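/- **Conventions.** All bicategories are small (the cells of each dimension form sets in a fixed universe); "functor" between bicategories means pseudofunctor (invertible constraints). If $F,G:B\to C$ are functors that agree on objects, an *icon* $\alpha:F\Rightarrow G$ is a family of natural transformations $\alpha_{ab}:F_{ab}\Rightarrow G_{ab}:B(a,b)\to C(Fa,Fb)$ compatible with the constraints: $\alpha_{1_a}\circ F_0=G_0$ and $\alpha_{f*g}\circ F_2=G_2\circ(\alpha_f*\alpha_g)$. $\mathbf{Icon}$ is the 2-category of bicategories, functors and icons, and $\mathbf{Gray}_{icon}$ is its locally full sub-2-category of (strict) 2-categories, 2-functors and icons; $i:\mathbf{Gray}_{icon}\to\mathbf{Icon}$ is the inclusion 2-functor. A *strongly monoidal 2-category* is a monoidal $\mathbf{Cat}$-enriched category: a 2-category $A$ with a 2-functor $\otimes:A\times A\to A$, an object $I$, and 2-natural isomorphisms $(x\otimes y)\otimes z\cong x\otimes(y\otimes z)$, $I\otimes x\cong x$, $x\otimes I\cong x$ satisfying the pentagon and triangle axioms. A *$\mathbf{Cat}$-lax monoidal functor* $A_1\to A_2$ between strongly monoidal 2-categories is a 2-functor $F$ with 1-cells $\chi_{x,y}:Fx\otimes_2Fy\to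 F(x\otimes_1y)$, 2-natural in $x,y$, and a 1-cell $\iota:I_2\to FI_1$, satisfying (as strict equations between 1-cells) the associativity axiom and the two unit axioms of a lax monoidal functor. For 2-categories $A,B$ the *Gray tensor product* $A\otimes B$ is the 2-category with objects $a\otimes b$; with 1-cells generated by $f\otimes 1:a\otimes b\to a'\otimes b$ ($f:a\to a'$ in $A$) and $1\otimes g:a\otimes b\to a\otimes b'$ ($g:b\to b'$ in $B$), subject to functoriality of $f\mapsto f\otimes1$ and $g\mapsto1\otimes g$; and with 2-cells generated by $\alpha\otimes1:f\otimes1\Rightarrow f'\otimes1$, $1\otimes\beta:1\otimes g\Rightarrow1\otimes g'$ and invertible $\Sigma_{f,g}:(f\otimes1)*(1\otimes g)\Rightarrow(1\otimes g)*(f\otimes1)$, subject to the axioms of a 2-category, to $\delta\mapsto\delta\otimes1$ and $\delta\mapsto1\otimes\delta$ being 2-functors, to naturality of $\Sigma_{f,g}$ in $f$ and in $g$ with respect to 2-cells, and to $\Sigma_{1,g}=1$, $\Sigma_{f,1}=1$, and $\Sigma_{f'*f,g}$, $\Sigma_{f,g'*g}$ being the evident pasted composites of $\Sigma_{f,g},\Sigma_{f',g}$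 and of $\Sigma_{f,g},\Sigma_{f,g'}$ (here $*$ is composition, right-hand factor first). A functor $H:A\times B\to D$ to a 2-category is *cubical* if it strictly preserves identity 1-cells (with identity unit constraints) and its comparison 2-cell $H(f_1,f_2)*H(g_1,g_2)\Rightarrow H(f_1*g_1,f_2*g_2)$ is an identity whenever $g_2$ or $f_1$ is an identity. Let $c=c_{A,B}:A\times B\to A\otimes B$ be the functor with $c(a,b)=a\otimes b$, $c(f,g)=(1\otimes g)*(f\otimes1)$ on 1-cells, acting correspondingly on 2-cells, with identity unit constraints and with composition constraint given by $\Sigma$. **Proposition.** There are 1. a strongly monoidal structure on $\mathbf{Icon}$ whose tensor product is the cartesian product $A\times B$ of bicategories, whose unit object is the terminal bicategory $1$, and whose action on 1-cells and 2-cells, associativity isomorphism and unit isomorphisms are the cartesian ones, i.e. those determined by the projections; 2. a strongly monoidal structure on $\mathbf{Gray}_{icon}$ whose tensor product on objects is the Gray tensor product $A\otimes B$ and whose unit object is the terminal 2-category $1$; 3. a $\mathbf{Cat}$-lax monoidal structure, with respect to these, on the inclusion $i:\mathbf{Gray}_{icon}\to\mathbf{Icon}$, with structure 1-cells $\chi_{A,B}=c_{A,B}:A\times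 B\to A\otimes B$ (in particular these are 2-natural with respect to 2-functors and icons) and with $\iota:1\to i(1)$ the identity. Moreover each $c_{A,B}$ is the universal cubical functor: it is cubical, and for every 2-category $D$, each cubical functor $A\times B\to D$ is $K\circ c_{A,B}$ for a unique 2-functor $K:A\otimes B\to D$. -/

import Mathlib

open CategoryTheory Bicategory

universe u

namespace GrayMon

section IconData

variable {A B C D : Type u} [Bicategory.{u, u} A] [Bicategory.{u, u} B] [Bicategory.{u, u} C]
  [Bicategory.{u, u} D]

/-- The underlying data of a lax functor with object map `o`: the functors `F_ab` between
hom-categories, and the constraint 2-cells, natural in the 1-cells. -/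
structure LaxData (o : B → C) where
  hom (a b : B) : (a ⟶ b) ⥤ (o a ⟶ o b)
  unit (a : B) : 𝟙 (o a) ⟶ (hom a a).obj (𝟙 a)
  comp {a b c : B} (f : a ⟶ b) (g : b ⟶ c) :
    (hom a b).obj f ≫ (hom b c).obj g ⟶ (hom a c).obj (f ≫ g)
  comp_left {a b c : B} {f f' : a ⟶ b} (η : f ⟶ f') (g : b ⟶ c) :
    (hom a b).map η ▷ (hom b c).obj g ≫ comp f' g = comp f g ≫ (hom a c).map (η ▷ g)
  comp_right {a b c : B} (f : a ⟶ b) {g g' : b ⟶ c} (θ : g ⟶ g') :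
    (hom a b).obj f ◁ (hom b c).map θ ≫ comp f g' = comp f g ≫ (hom a c).map (f ◁ θ)

/-- Icons between functors with the same object map `o`: natural transformations
`α_ab : F_ab ⟶ G_ab` which are compatible with the constraints. -/
structure IconOver {o : B → C} (F G : LaxData o) where
  nat (a b : B) : F.hom a b ⟶ G.hom a b
  unit (a : B) : F.unit a ≫ (nat a a).app (𝟙 a) = G.unit a
  comp {a b c : B} (f : a ⟶ b) (g : b ⟶ c) :
    F.comp f g ≫ (nat a c).app (f ≫ g) =
      ((nat a b).app f ▷ (F.hom b c).obj g ≫ (G.hom a b).obj f ◁ (nat b c).app g) ≫ G.comp f g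

theorem IconOver.ext_app {o : B → C} {F G : LaxData o} {α β : IconOver F G}
    (h : ∀ (a b : B) (f : a ⟶ b), (α.nat a b).app f = (β.nat a b).app f) : α = β := by
  cases α; cases β
  congr
  funext a b
  ext f
  exact h a b f

instance (o : B → C) : Category (LaxData o) where
  Hom F G := IconOver F G
  id F :=
    { nat := fun a b => 𝟙 (F.hom a b)
      unit := fun a => by simp
      comp := fun f g => by simp }
  comp {F G H} α β :=
    { nat := fun a b => α.nat a b ≫ β.nat a b
      unit := fun a => by
        rw [NatTrans.comp_app, ← Category.assoc, α.unit, β.unit]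
      comp := fun {a b c} f g => by
        rw [NatTrans.comp_app, ← Category.assoc, α.comp, Category.assoc, β.comp]
        simp only [Category.assoc, NatTrans.comp_app, comp_whiskerRight, whiskerLeft_comp]
        rw [whisker_exchange_assoc] }
  id_comp α := IconOver.ext_app fun a b f => Category.id_comp _
  comp_id α := IconOver.ext_app fun a b f => Category.comp_id _
  assoc α β γ := IconOver.ext_app fun a b f => Category.assoc _ _ _

/-- A functor with unspecified object map. Morphisms `F ⟶ G` in the disjoint union of the
categories `LaxData o` exist only if `F` and `G` agree on objects, and are icons then. -/
abbrev AnyLax (B C : Type u) [Bicategory.{u, u} B] [Bicategory.{u, u} C] : Type u :=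
  Σ o : B → C, LaxData o

/-- A pseudofunctor, regarded as a lax functor. -/
def lax (F : Pseudofunctor B C) : AnyLax B C :=
  ⟨F.obj,
    { hom := fun a b => { obj := F.map, map := F.map₂ }
      unit := fun a => (F.mapId a).inv
      comp := fun f g => (F.mapComp f g).inv
      comp_left := fun η g => by simp
      comp_right := fun f _ _ θ => by simp }⟩

theorem comp_square {X : Type u} [Category.{u} X] {a b c d e : X} {k : a ⟶ b} {m : b ⟶ c}
    {n' : c ⟶ d} {n : b ⟶ e} {m' : e ⟶ d} {v : a ⟶ e} (h : k ≫ n = v) (h' : m ≫ n' = n ≫ m') :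
    (k ≫ m) ≫ n' = v ≫ m' := by
  rw [Category.assoc, h', ← h, Category.assoc]

/-- Composition of functors, `F` first. -/
def compLax (F : AnyLax B C) (G : AnyLax C D) : AnyLax B D :=
  ⟨fun a => G.1 (F.1 a),
    { hom := fun a b => F.2.hom a b ⋙ G.2.hom (F.1 a) (F.1 b)
      unit := fun a => G.2.unit (F.1 a) ≫ (G.2.hom _ _).map (F.2.unit a)
      comp := fun f g => G.2.comp _ _ ≫ (G.2.hom _ _).map (F.2.comp f g)
      comp_left := fun η g => by
        dsimp only [Functor.comp_obj, Functor.comp_map]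
        rw [← Category.assoc, G.2.comp_left, Category.assoc, Category.assoc, ← Functor.map_comp,
          F.2.comp_left, Functor.map_comp]
      comp_right := fun f _ _ θ => by
        dsimp only [Functor.comp_obj, Functor.comp_map]
        rw [← Category.assoc, G.2.comp_right, Category.assoc, Category.assoc, ← Functor.map_comp,
          F.2.comp_right, Functor.map_comp] }⟩

theorem sigma_ext {o : B → C} {F G : LaxData o} {α β : F ⟶ G}
    (h : ∀ (a b : B) (f : a ⟶ b), (α.nat a b).app f = (β.nat a b).app f) :
    Sigma.SigmaHom.mk α = Sigma.SigmaHom.mk β :=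
  congrArg Sigma.SigmaHom.mk (IconOver.ext_app h)

/-- Whiskering of an icon `G ⇒ G'` with a functor `F` on the left: its component at `f` is the
component of the given icon at `F f`. -/
def preLax (F : AnyLax B C) : AnyLax C D ⥤ AnyLax B D where
  obj G := compLax F G
  map := fun
    | .mk α => .mk
      { nat := fun a b => Functor.whiskerLeft (F.2.hom a b) (α.nat (F.1 a) (F.1 b))
        unit := fun a => comp_square (α.unit (F.1 a)) ((α.nat _ _).naturality (F.2.unit a))
        comp := fun f g => (comp_square (α.comp ((F.2.hom _ _).obj f) ((F.2.hom _ _).obj g))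
          ((α.nat _ _).naturality (F.2.comp f g))).trans (Category.assoc _ _ _) }
  map_id G := sigma_ext fun a b f => rfl
  map_comp := by
    rintro _ _ _ ⟨α⟩ ⟨β⟩
    exact sigma_ext fun a b f => rfl

/-- Whiskering of an icon `F ⇒ F'` with a functor `H` on the right: its component at `f` is the
image under `H` of the component of the given icon at `f`. -/
def postLax (H : AnyLax C D) : AnyLax B C ⥤ AnyLax B D where
  obj F := compLax F H
  map := fun
    | .mk (X := F) (Y := G) α => .mk
      { nat := fun a b => Functor.whiskerRight (α.nat a b) (H.2.hom _ _)
        unit := fun a => by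
          exact (Category.assoc _ _ _).trans (congrArg _
            (((H.2.hom _ _).map_comp _ _).symm.trans (congrArg (H.2.hom _ _).map (α.unit a))))
        comp := fun {a b c} f g => by
          dsimp [compLax]
          rw [Category.assoc, ← Functor.map_comp, α.comp]
          simp only [Functor.map_comp, Category.assoc]
          rw [← reassoc_of% H.2.comp_left, ← reassoc_of% H.2.comp_right] }
  map_id F := sigma_ext fun a b f => (H.2.hom _ _).map_id _
  map_comp := by
    rintro _ _ _ ⟨α⟩ ⟨β⟩
    exact sigma_ext fun a b f => (H.2.hom _ _).map_comp _ _

/-- The invertible icon with identity components between two functors with the same action on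
0-, 1- and 2-cells and equal constraints. -/
def idIso {o : B → C} {h : ∀ a b : B, (a ⟶ b) ⥤ (o a ⟶ o b)}
    {k k' : ∀ a : B, 𝟙 (o a) ⟶ (h a a).obj (𝟙 a)}
    {m m' : ∀ {a b c : B} (f : a ⟶ b) (g : b ⟶ c),
      (h a b).obj f ≫ (h b c).obj g ⟶ (h a c).obj (f ≫ g)} {p q p' q'}
    (hk : ∀ a, k a = k' a)
    (hm : ∀ {a b c : B} (f : a ⟶ b) (g : b ⟶ c), m f g = m' f g) :
    (⟨o, ⟨h, k, m, p, q⟩⟩ : AnyLax B C) ≅ ⟨o, ⟨h, k', m', p', q'⟩⟩ :=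
  (Sigma.incl o).mapIso
    { hom :=
        { nat := fun _ _ => 𝟙 _
          unit := fun a => (Category.comp_id _).trans (hk a)
          comp := fun f g => by simp [hm] }
      inv :=
        { nat := fun _ _ => 𝟙 _
          unit := fun a => (Category.comp_id _).trans (hk a).symm
          comp := fun f g => by simp [hm] }
      hom_inv_id := IconOver.ext_app fun a b f => Category.id_comp _
      inv_hom_id := IconOver.ext_app fun a b f => Category.id_comp _ }

theorem comp_map_comp {X Y : Type u} [Category.{u} X] [Category.{u} Y] (P : X ⥤ Y) {a b c : X}
    {y : Y} (k : y ⟶ P.obj a) (m : a ⟶ b) (n : b ⟶ c) :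
    k ≫ P.map (m ≫ n) = (k ≫ P.map m) ≫ P.map n := by
  rw [P.map_comp, Category.assoc]

/-- Associativity of composition: an icon all of whose components are identities. -/
def assocLax (F : AnyLax A B) (G : AnyLax B C) (H : AnyLax C D) :
    compLax (compLax F G) H ≅ compLax F (compLax G H) :=
  idIso (h := fun a b => F.2.hom a b ⋙ G.2.hom _ _ ⋙ H.2.hom _ _)
    (fun _ => comp_map_comp (H.2.hom _ _) _ _ _)
    (fun _ _ => comp_map_comp (H.2.hom _ _) _ _ _)

/-- Left unitality of composition: an icon all of whose components are identities. -/
def leftLax (F : AnyLax B C) : compLax (lax (Pseudofunctor.id B)) F ≅ F :=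
  idIso (h := F.2.hom)
    (fun a => (congrArg (F.2.unit a ≫ ·) ((F.2.hom a a).map_id (𝟙 a))).trans (Category.comp_id _))
    (fun {a _ c} f g => (congrArg (F.2.comp f g ≫ ·) ((F.2.hom a c).map_id (f ≫ g))).trans
      (Category.comp_id _))

/-- Right unitality of composition: an icon all of whose components are identities. -/
def rightLax (F : AnyLax B C) : compLax F (lax (Pseudofunctor.id C)) ≅ F :=
  idIso (h := F.2.hom) (fun _ => Category.id_comp _) (fun _ _ => Category.id_comp _)

end IconData

/-- A small bicategory. These are the objects of the 2-category `Icon`. -/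
structure Icon : Type (u + 1) where
  carrier : Type u
  [str : Bicategory.{u, u} carrier]

attribute [instance] Icon.str

namespace Icon

instance : CategoryStruct Icon.{u} where
  Hom B C := Pseudofunctor B.carrier C.carrier
  id B := Pseudofunctor.id B.carrier
  comp F G := Pseudofunctor.comp F G

/-- The 2-cells of `Icon` from `F` to `G` are the icons `F ⇒ G`. -/
instance (B C : Icon.{u}) : Category (B ⟶ C) where
  Hom F G := lax F ⟶ lax G
  id F := 𝟙 (lax F)
  comp α β := Sigma.SigmaHom.comp α β
  id_comp α := Category.id_comp (obj := AnyLax B.carrier C.carrier) α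
  comp_id α := Category.comp_id (obj := AnyLax B.carrier C.carrier) α
  assoc α β γ := Category.assoc (obj := AnyLax B.carrier C.carrier) α β γ

/-- Invertible icons as invertible 2-cells of `Icon`. -/
def isoMk {B C : Icon.{u}} {F G : B ⟶ C} (e : lax F ≅ lax G) : F ≅ G :=
  ⟨e.hom, e.inv, e.hom_inv_id, e.inv_hom_id⟩

theorem id_whisker {B C : Type u} [Bicategory.{u, u} B] [Bicategory.{u, u} C] {F G : AnyLax B C}
    (α : F ⟶ G) : (preLax (lax (Pseudofunctor.id B))).map α =
      (leftLax F).hom ≫ α ≫ (leftLax G).inv := by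
  obtain ⟨α⟩ := α
  refine sigma_ext fun a b f => ?_
  exact ((Category.id_comp _).trans (Category.comp_id _)).symm

theorem whisker_id {B C : Type u} [Bicategory.{u, u} B] [Bicategory.{u, u} C] {F G : AnyLax B C}
    (α : F ⟶ G) : (postLax (lax (Pseudofunctor.id C))).map α =
      (rightLax F).hom ≫ α ≫ (rightLax G).inv := by
  obtain ⟨α⟩ := α
  refine sigma_ext fun a b f => ?_
  exact ((Category.id_comp _).trans (Category.comp_id _)).symm

theorem comp_whisker {A B C D : Type u} [Bicategory.{u, u} A] [Bicategory.{u, u} B]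
    [Bicategory.{u, u} C] [Bicategory.{u, u} D] (F : AnyLax A B) (G : AnyLax B C)
    {H K : AnyLax C D} (α : H ⟶ K) : (preLax (compLax F G)).map α =
      (assocLax F G H).hom ≫ (preLax F).map ((preLax G).map α) ≫ (assocLax F G K).inv := by
  obtain ⟨α⟩ := α
  refine sigma_ext fun a b f => ?_
  exact ((Category.id_comp _).trans (Category.comp_id _)).symm

theorem whisker_comp {A B C D : Type u} [Bicategory.{u, u} A] [Bicategory.{u, u} B]
    [Bicategory.{u, u} C] [Bicategory.{u, u} D] {F G : AnyLax A B} (α : F ⟶ G) (H : AnyLax B C)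
    (K : AnyLax C D) : (postLax (compLax H K)).map α =
      (assocLax F H K).inv ≫ (postLax K).map ((postLax H).map α) ≫ (assocLax G H K).hom := by
  obtain ⟨α⟩ := α
  refine sigma_ext fun a b f => ?_
  exact ((Category.id_comp _).trans (Category.comp_id _)).symm

theorem whisker_middle {A B C D : Type u} [Bicategory.{u, u} A] [Bicategory.{u, u} B]
    [Bicategory.{u, u} C] [Bicategory.{u, u} D] (F : AnyLax A B) {G H : AnyLax B C} (α : G ⟶ H)
    (K : AnyLax C D) : (postLax K).map ((preLax F).map α) =
      (assocLax F G K).hom ≫ (preLax F).map ((postLax K).map α) ≫ (assocLax F H K).inv := by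
  obtain ⟨α⟩ := α
  refine sigma_ext fun a b f => ?_
  exact ((Category.id_comp _).trans (Category.comp_id _)).symm

theorem exchange {A B C : Type u} [Bicategory.{u, u} A] [Bicategory.{u, u} B]
    [Bicategory.{u, u} C] {F G : AnyLax A B} {H K : AnyLax B C} (α : F ⟶ G) (β : H ⟶ K) :
    (preLax F).map β ≫ (postLax K).map α = (postLax H).map α ≫ (preLax G).map β := by
  obtain ⟨α⟩ := α
  obtain ⟨β⟩ := β
  refine sigma_ext fun a b f => ?_
  exact ((β.nat _ _).naturality _).symm

theorem pentagon_lax {A B C D E : Type u} [Bicategory.{u, u} A] [Bicategory.{u, u} B]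
    [Bicategory.{u, u} C] [Bicategory.{u, u} D] [Bicategory.{u, u} E] (F : AnyLax A B)
    (G : AnyLax B C) (H : AnyLax C D) (K : AnyLax D E) :
    (postLax K).map (assocLax F G H).hom ≫ (assocLax F (compLax G H) K).hom ≫
      (preLax F).map (assocLax G H K).hom =
    (assocLax (compLax F G) H K).hom ≫ (assocLax F G (compLax H K)).hom := by
  refine sigma_ext fun a b f => ?_
  have h : (K.2.hom _ _).map (𝟙 ((H.2.hom _ _).obj ((G.2.hom _ _).obj ((F.2.hom _ _).obj f)))) ≫
      𝟙 _ ≫ 𝟙 _ = 𝟙 _ ≫ 𝟙 _ := by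
    rw [(K.2.hom _ _).map_id, Category.id_comp]
  exact h

theorem triangle_lax {A B C : Type u} [Bicategory.{u, u} A] [Bicategory.{u, u} B]
    [Bicategory.{u, u} C] (F : AnyLax A B) (G : AnyLax B C) :
    (assocLax F (lax (Pseudofunctor.id B)) G).hom ≫ (preLax F).map (leftLax G).hom =
      (postLax G).map (rightLax F).hom := by
  refine sigma_ext fun a b f => ?_
  have h : 𝟙 ((G.2.hom _ _).obj ((F.2.hom _ _).obj f)) ≫ 𝟙 _ = (G.2.hom _ _).map (𝟙 _) := by
    rw [(G.2.hom _ _).map_id, Category.id_comp]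
  exact h

instance : Bicategory Icon.{u} where
  whiskerLeft F _ _ α := (preLax (lax F)).map α
  whiskerRight α H := (postLax (lax H)).map α
  associator F G H := isoMk (F := (F ≫ G) ≫ H) (G := F ≫ G ≫ H) (assocLax (lax F) (lax G) (lax H))
  leftUnitor F := isoMk (F := 𝟙 _ ≫ F) (G := F) (leftLax (lax F))
  rightUnitor F := isoMk (F := F ≫ 𝟙 _) (G := F) (rightLax (lax F))
  whiskerLeft_id F G := (preLax (lax F)).map_id _
  whiskerLeft_comp F _ _ _ α β := (preLax (lax F)).map_comp α β
  id_whiskerLeft α := id_whisker α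
  comp_whiskerLeft F G _ _ α := comp_whisker (lax F) (lax G) α
  id_whiskerRight F G := (postLax (lax G)).map_id _
  comp_whiskerRight α β H := (postLax (lax H)).map_comp α β
  whiskerRight_id α := whisker_id α
  whiskerRight_comp α G H := whisker_comp α (lax G) (lax H)
  whisker_assoc F _ _ α H := whisker_middle (lax F) α (lax H)
  whisker_exchange α β := exchange α β
  pentagon F G H K := pentagon_lax (lax F) (lax G) (lax H) (lax K)
  triangle F G := triangle_lax (lax F) (lax G)

theorem mk_eq_mk {B C : Type u} [Bicategory.{u, u} B] [Bicategory.{u, u} C]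
    {P : PrelaxFunctor B C} {i i'} {c c' : ∀ {x y z : B} (f : x ⟶ y) (g : y ⟶ z),
      P.map (f ≫ g) ≅ P.map f ≫ P.map g} {h₁ h₂ h₃ h₄ h₅ h₁' h₂' h₃' h₄' h₅'}
    (hi : ∀ a, (i a).hom = (i' a).hom)
    (hc : ∀ {x y z : B} (f : x ⟶ y) (g : y ⟶ z), (c f g).hom = (c' f g).hom) :
    Pseudofunctor.mk P i c h₁ h₂ h₃ h₄ h₅ = Pseudofunctor.mk P i' c' h₁' h₂' h₃' h₄' h₅' := by
  obtain rfl : i = i' := funext fun a => Iso.ext (hi a)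
  have : @c = @c' := by
    funext x y z f g
    exact Iso.ext (hc f g)
  subst this
  rfl

theorem eqToHom_eq {B C : Icon.{u}} {F G : B ⟶ C} (h : F = G) :
    eqToHom h = (eqToHom (congrArg lax h) : lax F ⟶ lax G) := by
  subst h; rfl

theorem lax_eqToHom {B C : Type u} [Bicategory.{u, u} B] [Bicategory.{u, u} C] {o : B → C}
    {F G : LaxData o} (α : F ⟶ G) (hα : ∀ (a b : B) (f : a ⟶ b), HEq ((α.nat a b).app f)
      (𝟙 ((F.hom a b).obj f)))
    (h : (⟨o, F⟩ : AnyLax B C) = ⟨o, G⟩) : Sigma.SigmaHom.mk α = eqToHom h := by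
  obtain rfl : F = G := eq_of_heq (Sigma.mk.inj h).2
  exact sigma_ext fun a b f => eq_of_heq (hα a b f)

theorem isoMk_eq {B C : Icon.{u}} {F G : B ⟶ C} (h : F = G) (e : lax F ≅ lax G)
    (he : e.hom = eqToHom (congrArg lax h)) : isoMk e = eqToIso h :=
  Iso.ext (he.trans (eqToHom_eq h).symm)

instance : Bicategory.Strict Icon.{u} where
  id_comp {A B} F := mk_eq_mk (P := F.toPrelaxFunctor) (fun a => by
      have h : F.map₂ (𝟙 (𝟙 a)) ≫ (F.mapId a).hom = (F.mapId a).hom := by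
        rw [F.map₂_id, Category.id_comp]
      exact h) (fun f g => by
      have h : F.map₂ (𝟙 (f ≫ g)) ≫ (F.mapComp f g).hom = (F.mapComp f g).hom := by
        rw [F.map₂_id, Category.id_comp]
      exact h)
  comp_id {A B} F := mk_eq_mk (P := F.toPrelaxFunctor) (fun a => Category.comp_id _)
    (fun f g => Category.comp_id _)
  assoc {A B C D} F G H := mk_eq_mk
    (P := (F.toPrelaxFunctor.comp G.toPrelaxFunctor).comp H.toPrelaxFunctor)
    (fun a => by
      have h : H.map₂ (G.map₂ (F.mapId a).hom ≫ (G.mapId (F.obj a)).hom) ≫ (H.mapId _).hom =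
          H.map₂ (G.map₂ (F.mapId a).hom) ≫ H.map₂ (G.mapId (F.obj a)).hom ≫ (H.mapId _).hom := by
        rw [H.map₂_comp, Category.assoc]
      exact h)
    (fun f g => by
      have h : H.map₂ (G.map₂ (F.mapComp f g).hom ≫ (G.mapComp _ _).hom) ≫ (H.mapComp _ _).hom =
          H.map₂ (G.map₂ (F.mapComp f g).hom) ≫ H.map₂ (G.mapComp _ _).hom ≫
            (H.mapComp _ _).hom := by
        rw [H.map₂_comp, Category.assoc]
      exact h)
  leftUnitor_eqToIso F := isoMk_eq _ _ (lax_eqToHom _ (fun _ _ _ => HEq.rfl) _)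
  rightUnitor_eqToIso F := isoMk_eq _ _ (lax_eqToHom _ (fun _ _ _ => HEq.rfl) _)
  associator_eqToIso F G H := isoMk_eq (F := (F ≫ G) ≫ H) (G := F ≫ G ≫ H) _ _
    (lax_eqToHom _ (fun _ _ _ => HEq.rfl) _)

end Icon

/-- A small 2-category. These are the objects of `GrayIcon`. -/
structure GrayIcon : Type (u + 1) where
  carrier : Type u
  [str : Bicategory.{u, u} carrier]
  [strict : Bicategory.Strict carrier]

attribute [instance] GrayIcon.str GrayIcon.strict

namespace GrayIcon

instance : CategoryStruct GrayIcon.{u} where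
  Hom B C := StrictPseudofunctor B.carrier C.carrier
  id B := StrictPseudofunctor.id B.carrier
  comp F G := StrictPseudofunctor.comp F G

/-- A 2-category, regarded as a bicategory. -/
abbrev toIcon (A : GrayIcon.{u}) : Icon.{u} := ⟨A.carrier⟩

/-- A 2-functor, regarded as a pseudofunctor. -/
def homToIcon {A B : GrayIcon.{u}} (F : A ⟶ B) : A.toIcon ⟶ B.toIcon := F.toPseudofunctor

instance (B C : GrayIcon.{u}) : Category (B ⟶ C) where
  Hom F G := homToIcon F ⟶ homToIcon G
  id F := 𝟙 (homToIcon F)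
  comp α β := CategoryStruct.comp (obj := B.toIcon ⟶ C.toIcon) α β
  id_comp α := Category.id_comp (obj := B.toIcon ⟶ C.toIcon) α
  comp_id α := Category.comp_id (obj := B.toIcon ⟶ C.toIcon) α
  assoc α β γ := Category.assoc (obj := B.toIcon ⟶ C.toIcon) α β γ

/-- Invertible icons between 2-functors as invertible 2-cells of `GrayIcon`. -/
def isoMk {B C : GrayIcon.{u}} {F G : B ⟶ C} (e : homToIcon F ≅ homToIcon G) : F ≅ G :=
  ⟨e.hom, e.inv, e.hom_inv_id, e.inv_hom_id⟩

instance : Bicategory GrayIcon.{u} where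
  whiskerLeft F _ _ α := homToIcon F ◁ α
  whiskerRight α H := Bicategory.whiskerRight (B := Icon.{u}) α (homToIcon H)
  associator F G H := isoMk (F := (F ≫ G) ≫ H) (G := F ≫ G ≫ H)
    (α_ (homToIcon F) (homToIcon G) (homToIcon H))
  leftUnitor F := isoMk (F := 𝟙 _ ≫ F) (G := F) (λ_ (homToIcon F))
  rightUnitor F := isoMk (F := F ≫ 𝟙 _) (G := F) (ρ_ (homToIcon F))
  whiskerLeft_id F G := Bicategory.whiskerLeft_id (homToIcon F) (homToIcon G)
  whiskerLeft_comp F _ _ _ α β := Bicategory.whiskerLeft_comp (B := Icon.{u}) (homToIcon F) α β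
  id_whiskerLeft α := Bicategory.id_whiskerLeft (B := Icon.{u}) α
  comp_whiskerLeft F G _ _ α :=
    Bicategory.comp_whiskerLeft (B := Icon.{u}) (homToIcon F) (homToIcon G) α
  id_whiskerRight F G := Bicategory.id_whiskerRight (homToIcon F) (homToIcon G)
  comp_whiskerRight α β H := Bicategory.comp_whiskerRight (B := Icon.{u}) α β (homToIcon H)
  whiskerRight_id α := Bicategory.whiskerRight_id (B := Icon.{u}) α
  whiskerRight_comp α G H :=
    Bicategory.whiskerRight_comp (B := Icon.{u}) α (homToIcon G) (homToIcon H)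
  whisker_assoc F _ _ α H :=
    Bicategory.whisker_assoc (B := Icon.{u}) (homToIcon F) α (homToIcon H)
  whisker_exchange α β := Bicategory.whisker_exchange (B := Icon.{u}) α β
  pentagon F G H K := Icon.pentagon_lax (lax F.toPseudofunctor) (lax G.toPseudofunctor)
    (lax H.toPseudofunctor) (lax K.toPseudofunctor)
  triangle F G := Icon.triangle_lax (lax F.toPseudofunctor) (lax G.toPseudofunctor)

theorem hom_ext {A B : GrayIcon.{u}} {F G : A ⟶ B} (h : homToIcon F = homToIcon G) : F = G := by
  obtain ⟨⟨F, _, _⟩, _, _⟩ := F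
  obtain ⟨⟨G, _, _⟩, _, _⟩ := G
  obtain rfl : F = G := h
  rfl

theorem isoMk_eq {A B : GrayIcon.{u}} {F G : A ⟶ B} (h : F = G) (e : homToIcon F ≅ homToIcon G)
    (he : e = eqToIso (congrArg homToIcon h)) : isoMk e = eqToIso h := by
  subst h; subst he; rfl

instance : Bicategory.Strict GrayIcon.{u} where
  id_comp F := hom_ext (Strict.id_comp (homToIcon F))
  comp_id F := hom_ext (Strict.comp_id (homToIcon F))
  assoc F G H := hom_ext (Strict.assoc (homToIcon F) (homToIcon G) (homToIcon H))
  leftUnitor_eqToIso {A _} F :=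
    isoMk_eq (F := 𝟙 A ≫ F) (G := F) _ _ (Strict.leftUnitor_eqToIso (homToIcon F))
  rightUnitor_eqToIso {_ B} F :=
    isoMk_eq (F := F ≫ 𝟙 B) (G := F) _ _ (Strict.rightUnitor_eqToIso (homToIcon F))
  associator_eqToIso F G H := isoMk_eq (F := (F ≫ G) ≫ H) (G := F ≫ G ≫ H) _ _
    (Strict.associator_eqToIso (homToIcon F) (homToIcon G) (homToIcon H))

/-- The inclusion 2-functor. -/
def incl : StrictPseudofunctor GrayIcon.{u} Icon.{u} := .mk''
  { obj := toIcon
    map := homToIcon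
    map₂ := fun α => α
    map₂_id := fun _ => rfl
    map₂_comp := fun _ _ => rfl
    map_id := fun _ => rfl
    map_comp := fun _ _ => rfl
    map₂_whisker_left := fun _ _ _ _ =>
      ((Category.id_comp _).trans (Category.comp_id _)).symm
    map₂_whisker_right := fun _ _ =>
      ((Category.id_comp _).trans (Category.comp_id _)).symm }

end GrayIcon

/-- The objects `a ⊗ b` of the Gray tensor product of `A` and `B`. -/
@[ext]
structure Gray (A B : Type u) where
  fst : A
  snd : B

namespace Gray

variable {A B : Type u} [Bicategory.{u, u} A] [Bicategory.{u, u} B]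

/-- Formal composites of the generating 1-cells `f ⊗ 1` and `1 ⊗ g`. -/
inductive Word : Gray A B → Gray A B → Type u
  | id (x : Gray A B) : Word x x
  | comp {x y z : Gray A B} (v : Word x y) (w : Word y z) : Word x z
  | left {a a' : A} (f : a ⟶ a') (b : B) : Word ⟨a, b⟩ ⟨a', b⟩
  | right (a : A) {b b' : B} (g : b ⟶ b') : Word ⟨a, b⟩ ⟨a, b'⟩

/-- The relations between 1-cells: the axioms of a category, and functoriality of `f ↦ f ⊗ 1` and
of `g ↦ 1 ⊗ g`. -/
inductive WordRel : ∀ {x y : Gray A B}, Word x y → Word x y → Prop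
  | comp_left {x y z : Gray A B} {v v' : Word x y} (w : Word y z) :
      WordRel v v' → WordRel (v.comp w) (v'.comp w)
  | comp_right {x y z : Gray A B} (v : Word x y) {w w' : Word y z} :
      WordRel w w' → WordRel (v.comp w) (v.comp w')
  | id_comp {x y : Gray A B} (w : Word x y) : WordRel ((Word.id x).comp w) w
  | comp_id {x y : Gray A B} (w : Word x y) : WordRel (w.comp (Word.id y)) w
  | assoc {x y z t : Gray A B} (v : Word x y) (w : Word y z) (k : Word z t) :
      WordRel ((v.comp w).comp k) (v.comp (w.comp k))
  | left_id (a : A) (b : B) : WordRel (.left (𝟙 a) b) (.id ⟨a, b⟩)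
  | left_comp {a a' a'' : A} (f : a ⟶ a') (f' : a' ⟶ a'') (b : B) :
      WordRel (.left (f ≫ f') b) (.comp (.left f b) (.left f' b))
  | right_id (a : A) (b : B) : WordRel (.right a (𝟙 b)) (.id ⟨a, b⟩)
  | right_comp (a : A) {b b' b'' : B} (g : b ⟶ b') (g' : b' ⟶ b'') :
      WordRel (.right a (g ≫ g')) (.comp (.right a g) (.right a g'))

/-- The 1-cells of the Gray tensor product: words modulo the relations. -/
instance : CategoryStruct (Gray A B) where
  Hom x y := Quot (WordRel (x := x) (y := y))
  id x := Quot.mk _ (.id x)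
  comp p q := Quot.map₂ Word.comp (fun v _ _ h => .comp_right v h) (fun _ _ w h => .comp_left w h)
    p q

theorem id_comp {x y : Gray A B} (p : x ⟶ y) : 𝟙 x ≫ p = p := by
  induction p using Quot.ind with
  | mk w => exact Quot.sound (.id_comp w)

theorem comp_id {x y : Gray A B} (p : x ⟶ y) : p ≫ 𝟙 y = p := by
  induction p using Quot.ind with
  | mk w => exact Quot.sound (.comp_id w)

theorem assoc {x y z t : Gray A B} (p : x ⟶ y) (q : y ⟶ z) (r : z ⟶ t) :
    (p ≫ q) ≫ r = p ≫ q ≫ r := by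
  induction p using Quot.ind with
  | mk v => induction q using Quot.ind with
    | mk w => induction r using Quot.ind with
      | mk k => exact Quot.sound (.assoc v w k)

/-- The generating 1-cell `f ⊗ 1`. -/
def left {a a' : A} (f : a ⟶ a') (b : B) : (⟨a, b⟩ : Gray A B) ⟶ ⟨a', b⟩ :=
  Quot.mk _ (.left f b)

/-- The generating 1-cell `1 ⊗ g`. -/
def right (a : A) {b b' : B} (g : b ⟶ b') : (⟨a, b⟩ : Gray A B) ⟶ ⟨a, b'⟩ :=
  Quot.mk _ (.right a g)

theorem left_id (a : A) (b : B) : left (𝟙 a) b = 𝟙 (⟨a, b⟩ : Gray A B) :=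
  Quot.sound (.left_id a b)

theorem left_comp {a a' a'' : A} (f : a ⟶ a') (f' : a' ⟶ a'') (b : B) :
    left (f ≫ f') b = left f b ≫ left f' b :=
  Quot.sound (.left_comp f f' b)

theorem right_id (a : A) (b : B) : right a (𝟙 b) = 𝟙 (⟨a, b⟩ : Gray A B) :=
  Quot.sound (.right_id a b)

theorem right_comp (a : A) {b b' b'' : B} (g : b ⟶ b') (g' : b' ⟶ b'') :
    right a (g ≫ g') = right a g ≫ right a g' :=
  Quot.sound (.right_comp a g g')

/-- Formal composites of the generating 2-cells `α ⊗ 1`, `1 ⊗ β`, `Σ_{f,g}` and `Σ_{f,g}⁻¹`.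
The 2-cell `ofEq h` is the identity of `p = q`. -/
inductive Cell : ∀ {x y : Gray A B}, (x ⟶ y) → (x ⟶ y) → Type u
  | ofEq {x y : Gray A B} {p q : x ⟶ y} (h : p = q) : Cell p q
  | vcomp {x y : Gray A B} {p q r : x ⟶ y} (s : Cell p q) (t : Cell q r) : Cell p r
  | whiskerLeft {x y z : Gray A B} (p : x ⟶ y) {q r : y ⟶ z} (s : Cell q r) :
      Cell (p ≫ q) (p ≫ r)
  | whiskerRight {x y z : Gray A B} {p q : x ⟶ y} (s : Cell p q) (r : y ⟶ z) :
      Cell (p ≫ r) (q ≫ r)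
  | left {a a' : A} {f f' : a ⟶ a'} (α : f ⟶ f') (b : B) : Cell (Gray.left f b) (Gray.left f' b)
  | right (a : A) {b b' : B} {g g' : b ⟶ b'} (β : g ⟶ g') :
      Cell (Gray.right a g) (Gray.right a g')
  | sigma {a a' : A} (f : a ⟶ a') {b b' : B} (g : b ⟶ b') :
      Cell (Gray.right a g ≫ Gray.left f b') (Gray.left f b ≫ Gray.right a' g)
  | sigmaInv {a a' : A} (f : a ⟶ a') {b b' : B} (g : b ⟶ b') :
      Cell (Gray.left f b ≫ Gray.right a' g) (Gray.right a g ≫ Gray.left f b')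

/-- The relations between 2-cells. -/
inductive CellRel : ∀ {x y : Gray A B} {p q : x ⟶ y}, Cell p q → Cell p q → Prop
  -- compatibility with the operations
  | vcomp_left {x y : Gray A B} {p q r : x ⟶ y} {s s' : Cell p q} (t : Cell q r) :
      CellRel s s' → CellRel (s.vcomp t) (s'.vcomp t)
  | vcomp_right {x y : Gray A B} {p q r : x ⟶ y} (s : Cell p q) {t t' : Cell q r} :
      CellRel t t' → CellRel (s.vcomp t) (s.vcomp t')
  | whiskerLeft {x y z : Gray A B} (p : x ⟶ y) {q r : y ⟶ z} {s s' : Cell q r} :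
      CellRel s s' → CellRel (s.whiskerLeft p) (s'.whiskerLeft p)
  | whiskerRight {x y z : Gray A B} {p q : x ⟶ y} {s s' : Cell p q} (r : y ⟶ z) :
      CellRel s s' → CellRel (s.whiskerRight r) (s'.whiskerRight r)
  -- the axioms of a 2-category
  | id_vcomp {x y : Gray A B} {p q : x ⟶ y} (s : Cell p q) : CellRel (.vcomp (.ofEq rfl) s) s
  | vcomp_id {x y : Gray A B} {p q : x ⟶ y} (s : Cell p q) : CellRel (.vcomp s (.ofEq rfl)) s
  | vcomp_assoc {x y : Gray A B} {p q r t : x ⟶ y} (s : Cell p q) (s' : Cell q r)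
      (s'' : Cell r t) : CellRel (.vcomp (.vcomp s s') s'') (.vcomp s (.vcomp s' s''))
  | whiskerLeft_id {x y z : Gray A B} (p : x ⟶ y) (q : y ⟶ z) :
      CellRel (.whiskerLeft p (.ofEq (rfl : q = q))) (.ofEq rfl)
  | whiskerLeft_vcomp {x y z : Gray A B} (p : x ⟶ y) {q r t : y ⟶ z} (s : Cell q r)
      (s' : Cell r t) :
      CellRel (.whiskerLeft p (.vcomp s s')) (.vcomp (.whiskerLeft p s) (.whiskerLeft p s'))
  | id_whiskerRight {x y z : Gray A B} (p : x ⟶ y) (q : y ⟶ z) :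
      CellRel (.whiskerRight (.ofEq (rfl : p = p)) q) (.ofEq rfl)
  | vcomp_whiskerRight {x y z : Gray A B} {p q r : x ⟶ y} (s : Cell p q) (s' : Cell q r)
      (t : y ⟶ z) :
      CellRel (.whiskerRight (.vcomp s s') t) (.vcomp (.whiskerRight s t) (.whiskerRight s' t))
  | id_whiskerLeft {x y : Gray A B} {p q : x ⟶ y} (s : Cell p q) :
      CellRel (.whiskerLeft (𝟙 x) s)
        (.vcomp (.ofEq (id_comp p)) (.vcomp s (.ofEq (id_comp q).symm)))
  | whiskerRight_id {x y : Gray A B} {p q : x ⟶ y} (s : Cell p q) :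
      CellRel (.whiskerRight s (𝟙 y))
        (.vcomp (.ofEq (comp_id p)) (.vcomp s (.ofEq (comp_id q).symm)))
  | comp_whiskerLeft {x y z t : Gray A B} (p : x ⟶ y) (q : y ⟶ z) {r r' : z ⟶ t}
      (s : Cell r r') :
      CellRel (.whiskerLeft (p ≫ q) s)
        (.vcomp (.ofEq (assoc p q r)) (.vcomp (.whiskerLeft p (.whiskerLeft q s))
          (.ofEq (assoc p q r').symm)))
  | whiskerRight_comp {x y z t : Gray A B} {p p' : x ⟶ y} (s : Cell p p') (q : y ⟶ z)
      (r : z ⟶ t) :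
      CellRel (.whiskerRight s (q ≫ r))
        (.vcomp (.ofEq (assoc p q r).symm) (.vcomp (.whiskerRight (.whiskerRight s q) r)
          (.ofEq (assoc p' q r))))
  | whisker_assoc {x y z t : Gray A B} (p : x ⟶ y) {q q' : y ⟶ z} (s : Cell q q')
      (r : z ⟶ t) :
      CellRel (.whiskerRight (.whiskerLeft p s) r)
        (.vcomp (.ofEq (assoc p q r)) (.vcomp (.whiskerLeft p (.whiskerRight s r))
          (.ofEq (assoc p q' r).symm)))
  | exchange {x y z : Gray A B} {p p' : x ⟶ y} {q q' : y ⟶ z} (s : Cell p p') (t : Cell q q') :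
      CellRel (.vcomp (.whiskerLeft p t) (.whiskerRight s q'))
        (.vcomp (.whiskerRight s q) (.whiskerLeft p' t))
  -- `δ ↦ δ ⊗ 1` is a 2-functor
  | left_id {a a' : A} (f : a ⟶ a') (b : B) : CellRel (.left (𝟙 f) b) (.ofEq rfl)
  | left_vcomp {a a' : A} {f f' f'' : a ⟶ a'} (α : f ⟶ f') (α' : f' ⟶ f'') (b : B) :
      CellRel (.left (α ≫ α') b) (.vcomp (.left α b) (.left α' b))
  | left_whiskerLeft {a a' a'' : A} (f : a ⟶ a') {k k' : a' ⟶ a''} (α : k ⟶ k') (b : B) :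
      CellRel (.left (f ◁ α) b)
        (.vcomp (.ofEq (left_comp f k b)) (.vcomp (.whiskerLeft (left f b) (.left α b))
          (.ofEq (left_comp f k' b).symm)))
  | left_whiskerRight {a a' a'' : A} {f f' : a ⟶ a'} (α : f ⟶ f') (k : a' ⟶ a'') (b : B) :
      CellRel (.left (α ▷ k) b)
        (.vcomp (.ofEq (left_comp f k b)) (.vcomp (.whiskerRight (.left α b) (left k b))
          (.ofEq (left_comp f' k b).symm)))
  -- `δ ↦ 1 ⊗ δ` is a 2-functor
  | right_id (a : A) {b b' : B} (g : b ⟶ b') : CellRel (.right a (𝟙 g)) (.ofEq rfl)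
  | right_vcomp (a : A) {b b' : B} {g g' g'' : b ⟶ b'} (β : g ⟶ g') (β' : g' ⟶ g'') :
      CellRel (.right a (β ≫ β')) (.vcomp (.right a β) (.right a β'))
  | right_whiskerLeft (a : A) {b b' b'' : B} (g : b ⟶ b') {k k' : b' ⟶ b''} (β : k ⟶ k') :
      CellRel (.right a (g ◁ β))
        (.vcomp (.ofEq (right_comp a g k)) (.vcomp (.whiskerLeft (right a g) (.right a β))
          (.ofEq (right_comp a g k').symm)))
  | right_whiskerRight (a : A) {b b' b'' : B} {g g' : b ⟶ b'} (β : g ⟶ g') (k : b' ⟶ b'') :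
      CellRel (.right a (β ▷ k))
        (.vcomp (.ofEq (right_comp a g k)) (.vcomp (.whiskerRight (.right a β) (right a k))
          (.ofEq (right_comp a g' k).symm)))
  -- `Σ` is invertible
  | sigma_sigmaInv {a a' : A} (f : a ⟶ a') {b b' : B} (g : b ⟶ b') :
      CellRel (.vcomp (.sigma f g) (.sigmaInv f g)) (.ofEq rfl)
  | sigmaInv_sigma {a a' : A} (f : a ⟶ a') {b b' : B} (g : b ⟶ b') :
      CellRel (.vcomp (.sigmaInv f g) (.sigma f g)) (.ofEq rfl)
  -- `Σ` is natural
  | sigma_natural_left {a a' : A} {f f' : a ⟶ a'} (α : f ⟶ f') {b b' : B} (g : b ⟶ b') :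
      CellRel (.vcomp (.whiskerLeft (right a g) (.left α b')) (.sigma f' g))
        (.vcomp (.sigma f g) (.whiskerRight (.left α b) (right a' g)))
  | sigma_natural_right {a a' : A} (f : a ⟶ a') {b b' : B} {g g' : b ⟶ b'} (β : g ⟶ g') :
      CellRel (.vcomp (.whiskerRight (.right a β) (left f b')) (.sigma f g'))
        (.vcomp (.sigma f g) (.whiskerLeft (left f b) (.right a' β)))
  -- `Σ` is compatible with identities and composition
  | sigma_id_left (a : A) {b b' : B} (g : b ⟶ b') :
      CellRel (.sigma (𝟙 a) g)
        (.ofEq (by rw [left_id, left_id, id_comp, comp_id]))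
  | sigma_id_right {a a' : A} (f : a ⟶ a') (b : B) :
      CellRel (.sigma f (𝟙 b))
        (.ofEq (by rw [right_id, right_id, id_comp, comp_id]))
  | sigma_comp_left {a a' a'' : A} (f : a ⟶ a') (f' : a' ⟶ a'') {b b' : B} (g : b ⟶ b') :
      CellRel (.sigma (f ≫ f') g)
        (.vcomp (.ofEq (by rw [left_comp, assoc]))
        (.vcomp (.whiskerRight (.sigma f g) (left f' b'))
        (.vcomp (.ofEq (assoc _ _ _))
        (.vcomp (.whiskerLeft (left f b) (.sigma f' g))
        (.ofEq (by rw [left_comp, assoc]))))))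
  | sigma_comp_right {a a' : A} (f : a ⟶ a') {b b' b'' : B} (g : b ⟶ b') (g' : b' ⟶ b'') :
      CellRel (.sigma f (g ≫ g'))
        (.vcomp (.ofEq (by rw [right_comp, assoc]))
        (.vcomp (.whiskerLeft (right a g) (.sigma f g'))
        (.vcomp (.ofEq (assoc _ _ _).symm)
        (.vcomp (.whiskerRight (.sigma f g) (right a' g'))
        (.ofEq (by rw [right_comp, assoc]))))))

/-- The 2-cells of the Gray tensor product. -/
instance (x y : Gray A B) : Category (x ⟶ y) where
  Hom p q := Quot (CellRel (p := p) (q := q))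
  id p := Quot.mk _ (.ofEq rfl)
  comp η θ := Quot.map₂ Cell.vcomp (fun s _ _ h => .vcomp_right s h)
    (fun _ _ t h => .vcomp_left t h) η θ
  id_comp η := by
    induction η using Quot.ind with
    | mk s => exact Quot.sound (.id_vcomp s)
  comp_id η := by
    induction η using Quot.ind with
    | mk s => exact Quot.sound (.vcomp_id s)
  assoc η θ ζ := by
    induction η using Quot.ind with
    | mk s => induction θ using Quot.ind with
      | mk t => induction ζ using Quot.ind with
        | mk r => exact Quot.sound (.vcomp_assoc s t r)

theorem ofEq_eq {x y : Gray A B} {p q : x ⟶ y} (h : p = q) :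
    (Quot.mk _ (.ofEq h) : p ⟶ q) = eqToHom h := by
  subst h; rfl

theorem whiskerLeft_eqToHom {x y z : Gray A B} (p : x ⟶ y) {q r : y ⟶ z} (h : q = r) :
    Quot.map (Cell.whiskerLeft p) (fun _ _ h => CellRel.whiskerLeft p h) (eqToHom h) =
      (eqToHom (congrArg (p ≫ ·) h) : p ≫ q ⟶ p ≫ r) := by
  subst h; exact Quot.sound (CellRel.whiskerLeft_id p q)

theorem eqToHom_whiskerRight {x y z : Gray A B} {p q : x ⟶ y} (h : p = q) (r : y ⟶ z) :
    Quot.map (fun s => Cell.whiskerRight s r) (fun _ _ h => CellRel.whiskerRight r h)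
      (eqToHom h) = (eqToHom (congrArg (· ≫ r) h) : p ≫ r ⟶ q ≫ r) := by
  subst h; exact Quot.sound (CellRel.id_whiskerRight p r)

/-- The Gray tensor product of 2-categories. -/
instance : Bicategory (Gray A B) where
  whiskerLeft p _ _ η := Quot.map (Cell.whiskerLeft p) (fun _ _ h => CellRel.whiskerLeft p h) η
  whiskerRight η r := Quot.map (fun s => Cell.whiskerRight s r) (fun _ _ h => CellRel.whiskerRight r h) η
  associator p q r := eqToIso (assoc p q r)
  leftUnitor p := eqToIso (id_comp p)
  rightUnitor p := eqToIso (comp_id p)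
  whiskerLeft_id p q := Quot.sound (CellRel.whiskerLeft_id p q)
  whiskerLeft_comp p _ _ _ η θ := by
    induction η using Quot.ind with
    | mk s => induction θ using Quot.ind with
      | mk t => exact Quot.sound (.whiskerLeft_vcomp p s t)
  id_whiskerLeft {_ _ p q} η := by
    induction η using Quot.ind with
    | mk s =>
      rw [eqToIso.hom, eqToIso.inv, ← ofEq_eq, ← ofEq_eq]
      exact Quot.sound (.id_whiskerLeft s)
  comp_whiskerLeft p q _ _ η := by
    induction η using Quot.ind with
    | mk s =>
      rw [eqToIso.hom, eqToIso.inv, ← ofEq_eq, ← ofEq_eq]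
      exact Quot.sound (.comp_whiskerLeft p q s)
  id_whiskerRight p q := Quot.sound (CellRel.id_whiskerRight p q)
  comp_whiskerRight η θ r := by
    induction η using Quot.ind with
    | mk s => induction θ using Quot.ind with
      | mk t => exact Quot.sound (.vcomp_whiskerRight s t r)
  whiskerRight_id η := by
    induction η using Quot.ind with
    | mk s =>
      rw [eqToIso.hom, eqToIso.inv, ← ofEq_eq, ← ofEq_eq]
      exact Quot.sound (.whiskerRight_id s)
  whiskerRight_comp η q r := by
    induction η using Quot.ind with
    | mk s =>
      rw [eqToIso.hom, eqToIso.inv, ← ofEq_eq, ← ofEq_eq]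
      exact Quot.sound (.whiskerRight_comp s q r)
  whisker_assoc p _ _ η r := by
    induction η using Quot.ind with
    | mk s =>
      rw [eqToIso.hom, eqToIso.inv, ← ofEq_eq, ← ofEq_eq]
      exact Quot.sound (.whisker_assoc p s r)
  whisker_exchange η θ := by
    induction η using Quot.ind with
    | mk s => induction θ using Quot.ind with
      | mk t => exact Quot.sound (.exchange s t)
  pentagon p q r t := by
    simp only [eqToIso.hom, eqToHom_whiskerRight, whiskerLeft_eqToHom, eqToHom_trans]
  triangle p q := by
    simp only [eqToIso.hom, eqToHom_whiskerRight, whiskerLeft_eqToHom, eqToHom_trans]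

instance : Bicategory.Strict (Gray A B) where
  id_comp := id_comp
  comp_id := comp_id
  assoc := assoc
  leftUnitor_eqToIso _ := rfl
  rightUnitor_eqToIso _ := rfl
  associator_eqToIso _ _ _ := rfl

/-- The generating 2-cell `α ⊗ 1`. -/
def left₂ {a a' : A} {f f' : a ⟶ a'} (α : f ⟶ f') (b : B) : left f b ⟶ left f' b :=
  Quot.mk _ (.left α b)

/-- The generating 2-cell `1 ⊗ β`. -/
def right₂ (a : A) {b b' : B} {g g' : b ⟶ b'} (β : g ⟶ g') : right a g ⟶ right a g' :=
  Quot.mk _ (.right a β)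

/-- The generating invertible 2-cell `Σ_{f,g}`. -/
def sigma {a a' : A} (f : a ⟶ a') {b b' : B} (g : b ⟶ b') :
    right a g ≫ left f b' ≅ left f b ≫ right a' g where
  hom := Quot.mk _ (.sigma f g)
  inv := Quot.mk _ (.sigmaInv f g)
  hom_inv_id := Quot.sound (.sigma_sigmaInv f g)
  inv_hom_id := Quot.sound (.sigmaInv_sigma f g)

/-- The identity `(f' f) ⊗ 1 = (f' ⊗ 1)(f ⊗ 1)` as an invertible 2-cell. -/
def leftComp {a a' a'' : A} (f : a ⟶ a') (f' : a' ⟶ a'') (b : B) :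
    left (f ≫ f') b ≅ left f b ≫ left f' b := eqToIso (left_comp f f' b)

/-- The identity `1 ⊗ (g' g) = (1 ⊗ g')(1 ⊗ g)` as an invertible 2-cell. -/
def rightComp (a : A) {b b' b'' : B} (g : b ⟶ b') (g' : b' ⟶ b'') :
    right a (g ≫ g') ≅ right a g ≫ right a g' := eqToIso (right_comp a g g')

/-- The identity `1 ⊗ 1 = 1` as an invertible 2-cell. -/
def leftId (a : A) (b : B) : left (𝟙 a) b ≅ 𝟙 (⟨a, b⟩ : Gray A B) := eqToIso (left_id a b)

/-- The identity `1 ⊗ 1 = 1` as an invertible 2-cell. -/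
def rightId (a : A) (b : B) : right a (𝟙 b) ≅ 𝟙 (⟨a, b⟩ : Gray A B) := eqToIso (right_id a b)

theorem left₂_id {a a' : A} (f : a ⟶ a') (b : B) : left₂ (𝟙 f) b = 𝟙 (left f b) :=
  Quot.sound (.left_id f b)

theorem left₂_comp {a a' : A} {f f' f'' : a ⟶ a'} (α : f ⟶ f') (α' : f' ⟶ f'') (b : B) :
    left₂ (α ≫ α') b = left₂ α b ≫ left₂ α' b :=
  Quot.sound (.left_vcomp α α' b)

theorem right₂_id (a : A) {b b' : B} (g : b ⟶ b') : right₂ a (𝟙 g) = 𝟙 (right a g) :=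
  Quot.sound (.right_id a g)

theorem right₂_comp (a : A) {b b' : B} {g g' g'' : b ⟶ b'} (β : g ⟶ g') (β' : g' ⟶ g'') :
    right₂ a (β ≫ β') = right₂ a β ≫ right₂ a β' :=
  Quot.sound (.right_vcomp a β β')

theorem left₂_eqToHom {a a' : A} {f f' : a ⟶ a'} (h : f = f') (b : B) :
    left₂ (eqToHom h) b = eqToHom (congrArg (left · b) h) := by
  subst h; exact left₂_id f b

theorem right₂_eqToHom (a : A) {b b' : B} {g g' : b ⟶ b'} (h : g = g') :
    right₂ a (eqToHom h) = eqToHom (congrArg (right a) h) := by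
  subst h; exact right₂_id a g

theorem left₂_whiskerLeft {a a' a'' : A} (f : a ⟶ a') {k k' : a' ⟶ a''} (α : k ⟶ k') (b : B) :
    left₂ (f ◁ α) b = (leftComp f k b).hom ≫ left f b ◁ left₂ α b ≫ (leftComp f k' b).inv := by
  rw [leftComp, leftComp, eqToIso.hom, eqToIso.inv, ← ofEq_eq, ← ofEq_eq]
  exact Quot.sound (.left_whiskerLeft f α b)

theorem left₂_whiskerRight {a a' a'' : A} {f f' : a ⟶ a'} (α : f ⟶ f') (k : a' ⟶ a'') (b : B) :
    left₂ (α ▷ k) b = (leftComp f k b).hom ≫ left₂ α b ▷ left k b ≫ (leftComp f' k b).inv := by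
  rw [leftComp, leftComp, eqToIso.hom, eqToIso.inv, ← ofEq_eq, ← ofEq_eq]
  exact Quot.sound (.left_whiskerRight α k b)

theorem right₂_whiskerLeft (a : A) {b b' b'' : B} (g : b ⟶ b') {k k' : b' ⟶ b''} (β : k ⟶ k') :
    right₂ a (g ◁ β) =
      (rightComp a g k).hom ≫ right a g ◁ right₂ a β ≫ (rightComp a g k').inv := by
  rw [rightComp, rightComp, eqToIso.hom, eqToIso.inv, ← ofEq_eq, ← ofEq_eq]
  exact Quot.sound (.right_whiskerLeft a g β)

theorem right₂_whiskerRight (a : A) {b b' b'' : B} {g g' : b ⟶ b'} (β : g ⟶ g') (k : b' ⟶ b'') :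
    right₂ a (β ▷ k) =
      (rightComp a g k).hom ≫ right₂ a β ▷ right a k ≫ (rightComp a g' k).inv := by
  rw [rightComp, rightComp, eqToIso.hom, eqToIso.inv, ← ofEq_eq, ← ofEq_eq]
  exact Quot.sound (.right_whiskerRight a β k)

theorem sigma_natural_left {a a' : A} {f f' : a ⟶ a'} (α : f ⟶ f') {b b' : B} (g : b ⟶ b') :
    right a g ◁ left₂ α b' ≫ (sigma f' g).hom = (sigma f g).hom ≫ left₂ α b ▷ right a' g :=
  Quot.sound (.sigma_natural_left α g)

theorem sigma_natural_right {a a' : A} (f : a ⟶ a') {b b' : B} {g g' : b ⟶ b'} (β : g ⟶ g') :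
    right₂ a β ▷ left f b' ≫ (sigma f g').hom = (sigma f g).hom ≫ left f b ◁ right₂ a' β :=
  Quot.sound (.sigma_natural_right f β)

theorem sigma_id_left (a : A) {b b' : B} (g : b ⟶ b') :
    (sigma (𝟙 a) g).hom = right a g ◁ (leftId a b').hom ≫ (ρ_ _).hom ≫ (λ_ _).inv ≫
      (leftId a b).inv ▷ right a g := by
  have h : (sigma (𝟙 a) g).hom =
      eqToHom (by rw [left_id, left_id, id_comp, comp_id]) := by
    rw [← ofEq_eq]; exact Quot.sound (.sigma_id_left a g)
  simp [h, leftId, Strict.rightUnitor_eqToIso, Strict.leftUnitor_eqToIso]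

theorem sigma_id_right {a a' : A} (f : a ⟶ a') (b : B) :
    (sigma f (𝟙 b)).hom = (rightId a b).hom ▷ left f b ≫ (λ_ _).hom ≫ (ρ_ _).inv ≫
      left f b ◁ (rightId a' b).inv := by
  have h : (sigma f (𝟙 b)).hom =
      eqToHom (by rw [right_id, right_id, id_comp, comp_id]) := by
    rw [← ofEq_eq]; exact Quot.sound (.sigma_id_right f b)
  simp [h, rightId, Strict.rightUnitor_eqToIso, Strict.leftUnitor_eqToIso]

theorem sigma_comp_left {a a' a'' : A} (f : a ⟶ a') (f' : a' ⟶ a'') {b b' : B} (g : b ⟶ b') :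
    (sigma (f ≫ f') g).hom = right a g ◁ (leftComp f f' b').hom ≫ (α_ _ _ _).inv ≫
      (sigma f g).hom ▷ left f' b' ≫ (α_ _ _ _).hom ≫ left f b ◁ (sigma f' g).hom ≫
      (α_ _ _ _).inv ≫ (leftComp f f' b).inv ▷ right a'' g := by
  have h : (sigma (f ≫ f') g).hom =
      eqToHom (by rw [left_comp, assoc]) ≫ (sigma f g).hom ▷ left f' b' ≫
        eqToHom (assoc _ _ _) ≫ left f b ◁ (sigma f' g).hom ≫
        eqToHom (by rw [left_comp, assoc]) := by
    rw [← ofEq_eq, ← ofEq_eq, ← ofEq_eq]; exact Quot.sound (.sigma_comp_left f f' g)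
  simp [h, leftComp, Strict.associator_eqToIso]

theorem sigma_comp_right {a a' : A} (f : a ⟶ a') {b b' b'' : B} (g : b ⟶ b') (g' : b' ⟶ b'') :
    (sigma f (g ≫ g')).hom = (rightComp a g g').hom ▷ left f b'' ≫ (α_ _ _ _).hom ≫
      right a g ◁ (sigma f g').hom ≫ (α_ _ _ _).inv ≫ (sigma f g).hom ▷ right a' g' ≫
      (α_ _ _ _).hom ≫ left f b ◁ (rightComp a' g g').inv := by
  have h : (sigma f (g ≫ g')).hom =
      eqToHom (by rw [right_comp, assoc]) ≫ right a g ◁ (sigma f g').hom ≫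
        eqToHom (assoc _ _ _).symm ≫ (sigma f g).hom ▷ right a' g' ≫
        eqToHom (by rw [right_comp, assoc]) := by
    rw [← ofEq_eq, ← ofEq_eq, ← ofEq_eq]; exact Quot.sound (.sigma_comp_right f g g')
  simp [h, rightComp, Strict.associator_eqToIso]

section Shuffle
variable {K : Type u} [Bicategory.{u, u} K]

/-- The composite 2-cell
`P ≫ Q = (L ≫ L') ≫ (N ≫ R') ≅ L ≫ (L' ≫ N) ≫ R' ≅ L ≫ (R ≫ M) ≫ R' ≅ (L ≫ R) ≫ (M ≫ R')`. -/
def shuffle {p q r s t v : K} {L : p ⟶ q} {L' : q ⟶ r} {R : q ⟶ s} {M : s ⟶ t} {N : r ⟶ t}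
    {R' : t ⟶ v} {P : p ⟶ r} {Q : r ⟶ v} (e : P ≅ L ≫ L') (e' : Q ≅ N ≫ R')
    (σ : R ≫ M ≅ L' ≫ N) : P ≫ Q ≅ (L ≫ R) ≫ (M ≫ R') :=
  whiskerRightIso e Q ≪≫ whiskerLeftIso (L ≫ L') e' ≪≫ α_ _ _ _ ≪≫
    whiskerLeftIso L ((α_ _ _ _).symm ≪≫ whiskerRightIso σ.symm R' ≪≫ α_ _ _ _) ≪≫
      (α_ _ _ _).symm

theorem shuffle_natural {p q r s t v : K} {L₁ L₂ : p ⟶ q} {L₁' L₂' : q ⟶ r} {R₁ R₂ : q ⟶ s}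
    {M₁ M₂ : s ⟶ t} {N₁ N₂ : r ⟶ t} {R₁' R₂' : t ⟶ v} {P₁ P₂ : p ⟶ r} {Q₁ Q₂ : r ⟶ v}
    {e₁ : P₁ ≅ L₁ ≫ L₁'} {e₁' : Q₁ ≅ N₁ ≫ R₁'} {σ₁ : R₁ ≫ M₁ ≅ L₁' ≫ N₁}
    {e₂ : P₂ ≅ L₂ ≫ L₂'} {e₂' : Q₂ ≅ N₂ ≫ R₂'} {σ₂ : R₂ ≫ M₂ ≅ L₂' ≫ N₂}
    (l : L₁ ⟶ L₂) (l' : L₁' ⟶ L₂') (r : R₁ ⟶ R₂) (m : M₁ ⟶ M₂) (n : N₁ ⟶ N₂) (r' : R₁' ⟶ R₂')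
    (h : (r ▷ M₁ ≫ R₂ ◁ m) ≫ σ₂.hom = σ₁.hom ≫ l' ▷ N₁ ≫ L₂' ◁ n) :
    (e₁.hom ≫ (l ▷ L₁' ≫ L₂ ◁ l') ≫ e₂.inv) ▷ Q₁ ≫ P₂ ◁ (e₁'.hom ≫ (n ▷ R₁' ≫ N₂ ◁ r') ≫ e₂'.inv) =
      (shuffle e₁ e₁' σ₁).hom ≫ ((l ▷ R₁ ≫ L₂ ◁ r) ▷ (M₁ ≫ R₁') ≫
        (L₂ ≫ R₂) ◁ (m ▷ R₁' ≫ M₂ ◁ r')) ≫ (shuffle e₂ e₂' σ₂).inv := by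
  have h' : (l' ▷ N₁ ≫ L₂' ◁ n) ≫ σ₂.inv = σ₁.inv ≫ r ▷ M₁ ≫ R₂ ◁ m := by
    rw [Iso.comp_inv_eq, Category.assoc, h, Iso.inv_hom_id_assoc]
  rw [← Category.assoc (shuffle e₁ e₁' σ₁).hom, Iso.eq_comp_inv]
  have hm : (l' ▷ (N₁ ≫ R₁') ≫ L₂' ◁ (n ▷ R₁' ≫ N₂ ◁ r')) ≫
      (α_ _ _ _).inv ≫ σ₂.inv ▷ R₂' ≫ (α_ _ _ _).hom =
      ((α_ _ _ _).inv ≫ σ₁.inv ▷ R₁' ≫ (α_ _ _ _).hom) ≫ r ▷ (M₁ ≫ R₁') ≫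
        R₂ ◁ (m ▷ R₁' ≫ M₂ ◁ r') := by
    calc
    _ = (α_ _ _ _).inv ≫ ((l' ▷ N₁ ≫ L₂' ◁ n) ▷ R₁' ≫ (L₂' ≫ N₂) ◁ r' ≫ σ₂.inv ▷ R₂') ≫
      (α_ _ _ _).hom := by simp
    _ = (α_ _ _ _).inv ≫ (((l' ▷ N₁ ≫ L₂' ◁ n) ≫ σ₂.inv) ▷ R₁' ≫ (R₂ ≫ M₂) ◁ r') ≫
      (α_ _ _ _).hom := by
      rw [whisker_exchange, comp_whiskerRight _ σ₂.inv]
      simp only [Category.assoc]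
    _ = _ := by rw [h']; simp
  calc
  _ = e₁.hom ▷ Q₁ ≫ (L₁ ≫ L₁') ◁ e₁'.hom ≫ (α_ _ _ _).hom ≫ l ▷ _ ≫
      L₂ ◁ ((l' ▷ (N₁ ≫ R₁') ≫ L₂' ◁ (n ▷ R₁' ≫ N₂ ◁ r')) ≫
      (α_ _ _ _).inv ≫ σ₂.inv ▷ R₂' ≫ (α_ _ _ _).hom) ≫ (α_ _ _ _).inv := by
    simp only [shuffle, Iso.trans_hom, whiskerRightIso_hom, whiskerLeftIso_hom, Category.assoc,
      Iso.symm_hom]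
    rw [whisker_exchange_assoc]
    simp only [comp_whiskerRight, whiskerLeft_comp, Category.assoc, inv_hom_whiskerRight_assoc,
      whiskerLeft_inv_hom_assoc]
    rw [← whisker_exchange_assoc, ← whisker_exchange_assoc]
    simp
  _ = _ := by
    rw [hm, whiskerLeft_comp L₂ (_ ≫ _ ≫ _), Category.assoc (L₂ ◁ _), ← whisker_exchange_assoc l]
    simp [shuffle]

theorem shuffle_leftUnitor {p q r : K} {U : p ⟶ p} {L : p ⟶ q} {V : p ⟶ p} {W : q ⟶ q}
    {R : q ⟶ r} {P : p ⟶ q} {Q : q ⟶ r} (e : P ≅ U ≫ L) (e' : Q ≅ W ≫ R)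
    (σ : V ≫ L ≅ L ≫ W) (u : U ≅ 𝟙 p) (v : V ≅ 𝟙 p) (w : W ≅ 𝟙 q)
    (h : σ.hom = v.hom ▷ L ≫ (λ_ L).hom ≫ (ρ_ L).inv ≫ L ◁ w.inv) :
    (e.hom ≫ u.hom ▷ L ≫ (λ_ L).hom) ▷ Q ≫ L ◁ (e'.hom ≫ w.hom ▷ R ≫ (λ_ R).hom) =
      (shuffle e e' σ).hom ≫ (u.hom ▷ V ≫ (λ_ V).hom ≫ v.hom) ▷ (L ≫ R) ≫ (λ_ (L ≫ R)).hom := by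
  obtain rfl : σ = whiskerRightIso v L ≪≫ λ_ L ≪≫ (ρ_ L).symm ≪≫ whiskerLeftIso L w.symm :=
    Iso.ext h
  calc
  _ = e.hom ▷ Q ≫ (U ≫ L) ◁ e'.hom ⊗≫ u.hom ▷ L ▷ (W ≫ R) ⊗≫ L ◁ w.hom ▷ R ⊗≫ 𝟙 _ := by
    have h₁ := whisker_exchange (u.hom ▷ L ≫ (λ_ L).hom) e'.hom
    rw [comp_whiskerRight, whiskerLeft_comp, Category.assoc, ← reassoc_of% h₁]
    bicategory
  _ = e.hom ▷ Q ≫ (U ≫ L) ◁ e'.hom ⊗≫ (u.hom ▷ (L ≫ W) ≫ 𝟙 p ◁ L ◁ w.hom) ▷ R ⊗≫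
      (v.inv ≫ v.hom) ▷ L ▷ R ⊗≫ 𝟙 _ := by
    rw [Iso.inv_hom_id]; bicategory
  _ = e.hom ▷ Q ≫ (U ≫ L) ◁ e'.hom ⊗≫ U ◁ L ◁ w.hom ▷ R ⊗≫
      (u.hom ▷ (𝟙 p) ≫ 𝟙 p ◁ v.inv) ▷ L ▷ R ⊗≫ v.hom ▷ L ▷ R ⊗≫ 𝟙 _ := by
    rw [← whisker_exchange]; bicategory
  _ = _ := by
    rw [← whisker_exchange]
    simp only [shuffle, Iso.trans_hom, whiskerRightIso_hom, whiskerLeftIso_hom, Iso.symm_hom,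
      Iso.trans_inv, whiskerRightIso_inv, whiskerLeftIso_inv, Iso.symm_inv]
    bicategory

theorem shuffle_rightUnitor {p q r : K} {U : q ⟶ q} {L : p ⟶ q} {U' : r ⟶ r} {W : r ⟶ r}
    {R : q ⟶ r} {P : p ⟶ q} {Q : q ⟶ r} (e : P ≅ L ≫ U) (e' : Q ≅ R ≫ W)
    (σ : R ≫ U' ≅ U ≫ R) (u : U ≅ 𝟙 q) (u' : U' ≅ 𝟙 r) (w : W ≅ 𝟙 r)
    (h : σ.hom = R ◁ u'.hom ≫ (ρ_ R).hom ≫ (λ_ R).inv ≫ u.inv ▷ R) :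
    (e.hom ≫ L ◁ u.hom ≫ (ρ_ L).hom) ▷ Q ≫ L ◁ (e'.hom ≫ R ◁ w.hom ≫ (ρ_ R).hom) =
      (shuffle e e' σ).hom ≫ (L ≫ R) ◁ (u'.hom ▷ W ≫ (λ_ W).hom ≫ w.hom) ≫
        (ρ_ (L ≫ R)).hom := by
  obtain rfl : σ = whiskerLeftIso R u' ≪≫ ρ_ R ≪≫ (λ_ R).symm ≪≫ whiskerRightIso u.symm R :=
    Iso.ext h
  calc
  _ = e.hom ▷ Q ≫ (L ≫ U) ◁ e'.hom ⊗≫ L ◁ u.hom ▷ R ▷ W ⊗≫ L ◁ R ◁ w.hom ⊗≫ 𝟙 _ := by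
    have h₁ := whisker_exchange (L ◁ u.hom ≫ (ρ_ L).hom) e'.hom
    rw [comp_whiskerRight, whiskerLeft_comp, Category.assoc, ← reassoc_of% h₁]
    bicategory
  _ = e.hom ▷ Q ≫ (L ≫ U) ◁ e'.hom ⊗≫ L ◁ u.hom ▷ R ▷ W ⊗≫
      L ◁ R ◁ (u'.inv ≫ u'.hom) ▷ W ⊗≫ L ◁ R ◁ w.hom ⊗≫ 𝟙 _ := by
    rw [Iso.inv_hom_id]; bicategory
  _ = _ := by
    simp only [shuffle, Iso.trans_hom, whiskerRightIso_hom, whiskerLeftIso_hom, Iso.symm_hom,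
      Iso.trans_inv, whiskerRightIso_inv, whiskerLeftIso_inv, Iso.symm_inv]
    bicategory

theorem shuffle_assoc {x₀₀ x₁₀ x₂₀ x₃₀ x₁₁ x₂₁ x₃₁ x₂₂ x₃₂ x₃₃ : K}
    {L₁ : x₀₀ ⟶ x₁₀} {L₂ : x₁₀ ⟶ x₂₀} {L₃ : x₂₀ ⟶ x₃₀} {L₂' : x₁₁ ⟶ x₂₁} {L₃' : x₂₁ ⟶ x₃₁}
    {L₃'' : x₂₂ ⟶ x₃₂} {R₁ : x₁₀ ⟶ x₁₁} {R₁' : x₂₀ ⟶ x₂₁} {R₁'' : x₃₀ ⟶ x₃₁}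
    {R₂ : x₂₁ ⟶ x₂₂} {R₂' : x₃₁ ⟶ x₃₂} {R₃ : x₃₂ ⟶ x₃₃}
    (σ₂₁ : R₁ ≫ L₂' ≅ L₂ ≫ R₁') (σ₃₁ : R₁' ≫ L₃' ≅ L₃ ≫ R₁'') (σ₃₂ : R₂ ≫ L₃'' ≅ L₃' ≫ R₂')
    {P₁₂ : x₀₀ ⟶ x₂₀} (h₁₂ : P₁₂ = L₁ ≫ L₂) {P₂₃ : x₁₀ ⟶ x₃₀} (h₂₃ : P₂₃ = L₂ ≫ L₃)
    {P₂₃' : x₁₁ ⟶ x₃₁} (h₂₃' : P₂₃' = L₂' ≫ L₃')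
    {P P' : x₀₀ ⟶ x₃₀} (hP : P = P₁₂ ≫ L₃) (hP' : P' = L₁ ≫ P₂₃)
    {Q₁₂ : x₂₀ ⟶ x₂₂} (k₁₂ : Q₁₂ = R₁' ≫ R₂) {Q₁₂' : x₃₀ ⟶ x₃₂} (k₁₂' : Q₁₂' = R₁'' ≫ R₂')
    {Q₂₃ : x₃₁ ⟶ x₃₃} (k₂₃ : Q₂₃ = R₂' ≫ R₃)
    {Q Q' : x₃₀ ⟶ x₃₃} (hQ : Q = Q₁₂' ≫ R₃) (hQ' : Q' = R₁'' ≫ Q₂₃)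
    (S : Q₁₂ ≫ L₃'' ≅ L₃ ≫ Q₁₂')
    (hS : S.hom = (eqToIso k₁₂).hom ▷ L₃'' ≫ (α_ _ _ _).hom ≫ R₁' ◁ σ₃₂.hom ≫ (α_ _ _ _).inv ≫
      σ₃₁.hom ▷ R₂' ≫ (α_ _ _ _).hom ≫ L₃ ◁ (eqToIso k₁₂').inv)
    (T : R₁ ≫ P₂₃' ≅ P₂₃ ≫ R₁'')
    (hT : T.hom = R₁ ◁ (eqToIso h₂₃').hom ≫ (α_ _ _ _).inv ≫ σ₂₁.hom ▷ L₃' ≫ (α_ _ _ _).hom ≫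
      L₂ ◁ σ₃₁.hom ≫ (α_ _ _ _).inv ≫ (eqToIso h₂₃).inv ▷ R₁'') :
    ((eqToIso hP).hom ≫ (eqToIso h₁₂).hom ▷ L₃ ≫ (α_ _ _ _).hom ≫ L₁ ◁ (eqToIso h₂₃).inv ≫
        (eqToIso hP').inv) ▷ Q ≫
      P' ◁ ((eqToIso hQ).hom ≫ (eqToIso k₁₂').hom ▷ R₃ ≫ (α_ _ _ _).hom ≫
        R₁'' ◁ (eqToIso k₂₃).inv ≫ (eqToIso hQ').inv) =
    (shuffle (eqToIso hP) (eqToIso hQ) S).hom ≫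
      (shuffle (eqToIso h₁₂) (eqToIso k₁₂) σ₂₁).hom ▷ (L₃'' ≫ R₃) ≫ (α_ _ _ _).hom ≫
      (L₁ ≫ R₁) ◁ (shuffle (eqToIso h₂₃') (eqToIso k₂₃) σ₃₂).inv ≫
      (shuffle (eqToIso hP') (eqToIso hQ') T).inv := by
  subst h₁₂ h₂₃ h₂₃' hP hP' k₁₂ k₁₂' k₂₃ hQ hQ'
  obtain rfl : S = α_ _ _ _ ≪≫ whiskerLeftIso R₁' σ₃₂ ≪≫ (α_ _ _ _).symm ≪≫
      whiskerRightIso σ₃₁ R₂' ≪≫ α_ _ _ _ := Iso.ext (by simpa using hS)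
  obtain rfl : T = (α_ _ _ _).symm ≪≫ whiskerRightIso σ₂₁ L₃' ≪≫ α_ _ _ _ ≪≫
      whiskerLeftIso L₂ σ₃₁ ≪≫ (α_ _ _ _).symm := Iso.ext (by simpa using hT)
  simp only [shuffle, eqToIso_refl, Iso.refl_hom, Iso.refl_inv, Iso.trans_hom, Iso.trans_inv,
    whiskerRightIso_hom, whiskerRightIso_inv, whiskerLeftIso_hom, whiskerLeftIso_inv,
    Iso.symm_hom, Iso.symm_inv]
  symm
  calc
  _ = 𝟙 _ ⊗≫ L₁ ◁ L₂ ◁ σ₃₁.inv ▷ R₂' ▷ R₃ ⊗≫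
      L₁ ◁ ((L₂ ≫ R₁') ◁ σ₃₂.inv ≫ σ₂₁.inv ▷ (R₂ ≫ L₃'')) ▷ R₃ ⊗≫
      L₁ ◁ (R₁ ≫ L₂') ◁ σ₃₂.hom ▷ R₃ ⊗≫ L₁ ◁ σ₂₁.hom ▷ L₃' ▷ R₂' ▷ R₃ ⊗≫
      L₁ ◁ L₂ ◁ σ₃₁.hom ▷ R₂' ▷ R₃ ⊗≫ 𝟙 _ := by bicategory
  _ = 𝟙 _ ⊗≫ L₁ ◁ L₂ ◁ σ₃₁.inv ▷ R₂' ▷ R₃ ⊗≫ L₁ ◁ σ₂₁.inv ▷ L₃' ▷ R₂' ▷ R₃ ⊗≫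
      L₁ ◁ (R₁ ≫ L₂') ◁ (σ₃₂.inv ≫ σ₃₂.hom) ▷ R₃ ⊗≫ L₁ ◁ σ₂₁.hom ▷ L₃' ▷ R₂' ▷ R₃ ⊗≫
      L₁ ◁ L₂ ◁ σ₃₁.hom ▷ R₂' ▷ R₃ ⊗≫ 𝟙 _ := by
    rw [whisker_exchange]; bicategory
  _ = 𝟙 _ ⊗≫ L₁ ◁ L₂ ◁ σ₃₁.inv ▷ R₂' ▷ R₃ ⊗≫ L₁ ◁ (σ₂₁.inv ≫ σ₂₁.hom) ▷ L₃' ▷ R₂' ▷ R₃ ⊗≫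
      L₁ ◁ L₂ ◁ σ₃₁.hom ▷ R₂' ▷ R₃ ⊗≫ 𝟙 _ := by
    rw [Iso.inv_hom_id]; bicategory
  _ = 𝟙 _ ⊗≫ L₁ ◁ L₂ ◁ (σ₃₁.inv ≫ σ₃₁.hom) ▷ R₂' ▷ R₃ ⊗≫ 𝟙 _ := by
    rw [Iso.inv_hom_id]; bicategory
  _ = _ := by
    rw [Iso.inv_hom_id]; bicategory
end Shuffle

theorem left₂_associator [Strict A] {a a' a'' a''' : A} (f : a ⟶ a') (f' : a' ⟶ a'')
    (f'' : a'' ⟶ a''') (b : B) :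
    left₂ (α_ f f' f'').hom b = (leftComp (f ≫ f') f'' b).hom ≫ (leftComp f f' b).hom ▷ _ ≫
      (α_ _ _ _).hom ≫ _ ◁ (leftComp f' f'' b).inv ≫ (leftComp f (f' ≫ f'') b).inv := by
  simp [leftComp, Strict.associator_eqToIso, left₂_eqToHom]

theorem left₂_leftUnitor [Strict A] {a a' : A} (f : a ⟶ a') (b : B) :
    left₂ (λ_ f).hom b = (leftComp (𝟙 a) f b).hom ≫ (leftId a b).hom ▷ _ ≫ (λ_ _).hom := by
  simp [leftComp, leftId, Strict.leftUnitor_eqToIso, left₂_eqToHom]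

theorem left₂_rightUnitor [Strict A] {a a' : A} (f : a ⟶ a') (b : B) :
    left₂ (ρ_ f).hom b = (leftComp f (𝟙 a') b).hom ≫ _ ◁ (leftId a' b).hom ≫ (ρ_ _).hom := by
  simp [leftComp, leftId, Strict.rightUnitor_eqToIso, left₂_eqToHom]

theorem right₂_associator [Strict B] (a : A) {b b' b'' b''' : B} (g : b ⟶ b') (g' : b' ⟶ b'')
    (g'' : b'' ⟶ b''') :
    right₂ a (α_ g g' g'').hom = (rightComp a (g ≫ g') g'').hom ≫ (rightComp a g g').hom ▷ _ ≫
      (α_ _ _ _).hom ≫ _ ◁ (rightComp a g' g'').inv ≫ (rightComp a g (g' ≫ g'')).inv := by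
  simp [rightComp, Strict.associator_eqToIso, right₂_eqToHom]

theorem right₂_leftUnitor [Strict B] (a : A) {b b' : B} (g : b ⟶ b') :
    right₂ a (λ_ g).hom = (rightComp a (𝟙 b) g).hom ≫ (rightId a b).hom ▷ _ ≫ (λ_ _).hom := by
  simp [rightComp, rightId, Strict.leftUnitor_eqToIso, right₂_eqToHom]

theorem right₂_rightUnitor [Strict B] (a : A) {b b' : B} (g : b ⟶ b') :
    right₂ a (ρ_ g).hom = (rightComp a g (𝟙 b')).hom ≫ _ ◁ (rightId a b').hom ≫ (ρ_ _).hom := by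
  simp [rightComp, rightId, Strict.rightUnitor_eqToIso, right₂_eqToHom]

theorem left_id_comp_right_id (a : A) (b : B) :
    left (𝟙 a) b ≫ right a (𝟙 b) = 𝟙 (⟨a, b⟩ : Gray A B) := by
  rw [left_id, right_id, id_comp]

theorem leftId_rightId (a : A) (b : B) :
    (leftId a b).hom ▷ right a (𝟙 b) ≫ (λ_ _).hom ≫ (rightId a b).hom =
      (eqToIso (left_id_comp_right_id a b)).hom := by
  simp [leftId, rightId, Strict.leftUnitor_eqToIso]

/-- The universal cubical functor `A × B ⟶ A ⊗ B`. It sends `(f, g)` to `(1 ⊗ g)(f ⊗ 1)`, it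
preserves identities, and its composition constraint is given by `Σ`. -/
def univCubical (A B : Type u) [Bicategory.{u, u} A] [Bicategory.{u, u} B] [Strict A] [Strict B] :
    Pseudofunctor (A × B) (Gray A B) where
  obj x := ⟨x.1, x.2⟩
  map {x y} f := left f.1 x.2 ≫ right y.1 f.2
  map₂ {x y f f'} α := left₂ α.1 x.2 ▷ right y.1 f.2 ≫ left f'.1 x.2 ◁ right₂ y.1 α.2
  map₂_id {x y} f := by
    have h : left₂ (𝟙 f.1) x.2 ▷ right y.1 f.2 ≫ left f.1 x.2 ◁ right₂ y.1 (𝟙 f.2) = 𝟙 _ := by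
      simp [left₂_id, right₂_id]
    exact h
  map₂_comp {x y f f' f''} α β := by
    have h : left₂ (α.1 ≫ β.1) x.2 ▷ right y.1 f.2 ≫ left f''.1 x.2 ◁ right₂ y.1 (α.2 ≫ β.2) =
        (left₂ α.1 x.2 ▷ right y.1 f.2 ≫ left f'.1 x.2 ◁ right₂ y.1 α.2) ≫
          left₂ β.1 x.2 ▷ right y.1 f'.2 ≫ left f''.1 x.2 ◁ right₂ y.1 β.2 := by
      simp only [left₂_comp, right₂_comp, comp_whiskerRight, whiskerLeft_comp, Category.assoc]
      rw [whisker_exchange_assoc]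
    exact h
  mapId x := eqToIso (left_id_comp_right_id x.1 x.2)
  mapComp {x y z} f g := shuffle (leftComp f.1 g.1 x.2) (rightComp z.1 f.2 g.2) (sigma g.1 f.2)
  map₂_whisker_left {x y z} f {g g'} η := by
    have h := shuffle_natural (e₁ := leftComp f.1 g.1 x.2) (e₁' := rightComp z.1 f.2 g.2)
      (σ₁ := sigma g.1 f.2) (e₂ := leftComp f.1 g'.1 x.2) (e₂' := rightComp z.1 f.2 g'.2)
      (σ₂ := sigma g'.1 f.2) (𝟙 _) (left₂ η.1 x.2) (𝟙 _) (left₂ η.1 y.2) (𝟙 _) (right₂ z.1 η.2)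
      (by simp [sigma_natural_left])
    simp only [id_whiskerRight, whiskerLeft_id, Category.id_comp, Category.comp_id,
      ← left₂_whiskerLeft, ← right₂_whiskerLeft] at h
    exact h
  map₂_whisker_right {x y z f f'} η g := by
    have h := shuffle_natural (e₁ := leftComp f.1 g.1 x.2) (e₁' := rightComp z.1 f.2 g.2)
      (σ₁ := sigma g.1 f.2) (e₂ := leftComp f'.1 g.1 x.2) (e₂' := rightComp z.1 f'.2 g.2)
      (σ₂ := sigma g.1 f'.2) (left₂ η.1 x.2) (𝟙 _) (right₂ y.1 η.2) (𝟙 _) (right₂ z.1 η.2) (𝟙 _)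
      (by simp [sigma_natural_right])
    simp only [id_whiskerRight, whiskerLeft_id, Category.comp_id,
      ← left₂_whiskerRight, ← right₂_whiskerRight] at h
    exact h
  map₂_associator {x y z t} f g h := by
    have h := shuffle_assoc (sigma g.1 f.2) (sigma h.1 f.2) (sigma h.1 g.2)
      (left_comp f.1 g.1 x.2) (left_comp g.1 h.1 x.2) (left_comp g.1 h.1 y.2)
      (left_comp (f.1 ≫ g.1) h.1 x.2) (left_comp f.1 (g.1 ≫ h.1) x.2)
      (right_comp z.1 f.2 g.2) (right_comp t.1 f.2 g.2) (right_comp t.1 g.2 h.2)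
      (right_comp t.1 (f.2 ≫ g.2) h.2) (right_comp t.1 f.2 (g.2 ≫ h.2))
      (sigma h.1 (f.2 ≫ g.2)) (sigma_comp_right _ _ _)
      (sigma (g.1 ≫ h.1) f.2) (sigma_comp_left _ _ _)
    refine Eq.trans ?_ h
    exact congrArg₂ (· ▷ _ ≫ _ ◁ ·) (left₂_associator _ _ _ _) (right₂_associator _ _ _ _)
  map₂_left_unitor {x y} f := by
    have h := shuffle_leftUnitor (leftComp (𝟙 x.1) f.1 x.2) (rightComp y.1 (𝟙 x.2) f.2)
      (sigma f.1 (𝟙 x.2)) (leftId x.1 x.2) (rightId x.1 x.2) (rightId y.1 x.2)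
      (sigma_id_right _ _)
    rw [← left₂_leftUnitor, ← right₂_leftUnitor] at h
    exact h.trans (congrArg (fun t => _ ≫ t ▷ _ ≫ _) (leftId_rightId _ _))
  map₂_right_unitor {x y} f := by
    have h := shuffle_rightUnitor (leftComp f.1 (𝟙 y.1) x.2) (rightComp y.1 f.2 (𝟙 y.2))
      (sigma (𝟙 y.1) f.2) (leftId y.1 x.2) (leftId y.1 y.2) (rightId y.1 y.2)
      (sigma_id_left _ _)
    rw [← left₂_rightUnitor, ← right₂_rightUnitor] at h
    exact h.trans (congrArg (fun t => _ ≫ _ ◁ t ≫ _) (leftId_rightId _ _))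

end Gray

section Monoidal

universe w v w' v' x x'

/-- A strongly monoidal 2-category (that is, a monoidal **Cat**-enriched category) with
underlying 2-category `K`, tensor product on objects `T` and unit object `I`. -/
structure StronglyMonoidal (K : Type x) [Bicategory.{w, v} K] [Strict K] (T : K → K → K)
    (I : K) where
  /-- The tensor product of 1-cells. -/
  map {a a' b b' : K} (f : a ⟶ a') (g : b ⟶ b') : T a b ⟶ T a' b'
  /-- The tensor product of 2-cells. -/
  map₂ {a a' b b' : K} {f f' : a ⟶ a'} {g g' : b ⟶ b'} (α : f ⟶ f') (β : g ⟶ g') :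
    map f g ⟶ map f' g'
  -- the tensor product is a 2-functor `K × K ⟶ K`
  map_id (a b : K) : map (𝟙 a) (𝟙 b) = 𝟙 (T a b)
  map_comp {a a' a'' b b' b'' : K} (f : a ⟶ a') (f' : a' ⟶ a'') (g : b ⟶ b') (g' : b' ⟶ b'') :
    map (f ≫ f') (g ≫ g') = map f g ≫ map f' g'
  map₂_id {a a' b b' : K} (f : a ⟶ a') (g : b ⟶ b') : map₂ (𝟙 f) (𝟙 g) = 𝟙 (map f g)
  map₂_comp {a a' b b' : K} {f f' f'' : a ⟶ a'} {g g' g'' : b ⟶ b'} (α : f ⟶ f')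
    (α' : f' ⟶ f'') (β : g ⟶ g') (β' : g' ⟶ g'') :
    map₂ (α ≫ α') (β ≫ β') = map₂ α β ≫ map₂ α' β'
  map₂_whiskerLeft {a a' a'' b b' b'' : K} (f : a ⟶ a') {k k' : a' ⟶ a''} (α : k ⟶ k')
    (g : b ⟶ b') {l l' : b' ⟶ b''} (β : l ⟶ l') :
    map₂ (f ◁ α) (g ◁ β) = eqToHom (map_comp f k g l) ≫ map f g ◁ map₂ α β ≫
      eqToHom (map_comp f k' g l').symm
  map₂_whiskerRight {a a' a'' b b' b'' : K} {f f' : a ⟶ a'} (α : f ⟶ f') (k : a' ⟶ a'')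
    {g g' : b ⟶ b'} (β : g ⟶ g') (l : b' ⟶ b'') :
    map₂ (α ▷ k) (β ▷ l) = eqToHom (map_comp f k g l) ≫ map₂ α β ▷ map k l ≫
      eqToHom (map_comp f' k g' l).symm
  /-- The associativity isomorphism. -/
  associator (a b c : K) : T (T a b) c ≅ T a (T b c)
  associator_natural {a a' b b' c c' : K} (f : a ⟶ a') (g : b ⟶ b') (h : c ⟶ c') :
    map (map f g) h ≫ (associator a' b' c').hom = (associator a b c).hom ≫ map f (map g h)
  associator_natural₂ {a a' b b' c c' : K} {f f' : a ⟶ a'} {g g' : b ⟶ b'} {h h' : c ⟶ c'}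
    (α : f ⟶ f') (β : g ⟶ g') (γ : h ⟶ h') :
    map₂ (map₂ α β) γ ▷ (associator a' b' c').hom = eqToHom (associator_natural f g h) ≫
      (associator a b c).hom ◁ map₂ α (map₂ β γ) ≫ eqToHom (associator_natural f' g' h').symm
  /-- The left unit isomorphism. -/
  leftUnitor (a : K) : T I a ≅ a
  leftUnitor_natural {a a' : K} (f : a ⟶ a') :
    map (𝟙 I) f ≫ (leftUnitor a').hom = (leftUnitor a).hom ≫ f
  leftUnitor_natural₂ {a a' : K} {f f' : a ⟶ a'} (α : f ⟶ f') :
    map₂ (𝟙 (𝟙 I)) α ▷ (leftUnitor a').hom = eqToHom (leftUnitor_natural f) ≫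
      (leftUnitor a).hom ◁ α ≫ eqToHom (leftUnitor_natural f').symm
  /-- The right unit isomorphism. -/
  rightUnitor (a : K) : T a I ≅ a
  rightUnitor_natural {a a' : K} (f : a ⟶ a') :
    map f (𝟙 I) ≫ (rightUnitor a').hom = (rightUnitor a).hom ≫ f
  rightUnitor_natural₂ {a a' : K} {f f' : a ⟶ a'} (α : f ⟶ f') :
    map₂ α (𝟙 (𝟙 I)) ▷ (rightUnitor a').hom = eqToHom (rightUnitor_natural f) ≫
      (rightUnitor a).hom ◁ α ≫ eqToHom (rightUnitor_natural f').symm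
  pentagon (a b c d : K) :
    map (associator a b c).hom (𝟙 d) ≫ (associator a (T b c) d).hom ≫
      map (𝟙 a) (associator b c d).hom =
    (associator (T a b) c d).hom ≫ (associator a b (T c d)).hom
  triangle (a b : K) :
    (associator a I b).hom ≫ map (𝟙 a) (leftUnitor b).hom = map (rightUnitor a).hom (𝟙 b)

/-- The structure of a **Cat**-lax monoidal functor on a 2-functor `F` between strongly monoidal
2-categories. -/
structure CatLaxMonoidal {K : Type x} [Bicategory.{w, v} K] [Strict K] {L : Type x'}
    [Bicategory.{w', v'} L] [Strict L] {T₁ : K → K → K} {I₁ : K} {T₂ : L → L → L} {I₂ : L}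
    (M₁ : StronglyMonoidal K T₁ I₁) (M₂ : StronglyMonoidal L T₂ I₂)
    (F : StrictPseudofunctor K L) where
  /-- The structure 1-cells. -/
  χ (a b : K) : T₂ (F.obj a) (F.obj b) ⟶ F.obj (T₁ a b)
  -- the structure 1-cells are 2-natural
  χ_natural {a a' b b' : K} (f : a ⟶ a') (g : b ⟶ b') :
    M₂.map (F.map f) (F.map g) ≫ χ a' b' = χ a b ≫ F.map (M₁.map f g)
  χ_natural₂ {a a' b b' : K} {f f' : a ⟶ a'} {g g' : b ⟶ b'} (α : f ⟶ f') (β : g ⟶ g') :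
    M₂.map₂ (F.map₂ α) (F.map₂ β) ▷ χ a' b' = eqToHom (χ_natural f g) ≫
      χ a b ◁ F.map₂ (M₁.map₂ α β) ≫ eqToHom (χ_natural f' g').symm
  /-- The unit 1-cell. -/
  ι : I₂ ⟶ F.obj I₁
  associativity (a b c : K) :
    M₂.map (χ a b) (𝟙 (F.obj c)) ≫ χ (T₁ a b) c ≫ F.map (M₁.associator a b c).hom =
      (M₂.associator (F.obj a) (F.obj b) (F.obj c)).hom ≫ M₂.map (𝟙 (F.obj a)) (χ b c) ≫
        χ a (T₁ b c)
  left_unit (a : K) :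
    M₂.map ι (𝟙 (F.obj a)) ≫ χ I₁ a ≫ F.map (M₁.leftUnitor a).hom =
      (M₂.leftUnitor (F.obj a)).hom
  right_unit (a : K) :
    M₂.map (𝟙 (F.obj a)) ι ≫ χ a I₁ ≫ F.map (M₁.rightUnitor a).hom =
      (M₂.rightUnitor (F.obj a)).hom

end Monoidal

namespace Icon

/-- The cartesian product of bicategories. -/
abbrev prod (A B : Icon.{u}) : Icon.{u} := ⟨A.carrier × B.carrier⟩

/-- The terminal bicategory. -/
abbrev unit : Icon.{u} := ⟨LocallyDiscrete (Discrete PUnit.{u + 1})⟩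

/-- The first projection. -/
def fst (A B : Icon.{u}) : prod A B ⟶ A := (Bicategory.Prod.fst A.carrier B.carrier).toPseudofunctor

/-- The second projection. -/
def snd (A B : Icon.{u}) : prod A B ⟶ B := (Bicategory.Prod.snd A.carrier B.carrier).toPseudofunctor

/-- A strongly monoidal structure on `Icon` with tensor product `prod` and unit `unit` is the
cartesian one if its tensor product of 1-cells and 2-cells, its associativity isomorphism and its
unit isomorphisms are those determined by the projections. -/
structure IsCartesian (M : StronglyMonoidal Icon.{u} prod unit) : Prop where
  map_fst {A A' B B' : Icon.{u}} (F : A ⟶ A') (G : B ⟶ B') : M.map F G ≫ fst A' B' = fst A B ≫ F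
  map_snd {A A' B B' : Icon.{u}} (F : A ⟶ A') (G : B ⟶ B') : M.map F G ≫ snd A' B' = snd A B ≫ G
  map₂_fst {A A' B B' : Icon.{u}} {F F' : A ⟶ A'} {G G' : B ⟶ B'} (α : F ⟶ F') (β : G ⟶ G') :
    M.map₂ α β ▷ fst A' B' = eqToHom (map_fst F G) ≫ fst A B ◁ α ≫ eqToHom (map_fst F' G').symm
  map₂_snd {A A' B B' : Icon.{u}} {F F' : A ⟶ A'} {G G' : B ⟶ B'} (α : F ⟶ F') (β : G ⟶ G') :
    M.map₂ α β ▷ snd A' B' = eqToHom (map_snd F G) ≫ snd A B ◁ β ≫ eqToHom (map_snd F' G').symm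
  associator_fst (A B C : Icon.{u}) :
    (M.associator A B C).hom ≫ fst A (prod B C) = fst (prod A B) C ≫ fst A B
  associator_snd_fst (A B C : Icon.{u}) :
    (M.associator A B C).hom ≫ snd A (prod B C) ≫ fst B C = fst (prod A B) C ≫ snd A B
  associator_snd_snd (A B C : Icon.{u}) :
    (M.associator A B C).hom ≫ snd A (prod B C) ≫ snd B C = snd (prod A B) C
  leftUnitor (A : Icon.{u}) : (M.leftUnitor A).hom = snd unit A
  rightUnitor (A : Icon.{u}) : (M.rightUnitor A).hom = fst A unit

end Icon

namespace GrayIcon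

/-- The Gray tensor product of 2-categories (in its pseudo version, with invertible `Σ`). -/
abbrev gray (A B : GrayIcon.{u}) : GrayIcon.{u} := ⟨Gray A.carrier B.carrier⟩

/-- The terminal 2-category. -/
abbrev unit : GrayIcon.{u} := ⟨LocallyDiscrete (Discrete PUnit.{u + 1})⟩

/-- A functor `H : A × B ⟶ D` between 2-categories is cubical if it strictly preserves identities
and if its comparison 2-cell for a composable pair `p : x ⟶ y`, `q : y ⟶ z` is an identity whenever
the second component of `p` or the first component of `q` is an identity. -/
structure IsCubical {A B D : GrayIcon.{u}} (H : Icon.prod A.toIcon B.toIcon ⟶ D.toIcon) : Prop where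
  mapId (x : A.carrier × B.carrier) : ∃ h, H.mapId x = eqToIso h
  mapComp_left {a a' : A.carrier} {b : B.carrier} {z : A.carrier × B.carrier} (f : a ⟶ a')
    (q : (a', b) ⟶ z) : ∃ h, H.mapComp (show (a, b) ⟶ (a', b) from Prod.mkHom f (𝟙 b)) q = eqToIso h
  mapComp_right {a : A.carrier} {b b' : B.carrier} {x : A.carrier × B.carrier} (p : x ⟶ (a, b))
    (g : b ⟶ b') : ∃ h, H.mapComp p (show (a, b) ⟶ (a, b') from Prod.mkHom (𝟙 a) g) = eqToIso h

/-- The universal cubical functor, as a 1-cell of `Icon`. By its universal property, its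
naturality determines the Gray tensor product of 2-functors and of icons. -/
def cubical (A B : GrayIcon.{u}) : Icon.prod A.toIcon B.toIcon ⟶ (gray A B).toIcon :=
  Gray.univCubical A.carrier B.carrier

/-- A cubical functor `c : A × B ⟶ E` is universal if composition with `c` is a bijection from the
2-functors `E ⟶ D` to the cubical functors `A × B ⟶ D`, for every 2-category `D`. -/
def IsUniversalCubical {A B E : GrayIcon.{u}} (c : Icon.prod A.toIcon B.toIcon ⟶ E.toIcon) : Prop :=
  IsCubical c ∧ ∀ (D : GrayIcon.{u}) (H : Icon.prod A.toIcon B.toIcon ⟶ D.toIcon), IsCubical H →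
    ∃! K : E ⟶ D, c ≫ homToIcon K = H

end GrayIcon
end GrayMon

/-!
The Gray tensor product `A ⊗ B` differs from the cartesian product only on 1-cells: the
projections `A ⊗ B ⟶ A` and `A ⊗ B ⟶ B` are jointly bijective on 0-cells and on the 2-cells
between any two parallel 1-cells (`Gray.proj_faithful`, `Gray.proj_full`). This is extracted from
the universal property of the cubical functor `c : A × B ⟶ A ⊗ B`. For existence, a cubical
functor `H` yields for every word in the generating 1-cells a comparison between the composite of
the values of `H` and the value of `H` on the composite; coherence and cubicality make it
independent of the word, and a 2-cell of `A ⊗ B` is sent to the conjugate by these comparisons of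
the value of `H` on the underlying 2-cell of `A × B` (`Gray.lift`). Uniqueness holds because the
generators of `A ⊗ B` are values or constraints of `c` (`Gray.univCubical_comp_injective`). The
identity of `A ⊗ B` is therefore induced by `c` itself, which shows that its 2-cells are
determined by their images in `A × B`.

Consequently an icon between functors into `A ⊗ B` is the same as a pair of icons between their
components (`JointlyFullyFaithful.icon_exists`, `JointlyFullyFaithful.icon_unique`), exactly as
for `A × B`, and two functors into `A ⊗ B` are equal once they agree on 1-cells and have the same
components (`JointlyFullyFaithful.pseudofunctor_ext`). The structure `Projections` collects what
is needed to deduce a strongly monoidal structure from this: all axioms on 2-cells and, up to a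
check on 1-cells, all equations between 1-cells can be verified after composition with the
projections (`Projections.toStronglyMonoidal`). For `Icon` there is nothing to check on 1-cells;
for `GrayIcon` the check is an evaluation on the generators `f ⊗ 1` and `1 ⊗ g`, since 2-functors
into `A ⊗ B` can be built from their components and a lift to 1-cells (`Gray.PairData.functor`).
As `c` is compatible with the projections of `A × B` and `A ⊗ B`, its 2-naturality and the axioms
of a lax monoidal functor follow in the same way.
-/

namespace GrayMon

/-! ### 2-functors from the Gray tensor product that send `Σ` to identities -/

section Strict
variable {K : Type*} [Bicategory K]

theorem congr_whiskerLeft {a b c : K} {f f' : a ⟶ b} (h : f = f') {g g' : b ⟶ c} (η : g ⟶ g') :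
    f ◁ η = eqToHom (by rw [h]) ≫ f' ◁ η ≫ eqToHom (by rw [h]) := by
  subst h; simp

theorem congr_whiskerRight {a b c : K} {f f' : a ⟶ b} (η : f ⟶ f') {g g' : b ⟶ c} (h : g = g') :
    η ▷ g = eqToHom (by rw [h]) ≫ η ▷ g' ≫ eqToHom (by rw [h]) := by
  subst h; simp

theorem id_comp_comp_id {X : Type*} [Category X] {x y : X} (f : x ⟶ y) : 𝟙 x ≫ f ≫ 𝟙 y = f := by
  simp

end Strict

namespace Gray

variable {A B D : Type u} [Bicategory.{u, u} A] [Bicategory.{u, u} B] [Bicategory.{u, u} D]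

/-- The values on 0-cells and on the generating 1-cells `f ⊗ 1` and `1 ⊗ g` of a functor from the
underlying category of `A ⊗ B`. -/
structure PathData (A B D : Type u) [Bicategory.{u, u} A] [Bicategory.{u, u} B]
    [Bicategory.{u, u} D] where
  obj : Gray A B → D
  left {a a' : A} (f : a ⟶ a') (b : B) : obj ⟨a, b⟩ ⟶ obj ⟨a', b⟩
  right (a : A) {b b' : B} (g : b ⟶ b') : obj ⟨a, b⟩ ⟶ obj ⟨a, b'⟩
  left_id (a : A) (b : B) : left (𝟙 a) b = 𝟙 _
  left_comp {a a' a'' : A} (f : a ⟶ a') (f' : a' ⟶ a'') (b : B) :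
    left (f ≫ f') b = left f b ≫ left f' b
  right_id (a : A) (b : B) : right a (𝟙 b) = 𝟙 _
  right_comp (a : A) {b b' b'' : B} (g : b ⟶ b') (g' : b' ⟶ b'') :
    right a (g ≫ g') = right a g ≫ right a g'

namespace PathData

variable (S : PathData A B D)

/-- The value on a word in the generating 1-cells. -/
def word : ∀ {x y : Gray A B}, Word x y → (S.obj x ⟶ S.obj y)
  | _, _, .id x => 𝟙 (S.obj x)
  | _, _, .comp v w => word v ≫ word w
  | _, _, .left f b => S.left f b
  | _, _, .right a g => S.right a g

theorem word_congr [Strict D] {x y : Gray A B} {v w : Word x y} (h : WordRel v w) :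
    S.word v = S.word w := by
  induction h with
  | comp_left w _ ih => exact congrArg (· ≫ S.word w) ih
  | comp_right v _ ih => exact congrArg (S.word v ≫ ·) ih
  | id_comp w => exact Strict.id_comp _
  | comp_id w => exact Strict.comp_id _
  | assoc v w k => exact Strict.assoc _ _ _
  | left_id a b => exact S.left_id a b
  | left_comp f f' b => exact S.left_comp f f' b
  | right_id a b => exact S.right_id a b
  | right_comp a g g' => exact S.right_comp a g g'

variable [Strict D]

/-- The action on the 1-cells of `A ⊗ B`, which are words modulo functoriality. -/
def map {x y : Gray A B} (p : x ⟶ y) : S.obj x ⟶ S.obj y :=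
  Quot.lift S.word (fun _ _ h => S.word_congr h) p

theorem map_id (x : Gray A B) : S.map (𝟙 x) = 𝟙 (S.obj x) := rfl

theorem map_comp {x y z : Gray A B} (p : x ⟶ y) (q : y ⟶ z) :
    S.map (p ≫ q) = S.map p ≫ S.map q := by
  induction p using Quot.ind with
  | mk v => induction q using Quot.ind with
    | mk w => rfl

/-- The functor from the underlying category of `A ⊗ B` determined by its values on generators. -/
def toFunctor [Strict A] [Strict B] : Gray A B ⥤ D where
  obj := S.obj
  map := S.map
  map_id := S.map_id
  map_comp := S.map_comp

end PathData

/-- The values on generators of a 2-functor from `A ⊗ B` to a 2-category that sends every `Σ` to an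
identity 2-cell. -/
structure CellData (A B D : Type u) [Bicategory.{u, u} A] [Bicategory.{u, u} B]
    [Bicategory.{u, u} D] extends PathData A B D where
  swap {a a' : A} (f : a ⟶ a') {b b' : B} (g : b ⟶ b') :
    right a g ≫ left f b' = left f b ≫ right a' g
  left₂ {a a' : A} {f f' : a ⟶ a'} (α : f ⟶ f') (b : B) : left f b ⟶ left f' b
  right₂ (a : A) {b b' : B} {g g' : b ⟶ b'} (β : g ⟶ g') : right a g ⟶ right a g'
  left₂_id {a a' : A} (f : a ⟶ a') (b : B) : left₂ (𝟙 f) b = 𝟙 _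
  left₂_comp {a a' : A} {f f' f'' : a ⟶ a'} (α : f ⟶ f') (α' : f' ⟶ f'') (b : B) :
    left₂ (α ≫ α') b = left₂ α b ≫ left₂ α' b
  left₂_whiskerLeft {a a' a'' : A} (f : a ⟶ a') {k k' : a' ⟶ a''} (α : k ⟶ k') (b : B) :
    left₂ (f ◁ α) b = eqToHom (left_comp f k b) ≫ left f b ◁ left₂ α b ≫
      eqToHom (left_comp f k' b).symm
  left₂_whiskerRight {a a' a'' : A} {f f' : a ⟶ a'} (α : f ⟶ f') (k : a' ⟶ a'') (b : B) :
    left₂ (α ▷ k) b = eqToHom (left_comp f k b) ≫ left₂ α b ▷ left k b ≫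
      eqToHom (left_comp f' k b).symm
  right₂_id (a : A) {b b' : B} (g : b ⟶ b') : right₂ a (𝟙 g) = 𝟙 _
  right₂_comp (a : A) {b b' : B} {g g' g'' : b ⟶ b'} (β : g ⟶ g') (β' : g' ⟶ g'') :
    right₂ a (β ≫ β') = right₂ a β ≫ right₂ a β'
  right₂_whiskerLeft (a : A) {b b' b'' : B} (g : b ⟶ b') {k k' : b' ⟶ b''} (β : k ⟶ k') :
    right₂ a (g ◁ β) = eqToHom (right_comp a g k) ≫ right a g ◁ right₂ a β ≫
      eqToHom (right_comp a g k').symm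
  right₂_whiskerRight (a : A) {b b' b'' : B} {g g' : b ⟶ b'} (β : g ⟶ g') (k : b' ⟶ b'') :
    right₂ a (β ▷ k) = eqToHom (right_comp a g k) ≫ right₂ a β ▷ right a k ≫
      eqToHom (right_comp a g' k).symm
  swap_natural_left {a a' : A} {f f' : a ⟶ a'} (α : f ⟶ f') {b b' : B} (g : b ⟶ b') :
    right a g ◁ left₂ α b' ≫ eqToHom (swap f' g) = eqToHom (swap f g) ≫ left₂ α b ▷ right a' g
  swap_natural_right {a a' : A} (f : a ⟶ a') {b b' : B} {g g' : b ⟶ b'} (β : g ⟶ g') :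
    right₂ a β ▷ left f b' ≫ eqToHom (swap f g') = eqToHom (swap f g) ≫ left f b ◁ right₂ a' β

namespace CellData

variable [Strict D] (S : CellData A B D)

theorem map_swap {a a' : A} (f : a ⟶ a') {b b' : B} (g : b ⟶ b') :
    S.map (Gray.right a g ≫ Gray.left f b') = S.map (Gray.left f b ≫ Gray.right a' g) :=
  S.swap f g

/-- The value on an expression for a 2-cell. -/
def cell : ∀ {x y : Gray A B} {p q : x ⟶ y}, Cell p q → (S.map p ⟶ S.map q)
  | _, _, _, _, .ofEq h => eqToHom (congrArg _ h)
  | _, _, _, _, .vcomp s t => cell s ≫ cell t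
  | _, _, _, _, .whiskerLeft p s =>
    eqToHom (S.map_comp _ _) ≫ S.map p ◁ cell s ≫ eqToHom (S.map_comp _ _).symm
  | _, _, _, _, .whiskerRight s r =>
    eqToHom (S.map_comp _ _) ≫ cell s ▷ S.map r ≫ eqToHom (S.map_comp _ _).symm
  | _, _, _, _, .left α b => S.left₂ α b
  | _, _, _, _, .right a β => S.right₂ a β
  | _, _, _, _, .sigma f g => eqToHom (S.map_swap f g)
  | _, _, _, _, .sigmaInv f g => eqToHom (S.map_swap f g).symm

attribute [local simp] Strict.associator_eqToIso Strict.leftUnitor_eqToIso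
  Strict.rightUnitor_eqToIso in
theorem cell_congr {x y : Gray A B} {p q : x ⟶ y} {s t : Cell p q} (h : CellRel s t) :
    S.cell s = S.cell t := by
  induction h with
  | vcomp_left t _ ih => simp [cell, ih]
  | vcomp_right t _ ih => simp [cell, ih]
  | whiskerLeft p _ ih => simp [cell, ih]
  | whiskerRight p _ ih => simp [cell, ih]
  | id_vcomp s => simp [cell]
  | vcomp_id s => simp [cell]
  | vcomp_assoc s t r => simp [cell]
  | whiskerLeft_id p q => simp [cell]
  | whiskerLeft_vcomp p s t => simp [cell]
  | id_whiskerRight p q => simp [cell]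
  | vcomp_whiskerRight s t p => simp [cell]
  | id_whiskerLeft s => simp [cell, congr_whiskerLeft (S.map_id _)]
  | whiskerRight_id s => simp [cell, congr_whiskerRight _ (S.map_id _)]
  | comp_whiskerLeft p q s => simp [cell, congr_whiskerLeft (S.map_comp p q)]
  | whiskerRight_comp s q r => simp [cell, congr_whiskerRight _ (S.map_comp q r)]
  | whisker_assoc p s r => simp [cell]
  | exchange s t => simp [cell, whisker_exchange_assoc]
  | left_id f b => exact S.left₂_id f b
  | left_vcomp α α' b => exact S.left₂_comp α α' b
  | left_whiskerLeft f α b =>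
    exact (S.left₂_whiskerLeft f α b).trans
      (congrArg (eqToHom _ ≫ · ≫ eqToHom _) (id_comp_comp_id _).symm)
  | left_whiskerRight α k b =>
    exact (S.left₂_whiskerRight α k b).trans
      (congrArg (eqToHom _ ≫ · ≫ eqToHom _) (id_comp_comp_id _).symm)
  | right_id f b => exact S.right₂_id f b
  | right_vcomp a β β' => exact S.right₂_comp a β β'
  | right_whiskerLeft a g β =>
    exact (S.right₂_whiskerLeft a g β).trans
      (congrArg (eqToHom _ ≫ · ≫ eqToHom _) (id_comp_comp_id _).symm)
  | right_whiskerRight a β k =>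
    exact (S.right₂_whiskerRight a β k).trans
      (congrArg (eqToHom _ ≫ · ≫ eqToHom _) (id_comp_comp_id _).symm)
  | sigma_sigmaInv f g => simp [cell]
  | sigmaInv_sigma f g => simp [cell]
  | sigma_natural_left α g =>
    exact (congrArg (· ≫ eqToHom _) (id_comp_comp_id _)).trans ((S.swap_natural_left α g).trans
      (congrArg (eqToHom _ ≫ ·) (id_comp_comp_id _).symm))
  | sigma_natural_right f β =>
    exact (congrArg (· ≫ eqToHom _) (id_comp_comp_id _)).trans ((S.swap_natural_right f β).trans
      (congrArg (eqToHom _ ≫ ·) (id_comp_comp_id _).symm))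
  | sigma_id_left a g => simp [cell]
  | sigma_id_right a g => simp [cell]
  | sigma_comp_left f f' g =>
    simp only [cell, Bicategory.whiskerLeft_eqToHom, Bicategory.eqToHom_whiskerRight]
    repeat erw [eqToHom_trans]
  | sigma_comp_right f g g' =>
    simp only [cell, Bicategory.whiskerLeft_eqToHom, Bicategory.eqToHom_whiskerRight]
    repeat erw [eqToHom_trans]

/-- The action on 2-cells. -/
def map₂ {x y : Gray A B} {p q : x ⟶ y} (s : p ⟶ q) : S.map p ⟶ S.map q :=
  Quot.lift S.cell (fun _ _ h => S.cell_congr h) s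

/-- The 2-functor determined by its values on generators. -/
def functor : StrictPseudofunctor (Gray A B) D := .mk''
  { obj := S.obj
    map := S.map
    map₂ := S.map₂
    map₂_id := fun _ => rfl
    map₂_comp := fun s t => by
      induction s using Quot.ind with
      | mk s => induction t using Quot.ind with
        | mk t => rfl
    map_id := S.map_id
    map_comp := S.map_comp
    map₂_whisker_left := fun p _ _ s => by
      induction s using Quot.ind with
      | mk s => rfl
    map₂_whisker_right := fun s p => by
      induction s using Quot.ind with
      | mk s => rfl }

end CellData

variable (A B) in
/-- The projection `A ⊗ B ⟶ A`. It sends every `1 ⊗ g` and every `Σ` to an identity. -/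
def proj₁ [Strict A] : StrictPseudofunctor (Gray A B) A := CellData.functor
  { obj := fun x => x.fst
    left := fun f _ => f
    right := fun a _ _ _ => 𝟙 a
    left_id := fun _ _ => rfl
    left_comp := fun _ _ _ => rfl
    right_id := fun _ _ => rfl
    right_comp := fun _ _ _ _ _ _ => (Strict.id_comp _).symm
    swap := fun f _ _ _ => (Strict.id_comp f).trans (Strict.comp_id f).symm
    left₂ := fun α _ => α
    right₂ := fun a _ _ _ _ _ => 𝟙 (𝟙 a)
    left₂_id := fun _ _ => rfl
    left₂_comp := fun _ _ _ => rfl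
    left₂_whiskerLeft := fun _ _ _ _ _ => by simp
    left₂_whiskerRight := fun _ _ _ => by simp
    right₂_id := fun _ _ => by simp
    right₂_comp := fun _ _ => by simp
    right₂_whiskerLeft := fun _ _ => by simp
    right₂_whiskerRight := fun _ _ => by simp
    swap_natural_left := fun α _ _ _ => by
      simp [Strict.leftUnitor_eqToIso, Strict.rightUnitor_eqToIso]
    swap_natural_right := fun α _ _ _ => by simp }

variable (A B) in
/-- The projection `A ⊗ B ⟶ B`. It sends every `f ⊗ 1` and every `Σ` to an identity. -/
def proj₂ [Strict B] : StrictPseudofunctor (Gray A B) B := CellData.functor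
  { obj := fun x => x.snd
    left := fun _ b => 𝟙 b
    right := fun _ _ _ g => g
    left_id := fun _ _ => rfl
    left_comp := fun _ _ _ => (Strict.id_comp _).symm
    right_id := fun _ _ => rfl
    right_comp := fun _ _ _ _ _ _ => rfl
    swap := fun _ _ _ g => (Strict.comp_id g).trans (Strict.id_comp g).symm
    left₂ := fun _ b => 𝟙 (𝟙 b)
    right₂ := fun _ _ _ _ _ β => β
    left₂_id := fun _ _ => rfl
    left₂_comp := fun _ _ _ => by simp
    left₂_whiskerLeft := fun _ _ _ _ _ => by simp
    left₂_whiskerRight := fun _ _ _ => by simp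
    right₂_id := fun _ _ => by simp
    right₂_comp := fun _ _ => by simp
    right₂_whiskerLeft := fun _ _ => by simp
    right₂_whiskerRight := fun _ _ => by simp
    swap_natural_left := fun α _ _ _ => by simp
    swap_natural_right := fun α _ _ _ => by
      simp [Strict.leftUnitor_eqToIso, Strict.rightUnitor_eqToIso] }

end Gray

/-! ### Comparison isomorphisms for a functor along composites -/

section Comb

theorem iso_heq {X : Type*} [Category X] {a b a' b' : X} (ha : a = a') (hb : b = b')
    {s : a ≅ b} {t : a' ≅ b'} (h : HEq s.hom t.hom) : HEq s t := by
  subst ha hb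
  exact heq_of_eq (Iso.ext (eq_of_heq h))

theorem conj_eqToHom_heq {X : Type*} [Category X] {a b a' b' : X} (ha : a' = a) (hb : b = b')
    (f : a ⟶ b) : HEq (eqToHom ha ≫ f ≫ eqToHom hb) f := by
  subst ha hb
  simp

variable {X D : Type u} [Bicategory.{u, u} X] [Bicategory.{u, u} D] (H : Pseudofunctor X D)

/-- If `k` and `l` are isomorphic to the values of a functor on `p` and `q`, then `k ≫ l` is
isomorphic to its value on `p ≫ q`. -/
def combine {x y z : X} {k : H.obj x ⟶ H.obj y} {l : H.obj y ⟶ H.obj z} {p : x ⟶ y} {q : y ⟶ z}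
    (s : k ≅ H.map p) (t : l ≅ H.map q) : k ≫ l ≅ H.map (p ≫ q) :=
  whiskerRightIso s l ≪≫ whiskerLeftIso (H.map p) t ≪≫ (H.mapComp p q).symm

theorem combine_congr {x y z : X} {k k' : H.obj x ⟶ H.obj y} {l l' : H.obj y ⟶ H.obj z}
    {p p' : x ⟶ y} {q q' : y ⟶ z} {s : k ≅ H.map p} {t : l ≅ H.map q} {s' : k' ≅ H.map p'}
    {t' : l' ≅ H.map q'} (hk : k = k') (hl : l = l') (hp : p = p') (hq : q = q') (hs : HEq s s')
    (ht : HEq t t') : HEq (combine H s t) (combine H s' t') := by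
  subst hk hl hp hq hs ht
  rfl

theorem combine_refl {x y z : X} (p : x ⟶ y) (q : y ⟶ z) :
    combine H (Iso.refl (H.map p)) (Iso.refl (H.map q)) = (H.mapComp p q).symm :=
  Iso.ext (by simp [combine])

theorem combine_eqToIso {x y z : X} {k : H.obj x ⟶ H.obj y} {l : H.obj y ⟶ H.obj z}
    {p : x ⟶ y} {q : y ⟶ z} (s : k = H.map p) (t : l = H.map q) :
    HEq (combine H (eqToIso s) (eqToIso t)) (H.mapComp p q).symm := by
  subst s t
  exact heq_of_eq (combine_refl H p q)

theorem combine_whiskerLeft {x y z : X} {k : H.obj x ⟶ H.obj y} {l l' : H.obj y ⟶ H.obj z}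
    {p : x ⟶ y} {q q' : y ⟶ z} (s : k ≅ H.map p) (t : l ≅ H.map q) (t' : l' ≅ H.map q')
    (θ : q ⟶ q') :
    (combine H s t).hom ≫ H.map₂ (p ◁ θ) ≫ (combine H s t').inv =
      k ◁ (t.hom ≫ H.map₂ θ ≫ t'.inv) := by
  simp only [combine, Iso.trans_hom, whiskerRightIso_hom, whiskerLeftIso_hom, Iso.symm_hom,
    Iso.trans_inv, whiskerRightIso_inv, whiskerLeftIso_inv, Iso.symm_inv,
    Pseudofunctor.map₂_whisker_left, Category.assoc, Iso.inv_hom_id_assoc]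
  simp only [← whiskerLeft_comp_assoc]
  rw [whisker_exchange]
  simp

theorem combine_whiskerRight {x y z : X} {k k' : H.obj x ⟶ H.obj y} {l : H.obj y ⟶ H.obj z}
    {p p' : x ⟶ y} {q : y ⟶ z} (s : k ≅ H.map p) (s' : k' ≅ H.map p') (t : l ≅ H.map q)
    (θ : p ⟶ p') :
    (combine H s t).hom ≫ H.map₂ (θ ▷ q) ≫ (combine H s' t).inv =
      (s.hom ≫ H.map₂ θ ≫ s'.inv) ▷ l := by
  simp only [combine, Iso.trans_hom, whiskerRightIso_hom, whiskerLeftIso_hom, Iso.symm_hom,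
    Iso.trans_inv, whiskerRightIso_inv, whiskerLeftIso_inv, Iso.symm_inv,
    Pseudofunctor.map₂_whisker_right, Category.assoc, Iso.inv_hom_id_assoc]
  rw [whisker_exchange_assoc]
  simp

variable [Strict X] [Strict D]

theorem combine_id_left {x y : X} {l : H.obj x ⟶ H.obj y} {q : x ⟶ y} (t : l ≅ H.map q) :
    HEq (combine H (H.mapId x).symm t) t := by
  refine iso_heq (Strict.id_comp l) (congrArg H.map (Strict.id_comp q)) ?_
  have h : (combine H (H.mapId x).symm t).hom ≫ H.map₂ (λ_ q).hom = (λ_ l).hom ≫ t.hom := by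
    simp only [combine, Iso.trans_hom, whiskerRightIso_hom, whiskerLeftIso_hom, Iso.symm_hom,
      Pseudofunctor.map₂_left_unitor, Category.assoc, Iso.inv_hom_id_assoc]
    rw [← whisker_exchange_assoc]
    simp
  rw [Strict.leftUnitor_eqToIso, Strict.leftUnitor_eqToIso, eqToIso.hom, eqToIso.hom,
    PrelaxFunctor.map₂_eqToHom, comp_eqToHom_iff, Category.assoc] at h
  rw [h]
  exact conj_eqToHom_heq _ _ _

theorem combine_id_right {x y : X} {k : H.obj x ⟶ H.obj y} {p : x ⟶ y} (s : k ≅ H.map p) :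
    HEq (combine H s (H.mapId y).symm) s := by
  refine iso_heq (Strict.comp_id k) (congrArg H.map (Strict.comp_id p)) ?_
  have h : (combine H s (H.mapId y).symm).hom ≫ H.map₂ (ρ_ p).hom = (ρ_ k).hom ≫ s.hom := by
    simp only [combine, Iso.trans_hom, whiskerRightIso_hom, whiskerLeftIso_hom, Iso.symm_hom,
      Pseudofunctor.map₂_right_unitor, Category.assoc, Iso.inv_hom_id_assoc]
    simp
  rw [Strict.rightUnitor_eqToIso, Strict.rightUnitor_eqToIso, eqToIso.hom, eqToIso.hom,
    PrelaxFunctor.map₂_eqToHom, comp_eqToHom_iff, Category.assoc] at h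
  rw [h]
  exact conj_eqToHom_heq _ _ _

theorem combine_assoc {x y z t : X} {k : H.obj x ⟶ H.obj y} {l : H.obj y ⟶ H.obj z}
    {m : H.obj z ⟶ H.obj t} {p : x ⟶ y} {q : y ⟶ z} {r : z ⟶ t} (s : k ≅ H.map p)
    (s' : l ≅ H.map q) (s'' : m ≅ H.map r) :
    HEq (combine H (combine H s s') s'') (combine H s (combine H s' s'')) := by
  refine iso_heq (Strict.assoc k l m) (congrArg H.map (Strict.assoc p q r)) ?_
  have h : (combine H (combine H s s') s'').hom ≫ H.map₂ (α_ p q r).hom =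
      (α_ k l m).hom ≫ (combine H s (combine H s' s'')).hom := by
    simp only [combine, Iso.trans_hom, whiskerRightIso_hom, whiskerLeftIso_hom, Iso.symm_hom,
      Pseudofunctor.map₂_associator, whiskerLeft_comp, comp_whiskerRight, Category.assoc,
      Iso.inv_hom_id_assoc]
    rw [whisker_exchange_assoc]
    simp
  rw [Strict.associator_eqToIso, Strict.associator_eqToIso, eqToIso.hom, eqToIso.hom,
    PrelaxFunctor.map₂_eqToHom, comp_eqToHom_iff] at h
  rw [h, Category.assoc (eqToHom _)]
  exact conj_eqToHom_heq _ _ _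

end Comb

/-! ### The 2-functor induced by a cubical functor -/

/-- Extensionality for functors between bicategories whose actions on cells need not agree
definitionally, whence the heterogeneous equalities. -/
theorem pseudofunctor_hext {B C : Type u} [Bicategory.{u, u} B] [Bicategory.{u, u} C]
    {F G : Pseudofunctor B C} (ho : ∀ x, F.obj x = G.obj x)
    (hm : ∀ {x y : B} (f : x ⟶ y), HEq (F.map f) (G.map f))
    (h₂ : ∀ {x y : B} {f g : x ⟶ y} (η : f ⟶ g), HEq (F.map₂ η) (G.map₂ η))
    (hi : ∀ x, HEq (F.mapId x).hom (G.mapId x).hom)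
    (hc : ∀ {x y z : B} (f : x ⟶ y) (g : y ⟶ z), HEq (F.mapComp f g).hom (G.mapComp f g).hom) :
    F = G := by
  obtain ⟨⟨⟨⟨Fo, Fm⟩, F₂⟩, _, _⟩, Fi, Fc, _, _, _, _, _⟩ := F
  obtain ⟨⟨⟨⟨Go, Gm⟩, G₂⟩, _, _⟩, Gi, Gc, _, _, _, _, _⟩ := G
  obtain rfl : Fo = Go := funext ho
  obtain rfl : @Fm = @Gm := by
    funext x y f
    exact eq_of_heq (hm f)
  obtain rfl : @F₂ = @G₂ := by
    funext x y f g η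
    exact eq_of_heq (h₂ η)
  exact Icon.mk_eq_mk (fun a => eq_of_heq (hi a)) (fun f g => eq_of_heq (hc f g))

namespace Gray

variable {A B D : Type u} [Bicategory.{u, u} A] [Bicategory.{u, u} B] [Bicategory.{u, u} D]
  [Strict A] [Strict B] [Strict D]

/-- The image of a 1-cell of `A ⊗ B` in the cartesian product. -/
def prj {x y : Gray A B} (p : x ⟶ y) : ((x.fst, x.snd) : A × B) ⟶ (y.fst, y.snd) :=
  Prod.mkHom ((proj₁ A B).map p) ((proj₂ A B).map p)

/-- The image of a 2-cell of `A ⊗ B` in the cartesian product. -/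
def prj₂ {x y : Gray A B} {p q : x ⟶ y} (s : p ⟶ q) : prj p ⟶ prj q :=
  Prod.mkHom ((proj₁ A B).map₂ s) ((proj₂ A B).map₂ s)

theorem prj_comp {x y z : Gray A B} (p : x ⟶ y) (q : y ⟶ z) :
    prj (p ≫ q) = prj p ≫ prj q :=
  Prod.ext ((proj₁ A B).map_comp p q) ((proj₂ A B).map_comp p q)

theorem prj₂_comp {x y : Gray A B} {p q r : x ⟶ y} (s : p ⟶ q) (t : q ⟶ r) :
    prj₂ (s ≫ t) = prj₂ s ≫ prj₂ t :=
  Prod.ext ((proj₁ A B).map₂_comp s t) ((proj₂ A B).map₂_comp s t)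

end Gray

namespace Gray

/-- The 1-cell `(f, 1)` of a product. -/
abbrev axis₁ {A B : Type u} [Bicategory.{u, u} A] [Bicategory.{u, u} B] {a a' : A} (f : a ⟶ a')
    (b : B) : ((a, b) : A × B) ⟶ (a', b) :=
  Prod.mkHom f (𝟙 b)

/-- The 1-cell `(1, g)` of a product. -/
abbrev axis₂ {A B : Type u} [Bicategory.{u, u} A] [Bicategory.{u, u} B] (a : A) {b b' : B}
    (g : b ⟶ b') : ((a, b) : A × B) ⟶ (a, b') :=
  Prod.mkHom (𝟙 a) g

/-- The 1-cell represented by a word. -/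
abbrev ofWord {A B : Type u} [Bicategory.{u, u} A] [Bicategory.{u, u} B] {x y : Gray A B}
    (w : Word x y) : x ⟶ y :=
  Quot.mk _ w

theorem axis₁_comp {A B : Type u} [Bicategory.{u, u} A] [Bicategory.{u, u} B] [Strict B]
    {a a' a'' : A} (f : a ⟶ a') (f' : a' ⟶ a'') (b : B) :
    axis₁ (f ≫ f') b = axis₁ f b ≫ axis₁ f' b :=
  Prod.ext rfl (Strict.id_comp _).symm

theorem axis₂_comp {A B : Type u} [Bicategory.{u, u} A] [Bicategory.{u, u} B] [Strict A]
    (a : A) {b b' b'' : B} (g : b ⟶ b') (g' : b' ⟶ b'') :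
    axis₂ a (g ≫ g') = axis₂ a g ≫ axis₂ a g' :=
  Prod.ext (Strict.id_comp _).symm rfl

section Lift

variable {A B D : Type u} [Bicategory.{u, u} A] [Bicategory.{u, u} B] [Bicategory.{u, u} D]
  [Strict A] [Strict B] [Strict D] {H : Pseudofunctor (A × B) D}
  (hH : GrayIcon.IsCubical (A := ⟨A⟩) (B := ⟨B⟩) (D := ⟨D⟩) H)

/-- The action on generating 1-cells of the 2-functor `A ⊗ B ⟶ D` induced by a cubical functor
`H`. -/
def liftPath : PathData A B D where
  obj x := H.obj (x.fst, x.snd)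
  left f b := H.map (axis₁ f b)
  right a _ _ g := H.map (axis₂ a g)
  left_id a b := (hH.mapId (a, b)).1
  left_comp f f' b := (congrArg H.map (axis₁_comp f f' b)).trans
    (hH.mapComp_left f (axis₁ f' b)).1
  right_id a b := (hH.mapId (a, b)).1
  right_comp a _ _ _ g g' := (congrArg H.map (axis₂_comp a g g')).trans
    (hH.mapComp_right (axis₂ a g) g').1

/-- The composite of the constraints of `H` along a word, comparing the composite of the values of
`H` on the letters of the word with the value of `H` on their composite. -/
def liftWord : ∀ {x y : Gray A B} (w : Word x y), (liftPath hH).word w ≅ H.map (prj (Quot.mk _ w))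
  | _, _, .id x => (H.mapId (x.fst, x.snd)).symm
  | _, _, .comp v w => combine H (liftWord v) (liftWord w)
  | _, _, .left f b => Iso.refl (H.map (axis₁ f b))
  | _, _, .right a g => Iso.refl (H.map (axis₂ a g))

theorem conj_id {X : Type*} [Category X] {a b : X} (e : a ≅ b) {m : b ⟶ b} (h : m = 𝟙 b) :
    e.hom ≫ m ≫ e.inv = 𝟙 a := by
  simp [h]

theorem conj_comp {X : Type*} [Category X] {a b c a' b' c' : X} (e : a ≅ a') (e' : b ≅ b')
    (e'' : c ≅ c') {m : a' ⟶ b'} {n : b' ⟶ c'} {k : a' ⟶ c'} (h : k = m ≫ n) :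
    e.hom ≫ k ≫ e''.inv = (e.hom ≫ m ≫ e'.inv) ≫ e'.hom ≫ n ≫ e''.inv := by
  simp [h]

theorem refl_heq_symm {X : Type*} [Category X] {a b b' : X} {e : b ≅ b'} (hb : a = b)
    (h : ∃ h, e = eqToIso h) : HEq (Iso.refl a) e.symm := by
  obtain ⟨rfl, rfl⟩ := h
  subst hb
  rfl

/-- The comparison isomorphism of a word depends only on the 1-cell that the word represents. The
relations of functoriality of `f ⊗ 1` and `1 ⊗ g` are respected because the corresponding
constraints of a cubical functor are identities, all others because of the coherence axioms. -/
theorem liftWord_heq {x y : Gray A B} {v w : Word x y} (h : WordRel v w) :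
    HEq (liftWord hH v) (liftWord hH w) := by
  induction h with
  | comp_left w h ih =>
    exact combine_congr H ((liftPath hH).word_congr h) rfl (congrArg prj (Quot.sound h)) rfl ih
      HEq.rfl
  | comp_right w h ih =>
    exact combine_congr H rfl ((liftPath hH).word_congr h) rfl (congrArg prj (Quot.sound h))
      HEq.rfl ih
  | id_comp w => exact combine_id_left H (liftWord hH w)
  | comp_id w => exact combine_id_right H (liftWord hH w)
  | assoc v w k => exact combine_assoc H (liftWord hH v) (liftWord hH w) (liftWord hH k)
  | left_id a b => exact refl_heq_symm rfl (hH.mapId (a, b))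
  | right_id a b => exact refl_heq_symm rfl (hH.mapId (a, b))
  | left_comp f f' b =>
    exact (refl_heq_symm (congrArg H.map (axis₁_comp f f' b))
      (hH.mapComp_left f (axis₁ f' b))).trans (heq_of_eq (combine_refl H _ _).symm)
  | right_comp a g g' =>
    exact (refl_heq_symm (congrArg H.map (axis₂_comp a g g'))
      (hH.mapComp_right (axis₂ a g) g')).trans (heq_of_eq (combine_refl H _ _).symm)

/-- The comparison between the induced 2-functor and `H` on a 1-cell. -/
def liftIso {x y : Gray A B} (p : x ⟶ y) : (liftPath hH).map p ≅ H.map (prj p) :=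
  Quot.hrecOn (motive := fun p => (liftPath hH).map p ≅ H.map (prj p)) p
    (fun w => liftWord hH w) (fun _ _ h => liftWord_heq hH h)

theorem liftIso_comp {x y z : Gray A B} (p : x ⟶ y) (q : y ⟶ z) :
    HEq (liftIso hH (p ≫ q)) (combine H (liftIso hH p) (liftIso hH q)) := by
  induction p using Quot.ind with
  | mk v => induction q using Quot.ind with
    | mk w => rfl

/-- The action on 2-cells of the 2-functor induced by `H`: the value of `H` on the underlying 2-cell
of the cartesian product, conjugated by the comparison isomorphisms. -/
def liftCell {x y : Gray A B} {p q : x ⟶ y} (s : p ⟶ q) :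
    (liftPath hH).map p ⟶ (liftPath hH).map q :=
  (liftIso hH p).hom ≫ H.map₂ (prj₂ s) ≫ (liftIso hH q).inv

theorem prj₂_whiskerLeft {x y z : Gray A B} (v : Word x y) {w w' : Word y z}
    (s : ofWord w ⟶ ofWord w') : prj₂ (ofWord v ◁ s) = prj (ofWord v) ◁ prj₂ s := by
  induction s using Quot.ind with
  | mk s => exact Prod.ext (id_comp_comp_id _) (id_comp_comp_id _)

theorem prj₂_whiskerRight {x y z : Gray A B} {v v' : Word x y} (s : ofWord v ⟶ ofWord v')
    (w : Word y z) : prj₂ (s ▷ ofWord w) = prj₂ s ▷ prj (ofWord w) := by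
  induction s using Quot.ind with
  | mk s => exact Prod.ext (id_comp_comp_id _) (id_comp_comp_id _)

/-- The 2-functor `A ⊗ B ⟶ D` induced by a cubical functor `A × B ⟶ D`. -/
def lift : StrictPseudofunctor (Gray A B) D := .mk''
  { obj := (liftPath hH).obj
    map := (liftPath hH).map
    map₂ := liftCell hH
    map₂_id := fun p => conj_id (liftIso hH p) (H.map₂_id _)
    map₂_comp := fun s t =>
      conj_comp _ _ _ ((congrArg H.map₂ (prj₂_comp s t)).trans (H.map₂_comp _ _))
    map_id := (liftPath hH).map_id
    map_comp := (liftPath hH).map_comp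
    map₂_whisker_left := fun p q q' s => by
      induction p using Quot.ind with
      | mk v => induction q using Quot.ind with
        | mk w => induction q' using Quot.ind with
          | mk w' =>
            refine Eq.trans ?_ (id_comp_comp_id _).symm
            refine (congrArg (_ ≫ H.map₂ · ≫ _) (prj₂_whiskerLeft v s)).trans ?_
            exact combine_whiskerLeft H (liftWord hH v) (liftWord hH w) (liftWord hH w') _
    map₂_whisker_right := fun {x y z p p'} s q => by
      induction p using Quot.ind with
      | mk v => induction q using Quot.ind with
        | mk w => induction p' using Quot.ind with
          | mk v' =>
            refine Eq.trans ?_ (id_comp_comp_id _).symm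
            refine (congrArg (_ ≫ H.map₂ · ≫ _) (prj₂_whiskerRight s w)).trans ?_
            exact combine_whiskerRight H (liftWord hH v) (liftWord hH v') (liftWord hH w) _ }

end Lift
end Gray

/-! ### Cubicality of the universal cubical functor, and its factorizations -/

/-- A morphism is the canonical one between two equal objects. -/
def IsEqToHom {X : Type*} [Category X] {a b : X} (f : a ⟶ b) : Prop :=
  ∃ h, f = eqToHom h

namespace IsEqToHom

variable {X : Type*} [Category X]

theorem comp {a b c : X} {f : a ⟶ b} {g : b ⟶ c} (hf : IsEqToHom f) (hg : IsEqToHom g) :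
    IsEqToHom (f ≫ g) := by
  obtain ⟨rfl, rfl⟩ := hf
  obtain ⟨rfl, rfl⟩ := hg
  exact ⟨rfl, Category.id_comp _⟩

theorem heq {a b a' b' : X} {f : a ⟶ b} {f' : a' ⟶ b'} (hf : IsEqToHom f) (hf' : IsEqToHom f')
    (ha : a = a') : HEq f f' := by
  obtain ⟨rfl, rfl⟩ := hf
  obtain ⟨rfl, rfl⟩ := hf'
  subst ha
  rfl

theorem map₂ {K L : Type*} [Bicategory K] [Bicategory L] {a b : K} {f g : a ⟶ b} {η : f ⟶ g}
    (h : IsEqToHom η) (F : Pseudofunctor K L) : IsEqToHom (F.map₂ η) := by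
  obtain ⟨rfl, rfl⟩ := h
  exact ⟨rfl, F.map₂_id _⟩

theorem strict_mapId {K L : Type*} [Bicategory K] [Bicategory L] (F : StrictPseudofunctor K L)
    (x : K) : IsEqToHom (F.mapId x).hom :=
  ⟨F.map_id x, congrArg Iso.hom (F.mapId_eq_eqToIso x)⟩

theorem strict_mapComp {K L : Type*} [Bicategory K] [Bicategory L] (F : StrictPseudofunctor K L)
    {x y z : K} (f : x ⟶ y) (g : y ⟶ z) : IsEqToHom (F.mapComp f g).hom :=
  ⟨F.map_comp f g, congrArg Iso.hom (F.mapComp_eq_eqToIso f g)⟩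

theorem comp_mapId {K L M : Type*} [Bicategory K] [Bicategory L] [Bicategory M]
    {F : Pseudofunctor K L} {G : Pseudofunctor L M} {x : K} (h : IsEqToHom (F.mapId x).hom)
    (h' : IsEqToHom (G.mapId (F.obj x)).hom) : IsEqToHom ((F.comp G).mapId x).hom :=
  (h.map₂ G).comp h'

theorem comp_mapComp {K L M : Type*} [Bicategory K] [Bicategory L] [Bicategory M]
    {F : Pseudofunctor K L} {G : Pseudofunctor L M} {x y z : K} {f : x ⟶ y} {g : y ⟶ z}
    (h : IsEqToHom (G.map₂ (F.mapComp f g).hom))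
    (h' : IsEqToHom (G.mapComp (F.map f) (F.map g)).hom) : IsEqToHom ((F.comp G).mapComp f g).hom :=
  h.comp h'

theorem mkHom {Y : Type*} [Category Y] {a b : X} {c d : Y} {f : a ⟶ b} {g : c ⟶ d}
    (hf : IsEqToHom f) (hg : IsEqToHom g) : IsEqToHom (Prod.mkHom f g) := by
  obtain ⟨rfl, rfl⟩ := hf
  obtain ⟨rfl, rfl⟩ := hg
  exact ⟨rfl, rfl⟩

theorem of_iso {a b : X} {e : a ≅ b} (h : ∃ h, e = eqToIso h) : IsEqToHom e.hom := by
  obtain ⟨h, rfl⟩ := h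
  exact ⟨h, rfl⟩

theorem inv {a b : X} {e : a ≅ b} (h : IsEqToHom e.hom) : IsEqToHom e.inv := by
  obtain ⟨rfl, h⟩ := h
  obtain rfl : e = Iso.refl a := Iso.ext h
  exact ⟨rfl, rfl⟩

theorem comp_heq {a b c : X} {f : a ⟶ b} (hf : IsEqToHom f) (g : b ⟶ c) : HEq (f ≫ g) g := by
  obtain ⟨rfl, rfl⟩ := hf
  exact heq_of_eq (Category.id_comp g)

theorem heq_comp {a b c : X} (f : a ⟶ b) {g : b ⟶ c} (hg : IsEqToHom g) : HEq (f ≫ g) f := by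
  obtain ⟨rfl, rfl⟩ := hg
  exact heq_of_eq (Category.comp_id f)

end IsEqToHom

theorem inv_heq {X : Type*} [Category X] {a b a' b' : X} (ha : a = a') (hb : b = b')
    {s : a ≅ b} {t : a' ≅ b'} (h : HEq s t) : HEq s.inv t.inv := by
  subst ha hb h
  rfl

theorem map₂_heq {K L : Type*} [Bicategory K] [Bicategory L] (F : Pseudofunctor K L) {a b : K}
    {f g f' g' : a ⟶ b} {η : f ⟶ g} {η' : f' ⟶ g'} (hf : f = f') (hg : g = g') (h : HEq η η') :
    HEq (F.map₂ η) (F.map₂ η') := by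
  subst hf hg h
  rfl

theorem mkHom_heq {X Y : Type*} [Category X] [Category Y] {a a' b b' : X} {c c' d d' : Y}
    {f : a ⟶ b} {f' : a' ⟶ b'} {g : c ⟶ d} {g' : c' ⟶ d'} (ha : a = a') (hb : b = b')
    (hc : c = c') (hd : d = d') (hf : HEq f f') (hg : HEq g g') :
    HEq (Prod.mkHom f g) (Prod.mkHom f' g') := by
  subst ha hb hc hd hf hg
  rfl

namespace Gray
variable {A B D : Type u} [Bicategory.{u, u} A] [Bicategory.{u, u} B] [Bicategory.{u, u} D]
  [Strict A] [Strict B] [Strict D]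

theorem sigma_id_left_eq (a : A) {b b' : B} (g : b ⟶ b') :
    ∃ h, sigma (𝟙 a) g = eqToIso h :=
  ⟨by rw [left_id, left_id, id_comp, comp_id],
    Iso.ext (Quot.sound (.sigma_id_left a g) |>.trans (ofEq_eq _))⟩

theorem sigma_id_right_eq {a a' : A} (f : a ⟶ a') (b : B) :
    ∃ h, sigma f (𝟙 b) = eqToIso h :=
  ⟨by rw [right_id, right_id, id_comp, comp_id],
    Iso.ext (Quot.sound (.sigma_id_right f b) |>.trans (ofEq_eq _))⟩

theorem shuffle_eqToIso {K : Type u} [Bicategory.{u, u} K] [Strict K] {p q r s t v : K} {L : p ⟶ q}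
    {L' : q ⟶ r} {R : q ⟶ s} {M : s ⟶ t} {N : r ⟶ t} {R' : t ⟶ v} {P : p ⟶ r} {Q : r ⟶ v}
    (e : P = L ≫ L') (e' : Q = N ≫ R') {σ : R ≫ M ≅ L' ≫ N} (hσ : ∃ h, σ = eqToIso h) :
    ∃ h, shuffle (eqToIso e) (eqToIso e') σ = eqToIso h := by
  obtain ⟨h, rfl⟩ := hσ
  refine ⟨?_, Iso.ext ?_⟩
  · rw [e, e', Strict.assoc, ← Strict.assoc L' N R', ← h]
    simp only [Strict.assoc]
  · simp [shuffle, Strict.associator_eqToIso]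

theorem isCubical_univCubical :
    GrayIcon.IsCubical (A := ⟨A⟩) (B := ⟨B⟩) (D := ⟨Gray A B⟩) (univCubical A B) where
  mapId x := ⟨_, rfl⟩
  mapComp_left f q := shuffle_eqToIso _ _ (sigma_id_right_eq _ _)
  mapComp_right p g := shuffle_eqToIso _ _ (sigma_id_left_eq _ _)

theorem univCubical_mapId (x : A × B) : IsEqToHom ((univCubical A B).mapId x).hom :=
  ⟨left_id_comp_right_id x.1 x.2, rfl⟩

theorem prj_univCubical {x y : A × B} (p : x ⟶ y) : prj ((univCubical A B).map p) = p :=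
  Prod.ext (Strict.comp_id p.1) (Strict.id_comp p.2)

theorem id_comp_heq {K : Type*} [Bicategory K] [Strict K] {a b : K} {f g : a ⟶ b} (η : f ⟶ g) :
    HEq (𝟙 (𝟙 a) ▷ f ≫ 𝟙 a ◁ η) η := by
  have h : 𝟙 (𝟙 a) ▷ f ≫ 𝟙 a ◁ η =
      eqToHom (Strict.id_comp f) ≫ η ≫ eqToHom (Strict.id_comp g).symm := by
    simp [Strict.leftUnitor_eqToIso]
  rw [h]
  exact conj_eqToHom_heq _ _ _

theorem comp_id_heq {K : Type*} [Bicategory K] [Strict K] {a b : K} {f g : a ⟶ b} (η : f ⟶ g) :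
    HEq (η ▷ 𝟙 b ≫ g ◁ 𝟙 (𝟙 b)) η := by
  have h : η ▷ 𝟙 b ≫ g ◁ 𝟙 (𝟙 b) =
      eqToHom (Strict.comp_id f) ≫ η ≫ eqToHom (Strict.comp_id g).symm := by
    simp [Strict.rightUnitor_eqToIso]
  rw [h]
  exact conj_eqToHom_heq _ _ _

theorem proj₁_univCubical_map₂ {x y : A × B} {p q : x ⟶ y} (α : p ⟶ q) :
    HEq ((proj₁ A B).map₂ ((univCubical A B).map₂ α)) α.1 := by
  refine HEq.trans (heq_of_eq ?_) (comp_id_heq α.1)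
  exact congrArg₂ (· ≫ ·) (id_comp_comp_id _) (id_comp_comp_id _)

theorem proj₂_univCubical_map₂ {x y : A × B} {p q : x ⟶ y} (α : p ⟶ q) :
    HEq ((proj₂ A B).map₂ ((univCubical A B).map₂ α)) α.2 := by
  refine HEq.trans (heq_of_eq ?_) (id_comp_heq α.2)
  exact congrArg₂ (· ≫ ·) (id_comp_comp_id _) (id_comp_comp_id _)

theorem map₂_shuffle {K L : Type u} [Bicategory.{u, u} K] [Bicategory.{u, u} L] [Strict K]
    [Strict L] (F : StrictPseudofunctor K L)
    {p q r s t v : K} {l : p ⟶ q}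
    {L' : q ⟶ r} {R : q ⟶ s} {M : s ⟶ t} {N : r ⟶ t} {R' : t ⟶ v} {P : p ⟶ r} {Q : r ⟶ v}
    (e : P = l ≫ L') (e' : Q = N ≫ R') {σ : R ≫ M ≅ L' ≫ N} (hσ : ∃ h, F.map₂ σ.inv = eqToHom h) :
    ∃ h, F.map₂ (shuffle (eqToIso e) (eqToIso e') σ).hom = eqToHom h := by
  obtain ⟨h, hσ⟩ := hσ
  refine ⟨?_, ?_⟩
  · rw [F.map_comp, F.map_comp] at h
    simp only [e, e', F.map_comp, Strict.assoc]
    rw [← Strict.assoc _ _ (F.map R'), h, Strict.assoc]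
  · simp [shuffle, Strict.associator_eqToIso, hσ, PrelaxFunctor.map₂_eqToHom,
      F.mapComp_eq_eqToIso]

theorem proj₁_univCubical_mapComp {x y z : A × B} (p : x ⟶ y) (q : y ⟶ z) :
    ∃ h, (proj₁ A B).map₂ ((univCubical A B).mapComp p q).hom = eqToHom h :=
  map₂_shuffle _ _ _ ⟨(Strict.comp_id q.1).trans (Strict.id_comp q.1).symm, rfl⟩

theorem proj₂_univCubical_mapComp {x y z : A × B} (p : x ⟶ y) (q : y ⟶ z) :
    ∃ h, (proj₂ A B).map₂ ((univCubical A B).mapComp p q).hom = eqToHom h :=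
  map₂_shuffle _ _ _ ⟨(Strict.id_comp p.2).trans (Strict.comp_id p.2).symm, rfl⟩

theorem univCubical_proj₁ :
    (univCubical A B).comp (proj₁ A B).toPseudofunctor =
      (Bicategory.Prod.fst A B).toPseudofunctor := by
  refine pseudofunctor_hext (fun _ => rfl) (fun f => heq_of_eq (Strict.comp_id f.1))
    proj₁_univCubical_map₂ (fun x => ?_) (fun f g => ?_)
  · exact IsEqToHom.heq (.comp_mapId (univCubical_mapId x) (.strict_mapId _ _)) ⟨rfl, rfl⟩
      (Strict.comp_id _)
  · exact IsEqToHom.heq (.comp_mapComp (proj₁_univCubical_mapComp f g) (.strict_mapComp _ _ _))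
      ⟨rfl, rfl⟩
      (Strict.comp_id _)

theorem univCubical_proj₂ :
    (univCubical A B).comp (proj₂ A B).toPseudofunctor =
      (Bicategory.Prod.snd A B).toPseudofunctor := by
  refine pseudofunctor_hext (fun _ => rfl) (fun f => heq_of_eq (Strict.id_comp f.2))
    proj₂_univCubical_map₂ (fun x => ?_) (fun f g => ?_)
  · exact IsEqToHom.heq (.comp_mapId (univCubical_mapId x) (.strict_mapId _ _)) ⟨rfl, rfl⟩
      (Strict.id_comp _)
  · exact IsEqToHom.heq (.comp_mapComp (proj₂_univCubical_mapComp f g) (.strict_mapComp _ _ _))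
      ⟨rfl, rfl⟩
      (Strict.id_comp _)

theorem prj₂_univCubical_mapComp {x y z : A × B} (p : x ⟶ y) (q : y ⟶ z) :
    IsEqToHom (prj₂ ((univCubical A B).mapComp p q).hom) :=
  IsEqToHom.mkHom (proj₁_univCubical_mapComp p q) (proj₂_univCubical_mapComp p q)

theorem prj₂_univCubical_map₂ {x y : A × B} {p q : x ⟶ y} (α : p ⟶ q) :
    HEq (prj₂ ((univCubical A B).map₂ α)) α :=
  mkHom_heq (Strict.comp_id p.1) (Strict.comp_id q.1) (Strict.id_comp p.2) (Strict.id_comp q.2)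
    (proj₁_univCubical_map₂ α) (proj₂_univCubical_map₂ α)

section
variable {H : Pseudofunctor (A × B) D}
  (hH : GrayIcon.IsCubical (A := ⟨A⟩) (B := ⟨B⟩) (D := ⟨D⟩) H)

theorem lift_map_univCubical {x y : A × B} (p : x ⟶ y) :
    (lift hH).map ((univCubical A B).map p) = H.map p :=
  (hH.mapComp_left p.1 (axis₂ y.1 p.2)).1.symm.trans (congrArg H.map (prj_univCubical p))

theorem liftIso_univCubical {x y : A × B} (p : x ⟶ y) :
    ∃ h, liftIso hH ((univCubical A B).map p) = eqToIso h := by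
  have h : ∃ h, H.mapComp (axis₁ p.1 x.2) (axis₂ y.1 p.2) = eqToIso h :=
    hH.mapComp_left p.1 (axis₂ y.1 p.2)
  obtain ⟨h, h'⟩ := h
  refine ⟨h.symm, (combine_refl H _ _).trans ?_⟩
  exact congrArg Iso.symm h'

theorem liftIso_univCubical_comp {x y z : A × B} (p : x ⟶ y) (q : y ⟶ z) :
    HEq (liftIso hH ((univCubical A B).map p ≫ (univCubical A B).map q)).inv
      (H.mapComp p q).hom := by
  obtain ⟨hp, ep⟩ := liftIso_univCubical hH p
  obtain ⟨hq, eq⟩ := liftIso_univCubical hH q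
  have h := liftIso_comp hH ((univCubical A B).map p) ((univCubical A B).map q)
  rw [ep, eq] at h
  have h' := (h.trans (combine_eqToIso H hp hq))
  have k := inv_heq ((liftPath hH).map_comp _ _ |>.trans (congrArg₂ (· ≫ ·) hp hq))
    (congrArg H.map (prj_comp _ _)) h'
  refine k.trans ?_
  change HEq (H.mapComp (prj ((univCubical A B).map p)) (prj ((univCubical A B).map q))).hom _
  rw [prj_univCubical p, prj_univCubical q]
  exact HEq.rfl

/-- The induced 2-functor factors the given cubical functor through the universal one. -/
theorem univCubical_lift : (univCubical A B).comp (lift hH).toPseudofunctor = H := by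
  refine pseudofunctor_hext (fun _ => rfl) (fun f => heq_of_eq (lift_map_univCubical hH f))
    (fun {x y f g} η => ?_) (fun x => ?_) (fun f g => ?_)
  · have hf := IsEqToHom.of_iso (liftIso_univCubical hH f)
    have hg := (IsEqToHom.of_iso (liftIso_univCubical hH g)).inv
    exact (hf.comp_heq _).trans ((IsEqToHom.heq_comp _ hg).trans
      (map₂_heq H (prj_univCubical f) (prj_univCubical g) (prj₂_univCubical_map₂ η)))
  · exact IsEqToHom.heq (.comp_mapId (univCubical_mapId x) (.strict_mapId _ _))
      (.of_iso (hH.mapId x))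
      (lift_map_univCubical hH (𝟙 x))
  · have hf := IsEqToHom.of_iso (liftIso_univCubical hH (f ≫ g))
    have hm : IsEqToHom (H.map₂ (prj₂ ((univCubical A B).mapComp f g).hom)) :=
      (prj₂_univCubical_mapComp f g).map₂ H
    have hc : IsEqToHom
        ((lift hH).mapComp ((univCubical A B).map f) ((univCubical A B).map g)).hom :=
      .strict_mapComp _ _ _
    exact (IsEqToHom.heq_comp _ hc).trans ((hf.comp_heq _).trans ((hm.comp_heq _).trans
      (liftIso_univCubical_comp hH f g)))

end

end Gray

/-! ### Uniqueness of the 2-functor induced by a cubical functor -/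

section HCongr
variable {K : Type*} [Bicategory K] {a a' b b' c c' : K}

theorem hcongr_id (ha : a = a') : HEq (𝟙 a) (𝟙 a') := by
  subst ha
  rfl

theorem hcongr_comp {f : a ⟶ b} {f' : a' ⟶ b'} {g : b ⟶ c} {g' : b' ⟶ c'} (ha : a = a')
    (hb : b = b') (hc : c = c') (hf : HEq f f') (hg : HEq g g') : HEq (f ≫ g) (f' ≫ g') := by
  subst ha hb hc hf hg
  rfl

theorem hcongr_id₂ {f : a ⟶ b} {f' : a' ⟶ b'} (ha : a = a') (hb : b = b') (hf : HEq f f') :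
    HEq (𝟙 f) (𝟙 f') := by
  subst ha hb hf
  rfl

theorem hcongr_comp₂ {f g h : a ⟶ b} {f' g' h' : a' ⟶ b'} {η : f ⟶ g} {η' : f' ⟶ g'} {θ : g ⟶ h}
    {θ' : g' ⟶ h'} (ha : a = a') (hb : b = b') (hf : HEq f f') (hg : HEq g g') (hh : HEq h h')
    (hη : HEq η η') (hθ : HEq θ θ') : HEq (η ≫ θ) (η' ≫ θ') := by
  subst ha hb hf hg hh hη hθ
  rfl

theorem hcongr_inv {f g : a ⟶ b} {f' g' : a' ⟶ b'} {η : f ≅ g} {η' : f' ≅ g'}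
    (ha : a = a') (hb : b = b') (hf : HEq f f') (hg : HEq g g') (hη : HEq η.hom η'.hom) :
    HEq η.inv η'.inv := by
  subst ha hb hf hg
  obtain rfl : η = η' := Iso.ext (eq_of_heq hη)
  rfl

theorem hcongr_whiskerLeft {f : a ⟶ b} {f' : a' ⟶ b'} {g h : b ⟶ c} {g' h' : b' ⟶ c'}
    {η : g ⟶ h} {η' : g' ⟶ h'} (ha : a = a') (hb : b = b') (hc : c = c') (hf : HEq f f')
    (hg : HEq g g') (hh : HEq h h') (hη : HEq η η') : HEq (f ◁ η) (f' ◁ η') := by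
  subst ha hb hc hf hg hh hη
  rfl

theorem hcongr_whiskerRight {f g : a ⟶ b} {f' g' : a' ⟶ b'} {h : b ⟶ c} {h' : b' ⟶ c'}
    {η : f ⟶ g} {η' : f' ⟶ g'} (ha : a = a') (hb : b = b') (hc : c = c') (hf : HEq f f')
    (hg : HEq g g') (hh : HEq h h') (hη : HEq η η') : HEq (η ▷ h) (η' ▷ h') := by
  subst ha hb hc hf hg hh hη
  rfl

theorem hcongr_isEqToHom {f g : a ⟶ b} {f' g' : a' ⟶ b'} {η : f ⟶ g} {η' : f' ⟶ g'} (ha : a = a')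
    (hb : b = b') (hf : HEq f f') (hη : IsEqToHom η) (hη' : IsEqToHom η') : HEq η η' := by
  subst ha hb hf
  exact hη.heq hη' rfl

end HCongr

section Cong
variable {K L : Type u} [Bicategory.{u, u} K] [Bicategory.{u, u} L] {F G : Pseudofunctor K L}

theorem obj_of_eq (h : F = G) (x : K) : F.obj x = G.obj x := by rw [h]

theorem map_of_eq (h : F = G) {x y : K} (f : x ⟶ y) : HEq (F.map f) (G.map f) := by rw [h]

theorem map₂_of_eq (h : F = G) {x y : K} {f g : x ⟶ y} (η : f ⟶ g) :
    HEq (F.map₂ η) (G.map₂ η) := by rw [h]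

theorem mapComp_hom_of_eq (h : F = G) {x y z : K} (f : x ⟶ y) (g : y ⟶ z) :
    HEq (F.mapComp f g).hom (G.mapComp f g).hom := by rw [h]

theorem map₂_whiskerLeft_heq (F : StrictPseudofunctor K L) {x y z : K} (f : x ⟶ y) {g h : y ⟶ z}
    (η : g ⟶ h) : HEq (F.map₂ (f ◁ η)) (F.map f ◁ F.map₂ η) := by
  rw [F.map₂_whisker_left]
  exact (IsEqToHom.comp_heq (.strict_mapComp F f g) _).trans
    (IsEqToHom.heq_comp _ (IsEqToHom.inv (.strict_mapComp F f h)))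

theorem map₂_whiskerRight_heq (F : StrictPseudofunctor K L) {x y z : K} {f g : x ⟶ y} (η : f ⟶ g)
    (h : y ⟶ z) : HEq (F.map₂ (η ▷ h)) (F.map₂ η ▷ F.map h) := by
  rw [F.map₂_whisker_right]
  exact (IsEqToHom.comp_heq (.strict_mapComp F f h) _).trans
    (IsEqToHom.heq_comp _ (IsEqToHom.inv (.strict_mapComp F g h)))

theorem strictPseudofunctor_ext {F G : StrictPseudofunctor K L}
    (h : F.toPseudofunctor = G.toPseudofunctor) : F = G := by
  obtain ⟨⟨F, _, _⟩, _, _⟩ := F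
  obtain ⟨⟨G, _, _⟩, _, _⟩ := G
  obtain rfl : F = G := h
  rfl

end Cong

namespace Gray

theorem shuffle_id {K : Type u} [Bicategory.{u, u} K] [Strict K] {p r s t : K} {L : p ⟶ p}
    {L' : p ⟶ r} {R : p ⟶ s} {M : s ⟶ t} {N : r ⟶ t} {R' : t ⟶ t} {P : p ⟶ r} {Q : r ⟶ t}
    (hL : L = 𝟙 p) (hR' : R' = 𝟙 t) (e : P = L ≫ L') (e' : Q = N ≫ R') (σ : R ≫ M ≅ L' ≫ N) :
    HEq (shuffle (eqToIso e) (eqToIso e') σ).hom σ.inv := by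
  subst hL hR' e e'
  have h₁ : (𝟙 p ≫ L') ≫ N ≫ 𝟙 t = L' ≫ N := by rw [Strict.id_comp, Strict.comp_id]
  have h₂ : R ≫ M = (𝟙 p ≫ R) ≫ M ≫ 𝟙 t := by rw [Strict.id_comp, Strict.comp_id]
  have h : (shuffle (eqToIso rfl) (eqToIso rfl) σ).hom = eqToHom h₁ ≫ σ.inv ≫ eqToHom h₂ := by
    simp [shuffle, Strict.associator_eqToIso, Strict.leftUnitor_eqToIso, Strict.rightUnitor_eqToIso]
  rw [h]
  exact conj_eqToHom_heq _ _ _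

variable {A B D : Type u} [Bicategory.{u, u} A] [Bicategory.{u, u} B] [Bicategory.{u, u} D]
  [Strict A] [Strict B] [Strict D]

theorem univCubical_map_axis₁ {a a' : A} (f : a ⟶ a') (b : B) :
    (univCubical A B).map (axis₁ f b) = left f b :=
  (congrArg (left f b ≫ ·) (right_id a' b)).trans (comp_id _)

theorem univCubical_map_axis₂ (a : A) {b b' : B} (g : b ⟶ b') :
    (univCubical A B).map (axis₂ a g) = right a g :=
  (congrArg (· ≫ right a g) (left_id a b)).trans (id_comp _)

theorem univCubical_map₂_axis₁ {a a' : A} {f f' : a ⟶ a'} (α : f ⟶ f') (b : B) :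
    HEq ((univCubical A B).map₂ (show axis₁ f b ⟶ axis₁ f' b from Prod.mkHom α (𝟙 (𝟙 b))))
      (left₂ α b) := by
  refine HEq.trans ?_ (comp_id_heq (left₂ α b))
  have e := right_id a' b
  refine hcongr_comp₂ rfl rfl ?_ ?_ ?_ ?_ ?_
  · exact heq_of_eq (congrArg (left f b ≫ ·) e)
  · exact heq_of_eq (congrArg (left f' b ≫ ·) e)
  · exact heq_of_eq (congrArg (left f' b ≫ ·) e)
  · exact hcongr_whiskerRight rfl rfl rfl HEq.rfl HEq.rfl (heq_of_eq e) HEq.rfl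
  · exact hcongr_whiskerLeft rfl rfl rfl HEq.rfl (heq_of_eq e) (heq_of_eq e)
      ((heq_of_eq (right₂_id a' (𝟙 b))).trans (hcongr_id₂ rfl rfl (heq_of_eq e)))

theorem univCubical_map₂_axis₂ (a : A) {b b' : B} {g g' : b ⟶ b'} (β : g ⟶ g') :
    HEq ((univCubical A B).map₂ (show axis₂ a g ⟶ axis₂ a g' from Prod.mkHom (𝟙 (𝟙 a)) β))
      (right₂ a β) := by
  refine HEq.trans ?_ (id_comp_heq (right₂ a β))
  have e := left_id a b
  refine hcongr_comp₂ rfl rfl ?_ ?_ ?_ ?_ ?_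
  · exact heq_of_eq (congrArg (· ≫ right a g) e)
  · exact heq_of_eq (congrArg (· ≫ right a g) e)
  · exact heq_of_eq (congrArg (· ≫ right a g') e)
  · exact hcongr_whiskerRight rfl rfl rfl (heq_of_eq e) (heq_of_eq e) HEq.rfl
      ((heq_of_eq (left₂_id (𝟙 a) b)).trans (hcongr_id₂ rfl rfl (heq_of_eq e)))
  · exact hcongr_whiskerLeft rfl rfl rfl (heq_of_eq e) HEq.rfl HEq.rfl HEq.rfl

/-- The constraint of the universal cubical functor for `(1, g)` and `(f, 1)` is the inverse of `Σ`,
so that a 2-functor on `A ⊗ B` is determined on `Σ` by its composite with that functor. -/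
theorem univCubical_mapComp_axis {a a' : A} (f : a ⟶ a') {b b' : B} (g : b ⟶ b') :
    HEq ((univCubical A B).mapComp (axis₂ a g) (axis₁ f b')).hom (sigma f g).inv :=
  shuffle_id (left_id a b) (right_id a' b') _ _ _

/-- Functors on the underlying category of `A ⊗ B` are determined by their values on generators. -/
theorem functor_map_heq (F G : Gray A B ⥤ D) (ho : ∀ x, F.obj x = G.obj x)
    (hl : ∀ {a a' : A} (f : a ⟶ a') (b : B), HEq (F.map (left f b)) (G.map (left f b)))
    (hr : ∀ (a : A) {b b' : B} (g : b ⟶ b'), HEq (F.map (right a g)) (G.map (right a g)))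
    {x y : Gray A B} (p : x ⟶ y) : HEq (F.map p) (G.map p) := by
  induction p using Quot.ind with
  | mk w =>
    induction w with
    | id x =>
      exact (heq_of_eq (F.map_id x)).trans ((hcongr_id (ho x)).trans (heq_of_eq (G.map_id x).symm))
    | @comp x y z v w hv hw =>
      exact (heq_of_eq (F.map_comp (ofWord v) (ofWord w))).trans
        ((hcongr_comp (ho x) (ho y) (ho z) hv hw).trans
          (heq_of_eq (G.map_comp (ofWord v) (ofWord w)).symm))
    | left f b => exact hl f b
    | right a g => exact hr a g

section
variable {K K' : StrictPseudofunctor (Gray A B) D}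
  (h : (univCubical A B).comp K.toPseudofunctor = (univCubical A B).comp K'.toPseudofunctor)
include h

theorem obj_unique (x : Gray A B) : K.obj x = K'.obj x := obj_of_eq h (x.fst, x.snd)

theorem map_unique {x y : Gray A B} (p : x ⟶ y) : HEq (K.map p) (K'.map p) := by
  refine functor_map_heq (StrictPseudofunctor.toFunctor K) (StrictPseudofunctor.toFunctor K')
    (obj_unique h) (fun f b => ?_) (fun a _ _ g => ?_) p
  · have e := univCubical_map_axis₁ f b
    exact (heq_of_eq (congrArg K.map e.symm)).trans
      ((map_of_eq h (axis₁ f b)).trans (heq_of_eq (congrArg K'.map e)))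
  · have e := univCubical_map_axis₂ a g
    exact (heq_of_eq (congrArg K.map e.symm)).trans
      ((map_of_eq h (axis₂ a g)).trans (heq_of_eq (congrArg K'.map e)))

theorem map₂_sigma_inv_unique {a a' : A} (f : a ⟶ a') {b b' : B} (g : b ⟶ b') :
    HEq (K.map₂ (sigma f g).inv) (K'.map₂ (sigma f g).inv) := by
  have e : (univCubical A B).map (axis₂ a g ≫ axis₁ f b') = left f b ≫ right a' g :=
    congrArg₂ (left · b ≫ right a' ·) (Strict.id_comp f) (Strict.comp_id g)
  have e' : (univCubical A B).map (axis₂ a g) ≫ (univCubical A B).map (axis₁ f b') =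
      right a g ≫ left f b' :=
    congrArg₂ (· ≫ ·) (univCubical_map_axis₂ a g) (univCubical_map_axis₁ f b')
  have hK (K : StrictPseudofunctor (Gray A B) D) : HEq (K.map₂ (sigma f g).inv)
      (((univCubical A B).comp K.toPseudofunctor).mapComp (axis₂ a g) (axis₁ f b')).hom :=
    (map₂_heq K.toPseudofunctor e.symm e'.symm (univCubical_mapComp_axis f g).symm).trans
      (IsEqToHom.heq_comp _ (.strict_mapComp K _ _)).symm
  exact (hK K).trans ((mapComp_hom_of_eq h _ _).trans (hK K').symm)

theorem map₂_unique {x y : Gray A B} {p q : x ⟶ y} (s : p ⟶ q) :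
    HEq (K.map₂ s) (K'.map₂ s) := by
  have ho := obj_unique h
  have hm {x y : Gray A B} (p : x ⟶ y) := map_unique h p
  induction s using Quot.ind with
  | mk s =>
    induction s with
    | ofEq e =>
      subst e
      exact (heq_of_eq (K.map₂_id _)).trans ((hcongr_id₂ (ho _) (ho _) (hm _)).trans
        (heq_of_eq (K'.map₂_id _).symm))
    | vcomp s t hs ht =>
      exact (heq_of_eq (K.map₂_comp (Quot.mk _ s) (Quot.mk _ t))).trans
        ((hcongr_comp₂ (ho _) (ho _) (hm _) (hm _) (hm _) hs ht).trans
        (heq_of_eq (K'.map₂_comp (Quot.mk _ s) (Quot.mk _ t)).symm))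
    | whiskerLeft p s hs =>
      exact (map₂_whiskerLeft_heq K p (Quot.mk _ s)).trans
        ((hcongr_whiskerLeft (ho _) (ho _) (ho _) (hm _) (hm _) (hm _) hs).trans
          (map₂_whiskerLeft_heq K' p (Quot.mk _ s)).symm)
    | whiskerRight s p hs =>
      exact (map₂_whiskerRight_heq K (Quot.mk _ s) p).trans
        ((hcongr_whiskerRight (ho _) (ho _) (ho _) (hm _) (hm _) (hm _) hs).trans
          (map₂_whiskerRight_heq K' (Quot.mk _ s) p).symm)
    | left α b =>
      have hK (K : StrictPseudofunctor (Gray A B) D) : HEq (K.map₂ (left₂ α b)) _ :=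
        map₂_heq K.toPseudofunctor (univCubical_map_axis₁ _ b).symm
          (univCubical_map_axis₁ _ b).symm (univCubical_map₂_axis₁ α b).symm
      exact (hK K).trans ((map₂_of_eq h _).trans (hK K').symm)
    | right a β =>
      have hK (K : StrictPseudofunctor (Gray A B) D) : HEq (K.map₂ (right₂ a β)) _ :=
        map₂_heq K.toPseudofunctor (univCubical_map_axis₂ a _).symm
          (univCubical_map_axis₂ a _).symm (univCubical_map₂_axis₂ a β).symm
      exact (hK K).trans ((map₂_of_eq h _).trans (hK K').symm)
    | sigma f g =>
      exact hcongr_inv (η := (K.map₂Iso (sigma f g)).symm) (η' := (K'.map₂Iso (sigma f g)).symm)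
        (ho _) (ho _) (hm _) (hm _) (map₂_sigma_inv_unique h f g)
    | sigmaInv f g => exact map₂_sigma_inv_unique h f g

theorem univCubical_comp_injective : K = K' :=
  strictPseudofunctor_ext (pseudofunctor_hext (obj_unique h) (map_unique h) (map₂_unique h)
    (fun x => hcongr_isEqToHom (obj_unique h x) (obj_unique h x) (map_unique h _)
      (.strict_mapId K x) (.strict_mapId K' x))
    (fun f g => hcongr_isEqToHom (obj_unique h _) (obj_unique h _) (map_unique h _)
      (.strict_mapComp K f g) (.strict_mapComp K' f g)))

end

end Gray

/-! ### 2-cells of the Gray tensor product -/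

namespace IsEqToHom

theorem whiskerLeft {K : Type*} [Bicategory K] {a b c : K} (f : a ⟶ b) {g h : b ⟶ c} {η : g ⟶ h}
    (hη : IsEqToHom η) : IsEqToHom (f ◁ η) := by
  obtain ⟨rfl, rfl⟩ := hη
  exact ⟨rfl, Bicategory.whiskerLeft_id f g⟩

theorem whiskerRight {K : Type*} [Bicategory K] {a b c : K} {f g : a ⟶ b} {η : f ⟶ g}
    (hη : IsEqToHom η) (h : b ⟶ c) : IsEqToHom (η ▷ h) := by
  obtain ⟨rfl, rfl⟩ := hη
  exact ⟨rfl, Bicategory.id_whiskerRight f h⟩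

theorem map₂_whiskerLeft {K L : Type u} [Bicategory.{u, u} K] [Bicategory.{u, u} L]
    (F : StrictPseudofunctor K L) {a b c : K} (f : a ⟶ b) {g h : b ⟶ c} {η : g ⟶ h}
    (hη : IsEqToHom (F.map₂ η)) : IsEqToHom (F.map₂ (f ◁ η)) := by
  rw [F.map₂_whisker_left]
  exact (IsEqToHom.strict_mapComp F f g).comp
    ((hη.whiskerLeft _).comp (IsEqToHom.strict_mapComp F f h).inv)

theorem map₂_whiskerRight {K L : Type u} [Bicategory.{u, u} K] [Bicategory.{u, u} L]
    (F : StrictPseudofunctor K L) {a b c : K} {f g : a ⟶ b} {η : f ⟶ g} (h : b ⟶ c)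
    (hη : IsEqToHom (F.map₂ η)) : IsEqToHom (F.map₂ (η ▷ h)) := by
  rw [F.map₂_whisker_right]
  exact (IsEqToHom.strict_mapComp F f h).comp
    ((hη.whiskerRight _).comp (IsEqToHom.strict_mapComp F g h).inv)

theorem map₂_comp {K L : Type u} [Bicategory.{u, u} K] [Bicategory.{u, u} L]
    (F : Pseudofunctor K L) {a b : K} {f g h : a ⟶ b} {η : f ⟶ g} {θ : g ⟶ h}
    (hη : IsEqToHom (F.map₂ η)) (hθ : IsEqToHom (F.map₂ θ)) : IsEqToHom (F.map₂ (η ≫ θ)) := by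
  rw [F.map₂_comp]
  exact hη.comp hθ

end IsEqToHom

theorem eq_cast_heq {K : Type*} [Category K] {a b a' b' : K} (ha : a = a') (hb : b = b')
    (f : a ⟶ b) : ∃ f' : a' ⟶ b', HEq f' f := by
  subst ha hb
  exact ⟨f, HEq.rfl⟩

namespace Gray

variable {A B D : Type u} [Bicategory.{u, u} A] [Bicategory.{u, u} B] [Bicategory.{u, u} D]
  [Strict A] [Strict B] [Strict D]

variable (A B) in
/-- The identity and the 2-functor induced by the universal cubical functor agree, as their
composites with the latter do. -/
theorem lift_univCubical :
    lift (isCubical_univCubical (A := A) (B := B)) = StrictPseudofunctor.id (Gray A B) :=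
  univCubical_comp_injective ((univCubical_lift _).trans
    (Strict.comp_id (B := Icon.{u}) (a := ⟨A × B⟩) (b := ⟨Gray A B⟩) (univCubical A B)).symm)

theorem lift_univCubical_map {x y : Gray A B} (p : x ⟶ y) :
    (liftPath (isCubical_univCubical (A := A) (B := B))).map p = p :=
  eq_of_heq (map_of_eq (congrArg (·.toPseudofunctor) (lift_univCubical A B)) p)

theorem liftCell_univCubical_heq {x y : Gray A B} {p q : x ⟶ y} (s : p ⟶ q) :
    HEq (liftCell (isCubical_univCubical (A := A) (B := B)) s) s :=
  map₂_of_eq (congrArg (·.toPseudofunctor) (lift_univCubical A B)) s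

/-- The 2-functor `A ⊗ B ⟶ A × B` is faithful on 2-cells: the identity of `A ⊗ B` is induced by the
universal cubical functor, and the action of an induced 2-functor on 2-cells factors through
`A × B`. -/
theorem proj_faithful {x y : Gray A B} {p q : x ⟶ y} {s t : p ⟶ q}
    (h₁ : (proj₁ A B).map₂ s = (proj₁ A B).map₂ t) (h₂ : (proj₂ A B).map₂ s = (proj₂ A B).map₂ t) :
    s = t := by
  have h : prj₂ s = prj₂ t := Prod.ext h₁ h₂
  refine eq_of_heq ((liftCell_univCubical_heq s).symm.trans (HEq.trans ?_
    (liftCell_univCubical_heq t)))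
  rw [liftCell, h, liftCell]

theorem isEqToHom_map₂_liftIso (F : StrictPseudofunctor (Gray A B) D)
    (hF : ∀ {x y z : A × B} (p : x ⟶ y) (q : y ⟶ z),
      IsEqToHom (F.map₂ ((univCubical A B).mapComp p q).hom)) {x y : Gray A B} (p : x ⟶ y) :
    IsEqToHom (F.map₂ (liftIso (isCubical_univCubical (A := A) (B := B)) p).hom) := by
  induction p using Quot.ind with
  | mk w =>
    induction w with
    | id x => exact (univCubical_mapId (x.fst, x.snd)).inv.map₂ F.toPseudofunctor
    | comp v w hv hw =>
      have h : IsEqToHom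
          (F.map₂Iso ((univCubical A B).mapComp (prj (ofWord v)) (prj (ofWord w)))).hom := hF _ _
      exact .map₂_comp F.toPseudofunctor (.map₂_whiskerRight F _ hv)
        (.map₂_comp F.toPseudofunctor (.map₂_whiskerLeft F _ hw) h.inv)
    | left f b => exact ⟨rfl, F.map₂_id _⟩
    | right a g => exact ⟨rfl, F.map₂_id _⟩

/-- The 2-functor `A ⊗ B ⟶ A × B` is full on 2-cells. -/
theorem proj_full {x y : Gray A B} {p q : x ⟶ y} (α : (proj₁ A B).map p ⟶ (proj₁ A B).map q)
    (β : (proj₂ A B).map p ⟶ (proj₂ A B).map q) :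
    ∃ s : p ⟶ q, (proj₁ A B).map₂ s = α ∧ (proj₂ A B).map₂ s = β := by
  have hc := isCubical_univCubical (A := A) (B := B)
  let t : (liftPath hc).map p ⟶ (liftPath hc).map q := (liftIso hc p).hom ≫
    (univCubical A B).map₂ (show prj p ⟶ prj q from Prod.mkHom α β) ≫ (liftIso hc q).inv
  obtain ⟨s, hs⟩ := eq_cast_heq (lift_univCubical_map p) (lift_univCubical_map q) t
  have hF {K : Type u} [Bicategory.{u, u} K] [Strict K] (F : StrictPseudofunctor (Gray A B) K)
      (hF : ∀ {x y z : A × B} (p : x ⟶ y) (q : y ⟶ z),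
        IsEqToHom (F.map₂ ((univCubical A B).mapComp p q).hom)) :
      HEq (F.map₂ s) (F.map₂ ((univCubical A B).map₂
        (show prj p ⟶ prj q from Prod.mkHom α β))) := by
    refine (map₂_heq F.toPseudofunctor (lift_univCubical_map p).symm
      (lift_univCubical_map q).symm hs).trans ?_
    have h₁ := isEqToHom_map₂_liftIso F hF p
    have h₂ : IsEqToHom (F.map₂Iso (liftIso hc q)).hom := isEqToHom_map₂_liftIso F hF q
    refine (heq_of_eq ((F.map₂_comp _ _).trans (congrArg _ (F.map₂_comp _ _)))).trans ?_
    exact (h₁.comp_heq _).trans (IsEqToHom.heq_comp _ h₂.inv)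
  exact ⟨s, eq_of_heq ((hF (proj₁ A B) proj₁_univCubical_mapComp).trans
      (proj₁_univCubical_map₂ _)),
    eq_of_heq ((hF (proj₂ A B) proj₂_univCubical_mapComp).trans (proj₂_univCubical_map₂ _))⟩

end Gray

namespace GrayIcon

theorem isUniversalCubical_cubical (A B : GrayIcon.{u}) : IsUniversalCubical (cubical A B) :=
  ⟨Gray.isCubical_univCubical, fun _ _ hH => ⟨Gray.lift hH, Gray.univCubical_lift hH,
    fun _ hK => Gray.univCubical_comp_injective (hK.trans (Gray.univCubical_lift hH).symm)⟩⟩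

end GrayIcon

/-! ### Icons into a 2-category with jointly fully faithful projections -/

section IconPair

variable {X E A B : Type u} [Bicategory.{u, u} X] [Bicategory.{u, u} E] [Bicategory.{u, u} A]
  [Bicategory.{u, u} B]

theorem fst_eq_of_hom {F G : AnyLax X E} (α : F ⟶ G) : F.1 = G.1 := by
  obtain ⟨α⟩ := α
  rfl

theorem exists_eq_mk {o : X → E} {F G : LaxData o} (α : (⟨o, F⟩ : AnyLax X E) ⟶ ⟨o, G⟩) :
    ∃ α' : F ⟶ G, α = Sigma.SigmaHom.mk α' := by
  obtain ⟨α⟩ := α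
  exact ⟨α, rfl⟩

theorem nat_eq_of_mk_eq {o : X → E} {F G : LaxData o} {α β : F ⟶ G}
    (h : (Sigma.SigmaHom.mk α : (⟨o, F⟩ : AnyLax X E) ⟶ ⟨o, G⟩) = Sigma.SigmaHom.mk β) : α = β := by
  cases h
  rfl

/-- Two functors `P : E ⟶ A` and `Q : E ⟶ B` are jointly injective on 0-cells and jointly bijective
on 2-cells between given parallel 1-cells. -/
structure JointlyFullyFaithful (P : Pseudofunctor E A) (Q : Pseudofunctor E B) : Prop where
  obj {x y : E} (h₁ : P.obj x = P.obj y) (h₂ : Q.obj x = Q.obj y) : x = y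
  faithful {x y : E} {p q : x ⟶ y} {s t : p ⟶ q} (h₁ : P.map₂ s = P.map₂ t)
    (h₂ : Q.map₂ s = Q.map₂ t) : s = t
  full {x y : E} {p q : x ⟶ y} (α : P.map p ⟶ P.map q) (β : Q.map p ⟶ Q.map q) :
    ∃ s : p ⟶ q, P.map₂ s = α ∧ Q.map₂ s = β

variable {P : Pseudofunctor E A} {Q : Pseudofunctor E B} (h : JointlyFullyFaithful P Q)
include h

theorem JointlyFullyFaithful.icon_unique {F G : AnyLax X E} {γ γ' : F ⟶ G}
    (h₁ : (postLax (lax P)).map γ = (postLax (lax P)).map γ')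
    (h₂ : (postLax (lax Q)).map γ = (postLax (lax Q)).map γ') : γ = γ' := by
  obtain ⟨γ⟩ := γ
  obtain ⟨γ', rfl⟩ := exists_eq_mk γ'
  refine sigma_ext fun a b f => h.faithful ?_ ?_
  · exact congrArg (fun i => (i.nat a b).app f) (nat_eq_of_mk_eq h₁)
  · exact congrArg (fun i => (i.nat a b).app f) (nat_eq_of_mk_eq h₂)

/-- Icons exist only between functors that agree on 0-cells. Injectivity on 0-cells therefore gives
`F` and `G` the same object map, and then the components are lifted one by one. -/
theorem JointlyFullyFaithful.icon_exists {F G : AnyLax X E}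
    (α : compLax F (lax P) ⟶ compLax G (lax P)) (β : compLax F (lax Q) ⟶ compLax G (lax Q)) :
    ∃ γ : F ⟶ G, (postLax (lax P)).map γ = α ∧ (postLax (lax Q)).map γ = β := by
  obtain ⟨o, F⟩ := F
  obtain ⟨o', G⟩ := G
  obtain rfl : o = o' :=
    funext fun x => h.obj (congrFun (fst_eq_of_hom α) x) (congrFun (fst_eq_of_hom β) x)
  obtain ⟨α, rfl⟩ := exists_eq_mk α
  obtain ⟨β, rfl⟩ := exists_eq_mk β
  choose γ hP hQ using fun (a b : X) (f : a ⟶ b) => h.full ((α.nat a b).app f) ((β.nat a b).app f)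
  have natural {Y : Type u} [Bicategory.{u, u} Y] (R : Pseudofunctor E Y)
      (δ : (compLax ⟨o, F⟩ (lax R)).2 ⟶ (compLax ⟨o, G⟩ (lax R)).2)
      (hR : ∀ a b f, R.map₂ (γ a b f) = (δ.nat a b).app f) {a b : X} {f g : a ⟶ b} (η : f ⟶ g) :
      R.map₂ ((F.hom a b).map η ≫ γ a b g) = R.map₂ (γ a b f ≫ (G.hom a b).map η) := by
    rw [R.map₂_comp, R.map₂_comp, hR, hR]
    exact (δ.nat a b).naturality η
  have unit {Y : Type u} [Bicategory.{u, u} Y] (R : Pseudofunctor E Y)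
      (δ : (compLax ⟨o, F⟩ (lax R)).2 ⟶ (compLax ⟨o, G⟩ (lax R)).2)
      (hR : ∀ a b f, R.map₂ (γ a b f) = (δ.nat a b).app f) (a : X) :
      R.map₂ (F.unit a ≫ γ a a (𝟙 a)) = R.map₂ (G.unit a) := by
    rw [R.map₂_comp, hR]
    have := δ.unit a
    exact (cancel_epi (R.mapId (o a)).inv).1 ((Category.assoc _ _ _).symm.trans this)
  have comp {Y : Type u} [Bicategory.{u, u} Y] (R : Pseudofunctor E Y)
      (δ : (compLax ⟨o, F⟩ (lax R)).2 ⟶ (compLax ⟨o, G⟩ (lax R)).2)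
      (hR : ∀ a b f, R.map₂ (γ a b f) = (δ.nat a b).app f) {a b c : X} (f : a ⟶ b) (g : b ⟶ c) :
      R.map₂ (F.comp f g ≫ γ a c (f ≫ g)) =
        R.map₂ ((γ a b f ▷ (F.hom b c).obj g ≫ (G.hom a b).obj f ◁ γ b c g) ≫ G.comp f g) := by
    have e := δ.comp f g
    rw [← hR, ← hR, ← hR] at e
    refine (cancel_epi (R.mapComp ((F.hom a b).obj f) ((F.hom b c).obj g)).inv).1 ?_
    refine (congrArg (_ ≫ ·) (R.map₂_comp _ _)).trans
      ((Category.assoc _ _ _).symm.trans (e.trans ?_))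
    dsimp [compLax, lax]
    simp only [R.map₂_comp, Pseudofunctor.map₂_whisker_left, Pseudofunctor.map₂_whisker_right,
      Category.assoc, Iso.inv_hom_id_assoc]
    exact Category.assoc _ _ _
  refine ⟨Sigma.SigmaHom.mk
    { nat := fun a b =>
        { app := γ a b
          naturality := fun _ _ η => h.faithful (natural P α hP η) (natural Q β hQ η) }
      unit := fun a => h.faithful (unit P α hP a) (unit Q β hQ a)
      comp := fun f g => h.faithful (comp P α hP f g) (comp Q β hQ f g) }, ?_, ?_⟩
  · exact sigma_ext fun a b f => hP a b f
  · exact sigma_ext fun a b f => hQ a b f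

end IconPair

theorem jointlyFullyFaithful_gray (A B : GrayIcon.{u}) : JointlyFullyFaithful
    (Gray.proj₁ A.carrier B.carrier).toPseudofunctor
    (Gray.proj₂ A.carrier B.carrier).toPseudofunctor where
  obj h₁ h₂ := Gray.ext h₁ h₂
  faithful := Gray.proj_faithful
  full := Gray.proj_full

theorem jointlyFullyFaithful_prod (A B : Icon.{u}) :
    JointlyFullyFaithful (Icon.fst A B) (Icon.snd A B) where
  obj h₁ h₂ := Prod.ext h₁ h₂
  faithful h₁ h₂ := Prod.ext h₁ h₂
  full α β := ⟨Prod.mkHom α β, rfl, rfl⟩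

/-! ### Tensor products with projections -/

universe w v x

/-- The 2-cells `γ` and `α` are intertwined by the 1-cells `p` and `q`: the composites of `γ` with
`q` and of `p` with `α` agree. The equality is heterogeneous, as its two sides are 2-cells between
1-cells that are equal but not definitionally so. -/
structure Square {K : Type x} [Bicategory.{w, v} K] {a b c d : K} {F F' : a ⟶ b} (γ : F ⟶ F')
    (q : b ⟶ d) (p : a ⟶ c) {G G' : c ⟶ d} (α : G ⟶ G') : Prop where
  source : F ≫ q = p ≫ G
  target : F' ≫ q = p ≫ G'
  heq : HEq (γ ▷ q) (p ◁ α)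

namespace Square

variable {K : Type x} [Bicategory.{w, v} K] [Strict K]

theorem comp_whiskerLeft_heq {a b c d : K} (f : a ⟶ b) (g : b ⟶ c) {h k : c ⟶ d} (η : h ⟶ k) :
    HEq ((f ≫ g) ◁ η) (f ◁ g ◁ η) := by
  rw [comp_whiskerLeft, Strict.associator_eqToIso, Strict.associator_eqToIso]
  exact conj_eqToHom_heq (Strict.assoc f g h) (Strict.assoc f g k).symm _

theorem whiskerRight_comp_heq {a b c d : K} {f g : a ⟶ b} (η : f ⟶ g) (h : b ⟶ c) (k : c ⟶ d) :
    HEq (η ▷ (h ≫ k)) (η ▷ h ▷ k) := by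
  rw [whiskerRight_comp, Strict.associator_eqToIso, Strict.associator_eqToIso]
  exact conj_eqToHom_heq (Strict.assoc f h k).symm (Strict.assoc g h k) _

theorem whisker_assoc_heq {a b c d : K} (f : a ⟶ b) {g h : b ⟶ c} (η : g ⟶ h) (k : c ⟶ d) :
    HEq ((f ◁ η) ▷ k) (f ◁ (η ▷ k)) := by
  rw [whisker_assoc, Strict.associator_eqToIso, Strict.associator_eqToIso]
  exact conj_eqToHom_heq (Strict.assoc f g k) (Strict.assoc f h k).symm _

variable {a b c d e : K} {F F' F'' : a ⟶ b} {γ : F ⟶ F'} {γ' : F' ⟶ F''} {q : b ⟶ d} {p : a ⟶ c}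
  {G G' G'' : c ⟶ d} {α : G ⟶ G'} {α' : G' ⟶ G''}

theorem iff_eq (h : F ≫ q = p ≫ G) (h' : F' ≫ q = p ≫ G') :
    Square γ q p α ↔ γ ▷ q = eqToHom h ≫ p ◁ α ≫ eqToHom h'.symm := by
  constructor
  · intro s
    exact eq_of_heq (s.heq.trans (conj_eqToHom_heq _ _ _).symm)
  · intro e
    exact ⟨h, h', (heq_of_eq e).trans (conj_eqToHom_heq _ _ _)⟩

theorem unique {δ : F ⟶ F'} (s : Square γ q p α) (t : Square δ q p α) : γ ▷ q = δ ▷ q :=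
  eq_of_heq (s.heq.trans t.heq.symm)

theorem id (h : F ≫ q = p ≫ G) : Square (𝟙 F) q p (𝟙 G) :=
  (iff_eq h h).2 (by simp)

theorem vcomp (s : Square γ q p α) (t : Square γ' q p α') : Square (γ ≫ γ') q p (α ≫ α') := by
  have hs := (iff_eq s.source s.target).1 s
  have ht := (iff_eq t.source t.target).1 t
  rw [iff_eq s.source t.target]
  simp [hs, ht]

theorem conj {F₁ F₂ : a ⟶ b} (h : F₁ = F) (h' : F' = F₂) (s : Square γ q p α) :
    Square (eqToHom h ≫ γ ≫ eqToHom h') q p α := by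
  subst h h'
  simpa using s

/-- Squares can be composed in the direction of the 1-cells. -/
theorem paste {q' : d ⟶ e} {f : K} {p' : c ⟶ f} {H H' : f ⟶ e} {δ : H ⟶ H'}
    (s : Square γ q p α) (t : Square α q' p' δ) : Square γ (q ≫ q') (p ≫ p') δ where
  source := by rw [← Strict.assoc, s.source, Strict.assoc, t.source, Strict.assoc]
  target := by rw [← Strict.assoc, s.target, Strict.assoc, t.target, Strict.assoc]
  heq := (whiskerRight_comp_heq γ q q').trans
    ((hcongr_whiskerRight rfl rfl rfl (heq_of_eq s.source) (heq_of_eq s.target) HEq.rfl s.heq).trans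
    ((whisker_assoc_heq p α q').trans
    ((hcongr_whiskerLeft rfl rfl rfl HEq.rfl (heq_of_eq t.source) (heq_of_eq t.target) t.heq).trans
    (comp_whiskerLeft_heq p p' δ).symm)))

theorem whiskerLeft {a' c' : K} {f : a' ⟶ a} {p' : a' ⟶ c'} {g : c' ⟶ c} (h : f ≫ p = p' ≫ g)
    (s : Square γ q p α) : Square (f ◁ γ) q p' (g ◁ α) where
  source := by rw [Strict.assoc, s.source, ← Strict.assoc, h, Strict.assoc]
  target := by rw [Strict.assoc, s.target, ← Strict.assoc, h, Strict.assoc]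
  heq := (whisker_assoc_heq f γ q).trans
    ((hcongr_whiskerLeft rfl rfl rfl HEq.rfl (heq_of_eq s.source) (heq_of_eq s.target) s.heq).trans
    ((comp_whiskerLeft_heq f p α).symm.trans
    ((heq_of_eq_left h α).trans (comp_whiskerLeft_heq p' g α))))
where
  heq_of_eq_left {a c d : K} {f f' : a ⟶ c} (h : f = f') {G G' : c ⟶ d} (α : G ⟶ G') :
      HEq (f ◁ α) (f' ◁ α) := by
    subst h
    rfl

theorem whiskerRight {b' d' : K} {l : b ⟶ b'} {q' : b' ⟶ d'} {k : d ⟶ d'} (h : l ≫ q' = q ≫ k)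
    (s : Square γ q p α) : Square (γ ▷ l) q' p (α ▷ k) where
  source := by rw [Strict.assoc, h, ← Strict.assoc, s.source, Strict.assoc]
  target := by rw [Strict.assoc, h, ← Strict.assoc, s.target, Strict.assoc]
  heq := (whiskerRight_comp_heq γ l q').symm.trans
    ((heq_of_eq_right h γ).trans ((whiskerRight_comp_heq γ q k).trans
    ((hcongr_whiskerRight rfl rfl rfl (heq_of_eq s.source) (heq_of_eq s.target) HEq.rfl s.heq).trans
    (whisker_assoc_heq p α k))))
where
  heq_of_eq_right {a c d : K} {f f' : c ⟶ d} (h : f = f') {G G' : a ⟶ c} (α : G ⟶ G') :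
      HEq (α ▷ f) (α ▷ f') := by
    subst h
    rfl

theorem of_comp_right {b' : K} {r : b ⟶ b'} {q' : b' ⟶ d} (h : r ≫ q' = q) (s : Square γ q p α) :
    Square (γ ▷ r) q' p α := by
  subst h
  exact ⟨(Strict.assoc _ _ _).trans s.source, (Strict.assoc _ _ _).trans s.target,
    (whiskerRight_comp_heq γ r q').symm.trans s.heq⟩

theorem of_comp_left {a' : K} {r : a' ⟶ a} {p' : a' ⟶ c} (h : r ≫ p = p') (s : Square γ q p α) :
    Square (r ◁ γ) q p' α := by
  subst h
  exact ⟨by rw [Strict.assoc, s.source, Strict.assoc], by rw [Strict.assoc, s.target, Strict.assoc],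
    (whisker_assoc_heq r γ q).trans ((hcongr_whiskerLeft rfl rfl rfl HEq.rfl (heq_of_eq s.source)
      (heq_of_eq s.target) s.heq).trans (comp_whiskerLeft_heq r p α).symm)⟩

end Square

/-- Projections for a tensor product `T` on a 2-category which determine all 2-cells into `T a b`,
together with an action of `T` on 1-cells and associativity and unit isomorphisms that are
compatible with the projections. The projections need not determine the 1-cells into `T a b`: they
do so only among parallel 1-cells that are related by `rel`. (For the Gray tensor product, 1-cells
are related if they have the same underlying functor on 0-cells and 1-cells.) -/
structure Projections (K : Type x) [Bicategory.{w, v} K] [Strict K] (T : K → K → K) (I : K) where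
  fst (a b : K) : T a b ⟶ a
  snd (a b : K) : T a b ⟶ b
  rel {c d : K} (F G : c ⟶ d) : Prop
  rel_comp {c d e : K} {F G : c ⟶ d} (h : rel F G) (H : d ⟶ e) : rel (F ≫ H) (G ≫ H)
  hom_ext {c a b : K} {F G : c ⟶ T a b} (h : rel F G) (h₁ : F ≫ fst a b = G ≫ fst a b)
    (h₂ : F ≫ snd a b = G ≫ snd a b) : F = G
  pair₂ {c a b : K} {F G : c ⟶ T a b} (α : F ≫ fst a b ⟶ G ≫ fst a b)
    (β : F ≫ snd a b ⟶ G ≫ snd a b) : ∃ γ : F ⟶ G, γ ▷ fst a b = α ∧ γ ▷ snd a b = β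
  hom_ext₂ {c a b : K} {F G : c ⟶ T a b} {γ δ : F ⟶ G} (h₁ : γ ▷ fst a b = δ ▷ fst a b)
    (h₂ : γ ▷ snd a b = δ ▷ snd a b) : γ = δ
  map {a a' b b' : K} (f : a ⟶ a') (g : b ⟶ b') : T a b ⟶ T a' b'
  map_fst {a a' b b' : K} (f : a ⟶ a') (g : b ⟶ b') : map f g ≫ fst a' b' = fst a b ≫ f
  map_snd {a a' b b' : K} (f : a ⟶ a') (g : b ⟶ b') : map f g ≫ snd a' b' = snd a b ≫ g
  associator (a b c : K) : T (T a b) c ≅ T a (T b c)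
  associator_fst (a b c : K) : (associator a b c).hom ≫ fst a (T b c) = fst (T a b) c ≫ fst a b
  associator_snd_fst (a b c : K) :
    (associator a b c).hom ≫ snd a (T b c) ≫ fst b c = fst (T a b) c ≫ snd a b
  associator_snd_snd (a b c : K) :
    (associator a b c).hom ≫ snd a (T b c) ≫ snd b c = snd (T a b) c
  leftUnitor (a : K) : T I a ≅ a
  leftUnitor_hom (a : K) : (leftUnitor a).hom = snd I a
  rightUnitor (a : K) : T a I ≅ a
  rightUnitor_hom (a : K) : (rightUnitor a).hom = fst a I
  rel_map_id (a b : K) : rel (map (𝟙 a) (𝟙 b)) (𝟙 (T a b))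
  rel_map_comp {a a' a'' b b' b'' : K} (f : a ⟶ a') (f' : a' ⟶ a'') (g : b ⟶ b') (g' : b' ⟶ b'') :
    rel (map (f ≫ f') (g ≫ g')) (map f g ≫ map f' g')
  rel_associator_natural {a a' b b' c c' : K} (f : a ⟶ a') (g : b ⟶ b') (h : c ⟶ c') :
    rel (map (map f g) h ≫ (associator a' b' c').hom) ((associator a b c).hom ≫ map f (map g h))
  rel_pentagon (a b c d : K) :
    rel (map (associator a b c).hom (𝟙 d) ≫ (associator a (T b c) d).hom ≫
        map (𝟙 a) (associator b c d).hom)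
      ((associator (T a b) c d).hom ≫ (associator a b (T c d)).hom)
  rel_triangle (a b : K) :
    rel ((associator a I b).hom ≫ map (𝟙 a) (leftUnitor b).hom) (map (rightUnitor a).hom (𝟙 b))

namespace Projections

variable {K : Type x} [Bicategory.{w, v} K] [Strict K] {T : K → K → K} {I : K}
  (P : Projections K T I)

theorem exists_map₂ {a a' b b' : K} {f f' : a ⟶ a'} {g g' : b ⟶ b'} (α : f ⟶ f') (β : g ⟶ g') :
    ∃ γ : P.map f g ⟶ P.map f' g', Square γ (P.fst a' b') (P.fst a b) α ∧
      Square γ (P.snd a' b') (P.snd a b) β := by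
  obtain ⟨γ, h₁, h₂⟩ := P.pair₂
    (eqToHom (P.map_fst f g) ≫ P.fst a b ◁ α ≫ eqToHom (P.map_fst f' g').symm)
    (eqToHom (P.map_snd f g) ≫ P.snd a b ◁ β ≫ eqToHom (P.map_snd f' g').symm)
  exact ⟨γ, (Square.iff_eq (P.map_fst f g) (P.map_fst f' g')).2 h₁,
    (Square.iff_eq (P.map_snd f g) (P.map_snd f' g')).2 h₂⟩

/-- The action of the tensor product on 2-cells, which is determined by the projections. -/
noncomputable def map₂ {a a' b b' : K} {f f' : a ⟶ a'} {g g' : b ⟶ b'} (α : f ⟶ f') (β : g ⟶ g') :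
    P.map f g ⟶ P.map f' g' :=
  (P.exists_map₂ α β).choose

section
variable {a a' b b' : K} {f f' : a ⟶ a'} {g g' : b ⟶ b'} (α : f ⟶ f') (β : g ⟶ g')

theorem map₂_fst : Square (P.map₂ α β) (P.fst a' b') (P.fst a b) α :=
  (P.exists_map₂ α β).choose_spec.1

theorem map₂_snd : Square (P.map₂ α β) (P.snd a' b') (P.snd a b) β :=
  (P.exists_map₂ α β).choose_spec.2

end

theorem square_ext {c d e a b : K} {F G : c ⟶ T a b} {γ δ : F ⟶ G} {p : c ⟶ d} {q : c ⟶ e}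
    {f f' : d ⟶ a} {g g' : e ⟶ b} {α : f ⟶ f'} {β : g ⟶ g'} (h₁ : Square γ (P.fst a b) p α)
    (h₂ : Square γ (P.snd a b) q β) (h₁' : Square δ (P.fst a b) p α)
    (h₂' : Square δ (P.snd a b) q β) : γ = δ :=
  P.hom_ext₂ (h₁.unique h₁') (h₂.unique h₂')

theorem map_fst_assoc {a a' b b' c : K} (f : a ⟶ a') (g : b ⟶ b') (k : a' ⟶ c) :
    P.map f g ≫ P.fst a' b' ≫ k = P.fst a b ≫ f ≫ k := by
  rw [← Strict.assoc, P.map_fst, Strict.assoc]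

theorem map_snd_assoc {a a' b b' c : K} (f : a ⟶ a') (g : b ⟶ b') (k : b' ⟶ c) :
    P.map f g ≫ P.snd a' b' ≫ k = P.snd a b ≫ g ≫ k := by
  rw [← Strict.assoc, P.map_snd, Strict.assoc]

theorem associator_fst_assoc {d : K} (a b c : K) (k : a ⟶ d) :
    (P.associator a b c).hom ≫ P.fst a (T b c) ≫ k = P.fst (T a b) c ≫ P.fst a b ≫ k := by
  rw [← Strict.assoc, P.associator_fst, Strict.assoc]

theorem associator_snd_fst_assoc {d : K} (a b c : K) (k : b ⟶ d) :
    (P.associator a b c).hom ≫ P.snd a (T b c) ≫ P.fst b c ≫ k =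
      P.fst (T a b) c ≫ P.snd a b ≫ k := by
  rw [← Strict.assoc (P.snd _ _), ← Strict.assoc, P.associator_snd_fst, Strict.assoc]

theorem associator_snd_snd_assoc {d : K} (a b c : K) (k : c ⟶ d) :
    (P.associator a b c).hom ≫ P.snd a (T b c) ≫ P.snd b c ≫ k = P.snd (T a b) c ≫ k := by
  rw [← Strict.assoc (P.snd _ _), ← Strict.assoc, P.associator_snd_snd]

end Projections

/-! ### The strongly monoidal structure determined by projections -/

namespace Projections

variable {K : Type x} [Bicategory.{w, v} K] [Strict K] {T : K → K → K} {I : K}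
  (P : Projections K T I)

theorem hom_ext_nested {d a b c : K} {F G : d ⟶ T a (T b c)} (h : P.rel F G)
    (h₁ : F ≫ P.fst a (T b c) = G ≫ P.fst a (T b c))
    (h₂ : F ≫ P.snd a (T b c) ≫ P.fst b c = G ≫ P.snd a (T b c) ≫ P.fst b c)
    (h₃ : F ≫ P.snd a (T b c) ≫ P.snd b c = G ≫ P.snd a (T b c) ≫ P.snd b c) : F = G := by
  simp only [← Strict.assoc] at h₂ h₃
  exact P.hom_ext h h₁ (P.hom_ext (P.rel_comp h _) h₂ h₃)

theorem map_id (a b : K) : P.map (𝟙 a) (𝟙 b) = 𝟙 (T a b) := by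
  apply P.hom_ext (P.rel_map_id a b) <;>
    simp only [map_fst, map_snd, Strict.id_comp, Strict.comp_id]

theorem map_comp {a a' a'' b b' b'' : K} (f : a ⟶ a') (f' : a' ⟶ a'') (g : b ⟶ b')
    (g' : b' ⟶ b'') : P.map (f ≫ f') (g ≫ g') = P.map f g ≫ P.map f' g' := by
  apply P.hom_ext (P.rel_map_comp f f' g g') <;>
    simp only [map_fst, map_snd, map_fst_assoc, map_snd_assoc, Strict.assoc]

theorem associator_natural {a a' b b' c c' : K} (f : a ⟶ a') (g : b ⟶ b') (h : c ⟶ c') :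
    P.map (P.map f g) h ≫ (P.associator a' b' c').hom =
      (P.associator a b c).hom ≫ P.map f (P.map g h) := by
  apply P.hom_ext_nested (P.rel_associator_natural f g h) <;>
    simp only [map_fst, map_snd, map_fst_assoc, map_snd_assoc, Strict.assoc, associator_fst,
      associator_snd_fst, associator_snd_snd, associator_fst_assoc, associator_snd_fst_assoc,
      associator_snd_snd_assoc]

theorem pentagon (a b c d : K) :
    P.map (P.associator a b c).hom (𝟙 d) ≫ (P.associator a (T b c) d).hom ≫
        P.map (𝟙 a) (P.associator b c d).hom =
      (P.associator (T a b) c d).hom ≫ (P.associator a b (T c d)).hom := by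
  have h := P.rel_pentagon a b c d
  refine P.hom_ext h ?_ (P.hom_ext_nested (P.rel_comp h _) ?_ ?_ ?_) <;>
    simp only [map_fst, map_snd, map_fst_assoc, Strict.assoc, associator_fst,
      associator_snd_fst, associator_snd_snd, associator_fst_assoc, associator_snd_fst_assoc,
      associator_snd_snd_assoc, Strict.comp_id]

theorem triangle (a b : K) :
    (P.associator a I b).hom ≫ P.map (𝟙 a) (P.leftUnitor b).hom =
      P.map (P.rightUnitor a).hom (𝟙 b) := by
  apply P.hom_ext (P.rel_triangle a b) <;>
    simp only [map_fst, map_snd, Strict.assoc, associator_fst, associator_snd_snd,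
      leftUnitor_hom, rightUnitor_hom, Strict.comp_id]

theorem leftUnitor_natural {a a' : K} (f : a ⟶ a') :
    P.map (𝟙 I) f ≫ (P.leftUnitor a').hom = (P.leftUnitor a).hom ≫ f := by
  rw [leftUnitor_hom, leftUnitor_hom, map_snd]

theorem rightUnitor_natural {a a' : K} (f : a ⟶ a') :
    P.map f (𝟙 I) ≫ (P.rightUnitor a').hom = (P.rightUnitor a).hom ≫ f := by
  rw [rightUnitor_hom, rightUnitor_hom, map_fst]

theorem square_ext_nested {d a b c e₁ e₂ e₃ : K} {F G : d ⟶ T a (T b c)} {γ δ : F ⟶ G}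
    {p₁ : d ⟶ e₁} {p₂ : d ⟶ e₂} {p₃ : d ⟶ e₃} {f f' : e₁ ⟶ a} {g g' : e₂ ⟶ b} {h h' : e₃ ⟶ c}
    {α : f ⟶ f'} {β : g ⟶ g'} {θ : h ⟶ h'}
    (h₁ : Square γ (P.fst a (T b c)) p₁ α) (h₁' : Square δ (P.fst a (T b c)) p₁ α)
    (h₂ : Square γ (P.snd a (T b c) ≫ P.fst b c) p₂ β)
    (h₂' : Square δ (P.snd a (T b c) ≫ P.fst b c) p₂ β)
    (h₃ : Square γ (P.snd a (T b c) ≫ P.snd b c) p₃ θ)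
    (h₃' : Square δ (P.snd a (T b c) ≫ P.snd b c) p₃ θ) : γ = δ :=
  P.hom_ext₂ (h₁.unique h₁') (P.square_ext (h₂.of_comp_right rfl) (h₃.of_comp_right rfl)
    (h₂'.of_comp_right rfl) (h₃'.of_comp_right rfl))

theorem associator_natural₂ {a a' b b' c c' : K} {f f' : a ⟶ a'} {g g' : b ⟶ b'} {h h' : c ⟶ c'}
    (α : f ⟶ f') (β : g ⟶ g') (γ : h ⟶ h') :
    P.map₂ (P.map₂ α β) γ ▷ (P.associator a' b' c').hom =
      eqToHom (P.associator_natural f g h) ≫ (P.associator a b c).hom ◁ P.map₂ α (P.map₂ β γ) ≫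
        eqToHom (P.associator_natural f' g' h').symm := by
  have l := P.map₂_fst (P.map₂ α β) γ
  have r := P.map₂_snd α (P.map₂ β γ)
  refine P.square_ext_nested ((l.paste (P.map₂_fst α β)).of_comp_right (P.associator_fst ..))
    (((P.map₂_fst α (P.map₂ β γ)).of_comp_left (P.associator_fst ..)).conj _ _)
    ((l.paste (P.map₂_snd α β)).of_comp_right (P.associator_snd_fst ..))
    (((r.paste (P.map₂_fst β γ)).of_comp_left (P.associator_snd_fst ..)).conj _ _)
    ((P.map₂_snd (P.map₂ α β) γ).of_comp_right (P.associator_snd_snd ..))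
    (((r.paste (P.map₂_snd β γ)).of_comp_left (P.associator_snd_snd ..)).conj _ _)

/-- The strongly monoidal structure determined by projections. -/
noncomputable def toStronglyMonoidal : StronglyMonoidal K T I where
  map := P.map
  map₂ := P.map₂
  map_id := P.map_id
  map_comp := P.map_comp
  map₂_id f g := P.square_ext (P.map₂_fst _ _) (P.map₂_snd _ _) (Square.id (P.map_fst f g))
    (Square.id (P.map_snd f g))
  map₂_comp α α' β β' := P.square_ext (P.map₂_fst _ _) (P.map₂_snd _ _)
    ((P.map₂_fst α β).vcomp (P.map₂_fst α' β')) ((P.map₂_snd α β).vcomp (P.map₂_snd α' β'))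
  map₂_whiskerLeft f _ _ α g _ _ β := P.square_ext (P.map₂_fst _ _) (P.map₂_snd _ _)
    (((P.map₂_fst α β).whiskerLeft (P.map_fst f g)).conj _ _)
    (((P.map₂_snd α β).whiskerLeft (P.map_snd f g)).conj _ _)
  map₂_whiskerRight α k _ _ β l := P.square_ext (P.map₂_fst _ _) (P.map₂_snd _ _)
    (((P.map₂_fst α β).whiskerRight (P.map_fst k l)).conj _ _)
    (((P.map₂_snd α β).whiskerRight (P.map_snd k l)).conj _ _)
  associator := P.associator
  associator_natural := P.associator_natural
  associator_natural₂ := P.associator_natural₂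
  leftUnitor := P.leftUnitor
  leftUnitor_natural := P.leftUnitor_natural
  leftUnitor_natural₂ α :=
    (Square.iff_eq (P.leftUnitor_natural _) (P.leftUnitor_natural _)).1 (by
      rw [P.leftUnitor_hom, P.leftUnitor_hom]
      exact P.map₂_snd _ α)
  rightUnitor := P.rightUnitor
  rightUnitor_natural := P.rightUnitor_natural
  rightUnitor_natural₂ α :=
    (Square.iff_eq (P.rightUnitor_natural _) (P.rightUnitor_natural _)).1 (by
      rw [P.rightUnitor_hom, P.rightUnitor_hom]
      exact P.map₂_fst α _)
  pentagon := P.pentagon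
  triangle := P.triangle

end Projections

/-! ### The cartesian product of bicategories -/

section Hext

variable {X E A B : Type u} [Bicategory.{u, u} X] [Bicategory.{u, u} E] [Bicategory.{u, u} A]
  [Bicategory.{u, u} B]

theorem comp_mapId_heq (F : Pseudofunctor X E) (P : StrictPseudofunctor E A) (x : X) :
    HEq ((F.comp P.toPseudofunctor).mapId x).hom (P.map₂ (F.mapId x).hom) :=
  IsEqToHom.heq_comp _ (.strict_mapId P _)

theorem comp_mapComp_heq (F : Pseudofunctor X E) (P : StrictPseudofunctor E A) {x y z : X}
    (f : x ⟶ y) (g : y ⟶ z) :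
    HEq ((F.comp P.toPseudofunctor).mapComp f g).hom (P.map₂ (F.mapComp f g).hom) :=
  IsEqToHom.heq_comp _ (.strict_mapComp P _ _)

theorem mapId_hom_of_eq {F G : Pseudofunctor X E} (h : F = G) (x : X) :
    HEq (F.mapId x).hom (G.mapId x).hom := by rw [h]

variable {P : StrictPseudofunctor E A} {Q : StrictPseudofunctor E B}
  (h : JointlyFullyFaithful P.toPseudofunctor Q.toPseudofunctor)
include h

theorem JointlyFullyFaithful.heq {x y x' y' : E} {p q : x ⟶ y} {p' q' : x' ⟶ y'} {s : p ⟶ q}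
    {s' : p' ⟶ q'} (hx : x = x') (hy : y = y') (hp : HEq p p') (hq : HEq q q')
    (hP : HEq (P.map₂ s) (P.map₂ s')) (hQ : HEq (Q.map₂ s) (Q.map₂ s')) : HEq s s' := by
  subst hx hy
  obtain rfl := eq_of_heq hp
  obtain rfl := eq_of_heq hq
  exact heq_of_eq (h.faithful (eq_of_heq hP) (eq_of_heq hQ))

/-- A functor into `E` is determined by its action on 1-cells and its composites with `P` and
`Q`. -/
theorem JointlyFullyFaithful.pseudofunctor_ext {F G : Pseudofunctor X E}
    (hm : ∀ {x y : X} (f : x ⟶ y), HEq (F.map f) (G.map f))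
    (hP : F.comp P.toPseudofunctor = G.comp P.toPseudofunctor)
    (hQ : F.comp Q.toPseudofunctor = G.comp Q.toPseudofunctor) : F = G := by
  have ho (x : X) : F.obj x = G.obj x := h.obj (obj_of_eq hP x) (obj_of_eq hQ x)
  refine pseudofunctor_hext ho hm (fun {x y f g} η => ?_) (fun x => ?_) (fun {x y z} f g => ?_)
  · exact h.heq (ho x) (ho y) (hm f) (hm g) (map₂_of_eq hP η) (map₂_of_eq hQ η)
  · refine h.heq (ho x) (ho x) (hm _) (hcongr_id (ho x)) ?_ ?_
    · exact (comp_mapId_heq F P x).symm.trans ((mapId_hom_of_eq hP x).trans (comp_mapId_heq G P x))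
    · exact (comp_mapId_heq F Q x).symm.trans ((mapId_hom_of_eq hQ x).trans (comp_mapId_heq G Q x))
  · refine h.heq (ho x) (ho z) (hm _) (hcongr_comp (ho x) (ho y) (ho z) (hm f) (hm g)) ?_ ?_
    · exact (comp_mapComp_heq F P f g).symm.trans
        ((mapComp_hom_of_eq hP f g).trans (comp_mapComp_heq G P f g))
    · exact (comp_mapComp_heq F Q f g).symm.trans
        ((mapComp_hom_of_eq hQ f g).trans (comp_mapComp_heq G Q f g))

end Hext

namespace Icon

/-- The functor into a product of bicategories with given components. -/
def pair {X A B : Icon.{u}} (P : X ⟶ A) (Q : X ⟶ B) : X ⟶ prod A B where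
  obj x := (P.obj x, Q.obj x)
  map f := Prod.mkHom (P.map f) (Q.map f)
  map₂ η := Prod.mkHom (P.map₂ η) (Q.map₂ η)
  map₂_id f := Prod.ext (P.map₂_id f) (Q.map₂_id f)
  map₂_comp η θ := Prod.ext (P.map₂_comp η θ) (Q.map₂_comp η θ)
  mapId x := Iso.prod (P.mapId x) (Q.mapId x)
  mapComp f g := Iso.prod (P.mapComp f g) (Q.mapComp f g)
  map₂_whisker_left f _ _ η := Prod.ext (P.map₂_whisker_left f η) (Q.map₂_whisker_left f η)
  map₂_whisker_right η f := Prod.ext (P.map₂_whisker_right η f) (Q.map₂_whisker_right η f)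
  map₂_associator f g h := Prod.ext (P.map₂_associator f g h) (Q.map₂_associator f g h)
  map₂_left_unitor f := Prod.ext (P.map₂_left_unitor f) (Q.map₂_left_unitor f)
  map₂_right_unitor f := Prod.ext (P.map₂_right_unitor f) (Q.map₂_right_unitor f)

theorem pair_fst {X A B : Icon.{u}} (P : X ⟶ A) (Q : X ⟶ B) : pair P Q ≫ fst A B = P :=
  pseudofunctor_hext (fun _ => rfl) (fun _ => HEq.rfl) (fun _ => HEq.rfl)
    (fun x => comp_mapId_heq (pair P Q) (Bicategory.Prod.fst A.carrier B.carrier) x)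
    (fun f g => comp_mapComp_heq (pair P Q) (Bicategory.Prod.fst A.carrier B.carrier) f g)

theorem pair_snd {X A B : Icon.{u}} (P : X ⟶ A) (Q : X ⟶ B) : pair P Q ≫ snd A B = Q :=
  pseudofunctor_hext (fun _ => rfl) (fun _ => HEq.rfl) (fun _ => HEq.rfl)
    (fun x => comp_mapId_heq (pair P Q) (Bicategory.Prod.snd A.carrier B.carrier) x)
    (fun f g => comp_mapComp_heq (pair P Q) (Bicategory.Prod.snd A.carrier B.carrier) f g)

theorem prod_hom_heq {K L : Type u} [Bicategory.{u, u} K] [Bicategory.{u, u} L] {x x' y y' : K × L}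
    (hx : x = x') (hy : y = y') {p : x ⟶ y} {p' : x' ⟶ y'} (h₁ : HEq p.1 p'.1)
    (h₂ : HEq p.2 p'.2) : HEq p p' := by
  subst hx hy
  exact heq_of_eq (Prod.ext (eq_of_heq h₁) (eq_of_heq h₂))

theorem hom_ext {X A B : Icon.{u}} {F G : X ⟶ prod A B} (h₁ : F ≫ fst A B = G ≫ fst A B)
    (h₂ : F ≫ snd A B = G ≫ snd A B) : F = G := by
  refine JointlyFullyFaithful.pseudofunctor_ext
    (P := Bicategory.Prod.fst A.carrier B.carrier) (Q := Bicategory.Prod.snd A.carrier B.carrier)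
    (jointlyFullyFaithful_prod A B) (fun {x y} f => ?_) h₁ h₂
  exact prod_hom_heq (Prod.ext (obj_of_eq h₁ x) (obj_of_eq h₂ x))
    (Prod.ext (obj_of_eq h₁ y) (obj_of_eq h₂ y)) (map_of_eq h₁ f) (map_of_eq h₂ f)

theorem pair_fst_assoc {X A B C : Icon.{u}} (P : X ⟶ A) (Q : X ⟶ B) (R : A ⟶ C) :
    pair P Q ≫ fst A B ≫ R = P ≫ R := by
  rw [← Strict.assoc, pair_fst]

theorem pair_snd_assoc {X A B C : Icon.{u}} (P : X ⟶ A) (Q : X ⟶ B) (R : B ⟶ C) :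
    pair P Q ≫ snd A B ≫ R = Q ≫ R := by
  rw [← Strict.assoc, pair_snd]

/-- The associativity isomorphism of the cartesian product. -/
def prodAssociator (A B C : Icon.{u}) : prod (prod A B) C ≅ prod A (prod B C) where
  hom := pair (fst _ _ ≫ fst _ _) (pair (fst _ _ ≫ snd _ _) (snd _ _))
  inv := pair (pair (fst _ _) (snd _ _ ≫ fst _ _)) (snd _ _ ≫ snd _ _)
  hom_inv_id := by
    refine hom_ext (hom_ext ?_ ?_) ?_ <;>
      simp only [Strict.assoc, pair_fst, pair_snd, pair_snd_assoc, Strict.id_comp]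
  inv_hom_id := by
    refine hom_ext ?_ (hom_ext ?_ ?_) <;>
      simp only [Strict.assoc, pair_fst, pair_snd, pair_fst_assoc, Strict.id_comp]

/-- The functor to the terminal bicategory. -/
def toUnit (A : Icon.{u}) : A ⟶ unit where
  obj _ := ⟨⟨PUnit.unit⟩⟩
  map _ := 𝟙 _
  map₂ _ := 𝟙 _
  mapId _ := Iso.refl _
  mapComp _ _ := Iso.refl _
  map₂_whisker_left _ _ _ _ := Subsingleton.elim _ _
  map₂_whisker_right _ _ := Subsingleton.elim _ _
  map₂_associator _ _ _ := Subsingleton.elim _ _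
  map₂_left_unitor _ := Subsingleton.elim _ _
  map₂_right_unitor _ := Subsingleton.elim _ _

theorem unit_obj_eq (x y : unit.{u}.carrier) : x = y := by
  obtain ⟨⟨⟨⟩⟩⟩ := x
  obtain ⟨⟨⟨⟩⟩⟩ := y
  rfl

theorem unit_map_eq {x y : unit.{u}.carrier} (f g : x ⟶ y) : f = g :=
  congrArg Discrete.mk (Subsingleton.elim f.as g.as)

theorem unit_hom_ext {A : Icon.{u}} (F G : A ⟶ unit) : F = G := by
  have h {x y x' y' : unit.{u}.carrier} (f : x ⟶ y) (f' : x' ⟶ y') : HEq f f' := by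
    obtain rfl := unit_obj_eq x x'
    obtain rfl := unit_obj_eq y y'
    exact heq_of_eq (unit_map_eq _ _)
  have h' {x y x' y' : unit.{u}.carrier} {f g : x ⟶ y} {f' g' : x' ⟶ y'} (η : f ⟶ g)
      (η' : f' ⟶ g') : HEq η η' := by
    obtain rfl := unit_obj_eq x x'
    obtain rfl := unit_obj_eq y y'
    obtain rfl := unit_map_eq f f'
    obtain rfl := unit_map_eq g g'
    exact heq_of_eq (Subsingleton.elim _ _)
  exact pseudofunctor_hext (fun _ => unit_obj_eq _ _) (fun _ => h _ _) (fun _ => h' _ _)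
    (fun _ => h' _ _) (fun _ _ => h' _ _)

/-- The cartesian product of bicategories with its projections. -/
def projections : Projections Icon.{u} prod unit where
  fst := fst
  snd := snd
  rel _ _ := True
  rel_comp _ _ := trivial
  hom_ext _ h₁ h₂ := hom_ext h₁ h₂
  pair₂ {_ _ _ F G} α β :=
    (jointlyFullyFaithful_prod _ _).icon_exists (F := lax F) (G := lax G) α β
  hom_ext₂ {_ _ _ F G _ _} h₁ h₂ :=
    (jointlyFullyFaithful_prod _ _).icon_unique (F := lax F) (G := lax G) h₁ h₂
  map f g := pair (fst _ _ ≫ f) (snd _ _ ≫ g)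
  map_fst _ _ := pair_fst _ _
  map_snd _ _ := pair_snd _ _
  associator := prodAssociator
  associator_fst _ _ _ := pair_fst _ _
  associator_snd_fst _ _ _ := by simp only [prodAssociator, pair_fst, pair_snd_assoc]
  associator_snd_snd _ _ _ := by simp only [prodAssociator, pair_snd, pair_snd_assoc]
  leftUnitor A :=
    { hom := snd _ _
      inv := pair (toUnit A) (𝟙 A)
      hom_inv_id := hom_ext (unit_hom_ext _ _) (by
        rw [Strict.assoc, pair_snd, Strict.comp_id, Strict.id_comp])
      inv_hom_id := pair_snd _ _ }
  leftUnitor_hom _ := rfl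
  rightUnitor A :=
    { hom := fst _ _
      inv := pair (𝟙 A) (toUnit A)
      hom_inv_id := hom_ext (by rw [Strict.assoc, pair_fst, Strict.comp_id, Strict.id_comp])
        (unit_hom_ext _ _)
      inv_hom_id := pair_fst _ _ }
  rightUnitor_hom _ := rfl
  rel_map_id _ _ := trivial
  rel_map_comp _ _ _ _ := trivial
  rel_associator_natural _ _ _ := trivial
  rel_pentagon _ _ _ _ := trivial
  rel_triangle _ _ := trivial

theorem isCartesian_projections : IsCartesian projections.{u}.toStronglyMonoidal where
  map_fst := projections.map_fst
  map_snd := projections.map_snd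
  map₂_fst α β := (Square.iff_eq (projections.map_fst _ _) (projections.map_fst _ _)).1
    (projections.map₂_fst α β)
  map₂_snd α β := (Square.iff_eq (projections.map_snd _ _) (projections.map_snd _ _)).1
    (projections.map₂_snd α β)
  associator_fst := projections.associator_fst
  associator_snd_fst := projections.associator_snd_fst
  associator_snd_snd := projections.associator_snd_snd
  leftUnitor _ := rfl
  rightUnitor _ := rfl

end Icon

/-! ### 2-functors into the Gray tensor product -/

namespace Gray

variable {X A B : Type u} [Bicategory.{u, u} X] [Bicategory.{u, u} A] [Bicategory.{u, u} B]
  [Strict X] [Strict A] [Strict B]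

/-- A lift of a pair of 2-functors `P : X ⟶ A` and `Q : X ⟶ B` on 0-cells and 1-cells to the Gray
tensor product of `A` and `B`. -/
structure PairData (P : StrictPseudofunctor X A) (Q : StrictPseudofunctor X B) where
  map {x y : X} (f : x ⟶ y) : (⟨P.obj x, Q.obj x⟩ : Gray A B) ⟶ ⟨P.obj y, Q.obj y⟩
  map_id (x : X) : map (𝟙 x) = 𝟙 _
  map_comp {x y z : X} (f : x ⟶ y) (g : y ⟶ z) : map (f ≫ g) = map f ≫ map g
  map_fst {x y : X} (f : x ⟶ y) : (proj₁ A B).map (map f) = P.map f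
  map_snd {x y : X} (f : x ⟶ y) : (proj₂ A B).map (map f) = Q.map f

namespace PairData

variable {P : StrictPseudofunctor X A} {Q : StrictPseudofunctor X B} (S : PairData P Q)

theorem exists_map₂ {x y : X} {f g : x ⟶ y} (η : f ⟶ g) : ∃ s : S.map f ⟶ S.map g,
    HEq ((proj₁ A B).map₂ s) (P.map₂ η) ∧ HEq ((proj₂ A B).map₂ s) (Q.map₂ η) := by
  obtain ⟨s, h₁, h₂⟩ := proj_full (p := S.map f) (q := S.map g)
    (eqToHom (S.map_fst f) ≫ P.map₂ η ≫ eqToHom (S.map_fst g).symm)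
    (eqToHom (S.map_snd f) ≫ Q.map₂ η ≫ eqToHom (S.map_snd g).symm)
  exact ⟨s, (heq_of_eq h₁).trans (conj_eqToHom_heq (S.map_fst f) (S.map_fst g).symm _),
    (heq_of_eq h₂).trans (conj_eqToHom_heq (S.map_snd f) (S.map_snd g).symm _)⟩

noncomputable def map₂ {x y : X} {f g : x ⟶ y} (η : f ⟶ g) : S.map f ⟶ S.map g :=
  (S.exists_map₂ η).choose

theorem map₂_fst {x y : X} {f g : x ⟶ y} (η : f ⟶ g) :
    HEq ((proj₁ A B).map₂ (S.map₂ η)) (P.map₂ η) :=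
  (S.exists_map₂ η).choose_spec.1

theorem map₂_snd {x y : X} {f g : x ⟶ y} (η : f ⟶ g) :
    HEq ((proj₂ A B).map₂ (S.map₂ η)) (Q.map₂ η) :=
  (S.exists_map₂ η).choose_spec.2

theorem eq_map₂ {x y : X} {f g : x ⟶ y} (η : f ⟶ g) {s : S.map f ⟶ S.map g}
    (h₁ : HEq ((proj₁ A B).map₂ s) (P.map₂ η)) (h₂ : HEq ((proj₂ A B).map₂ s) (Q.map₂ η)) :
    S.map₂ η = s :=
  proj_faithful (eq_of_heq ((S.map₂_fst η).trans h₁.symm))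
    (eq_of_heq ((S.map₂_snd η).trans h₂.symm))

section

variable {C : Type u} [Bicategory.{u, u} C] [Strict C] (R : StrictPseudofunctor (Gray A B) C)
  (F : StrictPseudofunctor X C)

theorem map₂_id_heq {x y : X} {f : x ⟶ y} {p : (⟨P.obj x, Q.obj x⟩ : Gray A B) ⟶ ⟨P.obj y, Q.obj y⟩}
    (h : ∀ x, R.obj ⟨P.obj x, Q.obj x⟩ = F.obj x) (hp : HEq (R.map p) (F.map f)) :
    HEq (R.map₂ (𝟙 p)) (F.map₂ (𝟙 f)) := by
  rw [R.map₂_id, F.map₂_id]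
  exact hcongr_id₂ (h x) (h y) hp

theorem map₂_comp_heq (h : ∀ x, R.obj ⟨P.obj x, Q.obj x⟩ = F.obj x)
    (hm : ∀ {x y : X} (f : x ⟶ y), HEq (R.map (S.map f)) (F.map f))
    (h₂ : ∀ {x y : X} {f g : x ⟶ y} (η : f ⟶ g), HEq (R.map₂ (S.map₂ η)) (F.map₂ η))
    {x y : X} {f f' f'' : x ⟶ y} (η : f ⟶ f') (θ : f' ⟶ f'') :
    HEq (R.map₂ (S.map₂ η ≫ S.map₂ θ)) (F.map₂ (η ≫ θ)) := by
  rw [R.map₂_comp, F.map₂_comp]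
  exact hcongr_comp₂ (h x) (h y) (hm f) (hm f') (hm f'') (h₂ η) (h₂ θ)

theorem map₂_whiskerLeft_heq (h : ∀ x, R.obj ⟨P.obj x, Q.obj x⟩ = F.obj x)
    (hm : ∀ {x y : X} (f : x ⟶ y), HEq (R.map (S.map f)) (F.map f))
    (h₂ : ∀ {x y : X} {f g : x ⟶ y} (η : f ⟶ g), HEq (R.map₂ (S.map₂ η)) (F.map₂ η))
    {x y z : X} (f : x ⟶ y) {g g' : y ⟶ z} (η : g ⟶ g') :
    HEq (R.map₂ (eqToHom (S.map_comp f g) ≫ S.map f ◁ S.map₂ η ≫ eqToHom (S.map_comp f g').symm))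
      (F.map₂ (f ◁ η)) :=
  (map₂_heq R.toPseudofunctor (S.map_comp f g) (S.map_comp f g')
    (conj_eqToHom_heq (S.map_comp f g) (S.map_comp f g').symm _)).trans
    ((GrayMon.map₂_whiskerLeft_heq R _ _).trans
    ((hcongr_whiskerLeft (h x) (h y) (h z) (hm f) (hm g) (hm g') (h₂ η)).trans
      (GrayMon.map₂_whiskerLeft_heq F _ _).symm))

theorem map₂_whiskerRight_heq (h : ∀ x, R.obj ⟨P.obj x, Q.obj x⟩ = F.obj x)
    (hm : ∀ {x y : X} (f : x ⟶ y), HEq (R.map (S.map f)) (F.map f))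
    (h₂ : ∀ {x y : X} {f g : x ⟶ y} (η : f ⟶ g), HEq (R.map₂ (S.map₂ η)) (F.map₂ η))
    {x y z : X} {f f' : x ⟶ y} (η : f ⟶ f') (g : y ⟶ z) :
    HEq (R.map₂ (eqToHom (S.map_comp f g) ≫ S.map₂ η ▷ S.map g ≫ eqToHom (S.map_comp f' g).symm))
      (F.map₂ (η ▷ g)) :=
  (map₂_heq R.toPseudofunctor (S.map_comp f g) (S.map_comp f' g)
    (conj_eqToHom_heq (S.map_comp f g) (S.map_comp f' g).symm _)).trans
    ((GrayMon.map₂_whiskerRight_heq R _ _).trans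
    ((hcongr_whiskerRight (h x) (h y) (h z) (hm f) (hm f') (hm g) (h₂ η)).trans
      (GrayMon.map₂_whiskerRight_heq F _ _).symm))

end

/-- The 2-functor to the Gray tensor product determined by a lift of `P` and `Q` on 1-cells; its
action on 2-cells exists and is unique since the Gray tensor product has the same 2-cells as the
cartesian product. -/
noncomputable def functor : StrictPseudofunctor X (Gray A B) := .mk''
  { obj := fun x => ⟨P.obj x, Q.obj x⟩
    map := S.map
    map₂ := S.map₂
    map_id := S.map_id
    map_comp := S.map_comp
    map₂_id := fun f => S.eq_map₂ _
      (map₂_id_heq (proj₁ A B) P (fun _ => rfl) (heq_of_eq (S.map_fst f)))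
      (map₂_id_heq (proj₂ A B) Q (fun _ => rfl) (heq_of_eq (S.map_snd f)))
    map₂_comp := fun η θ => S.eq_map₂ _
      (S.map₂_comp_heq (proj₁ A B) P (fun _ => rfl) (fun f => heq_of_eq (S.map_fst f))
        S.map₂_fst η θ)
      (S.map₂_comp_heq (proj₂ A B) Q (fun _ => rfl) (fun f => heq_of_eq (S.map_snd f))
        S.map₂_snd η θ)
    map₂_whisker_left := fun f _ _ η => S.eq_map₂ _
      (S.map₂_whiskerLeft_heq (proj₁ A B) P (fun _ => rfl) (fun f => heq_of_eq (S.map_fst f))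
        S.map₂_fst f η)
      (S.map₂_whiskerLeft_heq (proj₂ A B) Q (fun _ => rfl) (fun f => heq_of_eq (S.map_snd f))
        S.map₂_snd f η)
    map₂_whisker_right := fun η f => S.eq_map₂ _
      (S.map₂_whiskerRight_heq (proj₁ A B) P (fun _ => rfl) (fun f => heq_of_eq (S.map_fst f))
        S.map₂_fst η f)
      (S.map₂_whiskerRight_heq (proj₂ A B) Q (fun _ => rfl) (fun f => heq_of_eq (S.map_snd f))
        S.map₂_snd η f) }

end PairData

theorem strictPseudofunctor_hext {X A : Type u} [Bicategory.{u, u} X] [Bicategory.{u, u} A]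
    {F G : StrictPseudofunctor X A} (ho : ∀ x, F.obj x = G.obj x)
    (hm : ∀ {x y : X} (f : x ⟶ y), HEq (F.map f) (G.map f))
    (h₂ : ∀ {x y : X} {f g : x ⟶ y} (η : f ⟶ g), HEq (F.map₂ η) (G.map₂ η)) : F = G :=
  strictPseudofunctor_ext (pseudofunctor_hext ho hm h₂
    (fun x => hcongr_isEqToHom (ho x) (ho x) (hm _) (.strict_mapId F x) (.strict_mapId G x))
    (fun {x _ z} f g => hcongr_isEqToHom (ho x) (ho z) (hm _) (.strict_mapComp F f g)
      (.strict_mapComp G f g)))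

end Gray

namespace GrayIcon

/-- The projection of the Gray tensor product to the first factor. -/
def fst (A B : GrayIcon.{u}) : gray A B ⟶ A := Gray.proj₁ A.carrier B.carrier

/-- The projection of the Gray tensor product to the second factor. -/
def snd (A B : GrayIcon.{u}) : gray A B ⟶ B := Gray.proj₂ A.carrier B.carrier

theorem pair_fst {X A B : GrayIcon.{u}} {P : X ⟶ A} {Q : X ⟶ B} (S : Gray.PairData P Q) :
    (S.functor : X ⟶ gray A B) ≫ fst A B = P :=
  Gray.strictPseudofunctor_hext (fun _ => rfl) (fun f => heq_of_eq (S.map_fst f)) S.map₂_fst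

theorem pair_snd {X A B : GrayIcon.{u}} {P : X ⟶ A} {Q : X ⟶ B} (S : Gray.PairData P Q) :
    (S.functor : X ⟶ gray A B) ≫ snd A B = Q :=
  Gray.strictPseudofunctor_hext (fun _ => rfl) (fun f => heq_of_eq (S.map_snd f)) S.map₂_snd

/-- Two 2-functors agree on 0-cells and on 1-cells. -/
structure SameMap {A B : GrayIcon.{u}} (F G : A ⟶ B) : Prop where
  obj (x : A.carrier) : F.obj x = G.obj x
  map {x y : A.carrier} (f : x ⟶ y) : HEq (F.map f) (G.map f)

theorem SameMap.comp {A B C : GrayIcon.{u}} {F G : A ⟶ B} (h : SameMap F G) (H : B ⟶ C) :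
    SameMap (F ≫ H) (G ≫ H) where
  obj x := congrArg H.obj (h.obj x)
  map {x y} f := by
    have {a a' b b' : B.carrier} (ha : a = a') (hb : b = b') {p : a ⟶ b} {q : a' ⟶ b'}
        (hp : HEq p q) : HEq (H.map p) (H.map q) := by
      subst ha hb
      obtain rfl := eq_of_heq hp
      rfl
    exact this (h.obj x) (h.obj y) (h.map f)

/-- A 2-functor into `A ⊗ B` is determined by its 1-cell part and its two components. -/
theorem gray_hom_ext {X A B : GrayIcon.{u}} {F G : X ⟶ gray A B} (h : SameMap F G)
    (h₁ : F ≫ fst A B = G ≫ fst A B) (h₂ : F ≫ snd A B = G ≫ snd A B) : F = G :=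
  hom_ext (JointlyFullyFaithful.pseudofunctor_ext
    (P := Gray.proj₁ A.carrier B.carrier) (Q := Gray.proj₂ A.carrier B.carrier)
    (jointlyFullyFaithful_gray A B) h.map (congrArg homToIcon h₁) (congrArg homToIcon h₂))

end GrayIcon

/-! ### Functoriality of the Gray tensor product -/

namespace Gray

variable {A B C D : Type u} [Bicategory.{u, u} A] [Bicategory.{u, u} B] [Bicategory.{u, u} C]
  [Bicategory.{u, u} D] [Strict A] [Strict B] [Strict C] [Strict D]

/-- The functor `a ↦ a ⊗ b`. -/
def leftFunctor (b : B) : A ⥤ Gray A B where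
  obj a := ⟨a, b⟩
  map f := left f b
  map_id a := left_id a b
  map_comp f f' := left_comp f f' b

/-- The functor `b ↦ a ⊗ b`. -/
def rightFunctor (a : A) : B ⥤ Gray A B where
  obj b := ⟨a, b⟩
  map g := right a g
  map_id b := right_id a b
  map_comp g g' := right_comp a g g'

/-- The 2-functor `(A ⊗ B) ⊗ C ⟶ A ⊗ (B ⊗ C)` on the 1-cells of `A ⊗ B`. -/
def assocPathLeft (c : C) : PathData A B (Gray A (Gray B C)) where
  obj x := ⟨x.fst, ⟨x.snd, c⟩⟩
  left f b := left f (⟨b, c⟩ : Gray B C)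
  right a _ _ g := right a (left g c)
  left_id a b := left_id a (⟨b, c⟩ : Gray B C)
  left_comp f f' b := left_comp f f' (⟨b, c⟩ : Gray B C)
  right_id a b := (congrArg (right a) (left_id b c)).trans (right_id a _)
  right_comp a _ _ _ g g' := (congrArg (right a) (left_comp g g' c)).trans (right_comp a _ _)

variable (A B C) in
/-- The associativity isomorphism on 1-cells. On `p ⊗ 1`, with `p` a 1-cell of `A ⊗ B`, it is given
by `assocPathLeft`. -/
def assocPath : PathData (Gray A B) C (Gray A (Gray B C)) where
  obj x := ⟨x.fst.fst, ⟨x.fst.snd, x.snd⟩⟩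
  left p c := (assocPathLeft c).map p
  right x _ _ h := right x.fst (right x.snd h)
  left_id x c := (assocPathLeft c).map_id x
  left_comp p q c := (assocPathLeft c).map_comp p q
  right_id x c := (congrArg (right x.fst) (right_id x.snd c)).trans (right_id _ _)
  right_comp x _ _ _ h h' :=
    (congrArg (right x.fst) (right_comp x.snd h h')).trans (right_comp _ _ _)

/-- The inverse of the associativity isomorphism on the 1-cells of `B ⊗ C`. -/
def assocInvPathRight (a : A) : PathData B C (Gray (Gray A B) C) where
  obj x := ⟨⟨a, x.fst⟩, x.snd⟩
  left g c := left (right a g) c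
  right b _ _ h := right (⟨a, b⟩ : Gray A B) h
  left_id b c := (congrArg (left · c) (right_id a b)).trans (left_id _ c)
  left_comp g g' c := (congrArg (left · c) (right_comp a g g')).trans (left_comp _ _ c)
  right_id b c := right_id (⟨a, b⟩ : Gray A B) c
  right_comp b _ _ _ h h' := right_comp (⟨a, b⟩ : Gray A B) h h'

variable (A B C) in
/-- The inverse of the associativity isomorphism on 1-cells. -/
def assocInvPath : PathData A (Gray B C) (Gray (Gray A B) C) where
  obj x := ⟨⟨x.fst, x.snd.fst⟩, x.snd.snd⟩
  left f x := left (left f x.fst) x.snd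
  right a _ _ p := (assocInvPathRight a).map p
  left_id a x := (congrArg (left · x.snd) (left_id a x.fst)).trans (left_id _ _)
  left_comp f f' x := (congrArg (left · x.snd) (left_comp f f' x.fst)).trans (left_comp _ _ _)
  right_id a x := (assocInvPathRight a).map_id x
  right_comp a _ _ _ p q := (assocInvPathRight a).map_comp p q

end Gray

namespace GrayIcon

/-- The tensor product of 2-functors on 1-cells. -/
def mapPath {A A' B B' : GrayIcon.{u}} (F : A ⟶ A') (G : B ⟶ B') :
    Gray.PathData A.carrier B.carrier (gray A' B').carrier where
  obj x := ⟨F.obj x.fst, G.obj x.snd⟩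
  left f b := Gray.left (F.map f) (G.obj b)
  right a _ _ g := Gray.right (F.obj a) (G.map g)
  left_id a b := (congrArg (Gray.left · _) (F.map_id a)).trans (Gray.left_id _ _)
  left_comp f f' b := (congrArg (Gray.left · _) (F.map_comp f f')).trans (Gray.left_comp _ _ _)
  right_id a b := (congrArg (Gray.right _) (G.map_id b)).trans (Gray.right_id _ _)
  right_comp a _ _ _ g g' :=
    (congrArg (Gray.right _) (G.map_comp g g')).trans (Gray.right_comp _ _ _)

/-- The form of `Gray.functor_map_heq` for 2-functors. -/
theorem hom_map_heq {A B D : GrayIcon.{u}} {F G : gray A B ⟶ D} (ho : ∀ x, F.obj x = G.obj x)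
    (hl : ∀ {a a' : A.carrier} (f : a ⟶ a') (b : B.carrier),
      HEq (F.map (Gray.left f b)) (G.map (Gray.left f b)))
    (hr : ∀ (a : A.carrier) {b b' : B.carrier} (g : b ⟶ b'),
      HEq (F.map (Gray.right a g)) (G.map (Gray.right a g)))
    {x y : (gray A B).carrier} (p : x ⟶ y) : HEq (F.map p) (G.map p) :=
  Gray.functor_map_heq (StrictPseudofunctor.toFunctor F) (StrictPseudofunctor.toFunctor G)
    ho hl hr p

theorem sameMap {A B D : GrayIcon.{u}} {F G : gray A B ⟶ D} (ho : ∀ x, F.obj x = G.obj x)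
    (hl : ∀ {a a' : A.carrier} (f : a ⟶ a') (b : B.carrier),
      HEq (F.map (Gray.left f b)) (G.map (Gray.left f b)))
    (hr : ∀ (a : A.carrier) {b b' : B.carrier} (g : b ⟶ b'),
      HEq (F.map (Gray.right a g)) (G.map (Gray.right a g))) : SameMap F G :=
  ⟨ho, hom_map_heq ho hl hr⟩

/-- The tensor product of 2-functors on 1-cells, as a lift of `F` and `G`. -/
def mapData {A A' B B' : GrayIcon.{u}} (F : A ⟶ A') (G : B ⟶ B') :
    Gray.PairData (X := Gray A.carrier B.carrier) (A := A'.carrier) (B := B'.carrier)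
      (fst A B ≫ F) (snd A B ≫ G) where
  map p := (mapPath F G).map p
  map_id _ := rfl
  map_comp p q := (mapPath F G).map_comp p q
  map_fst p := eq_of_heq (Gray.functor_map_heq
    ((mapPath F G).toFunctor ⋙ StrictPseudofunctor.toFunctor (fst A' B'))
    (StrictPseudofunctor.toFunctor (fst A B ≫ F)) (fun _ => rfl) (fun _ _ => HEq.rfl)
    (fun a _ _ g => heq_of_eq (F.map_id a).symm) p)
  map_snd p := eq_of_heq (Gray.functor_map_heq
    ((mapPath F G).toFunctor ⋙ StrictPseudofunctor.toFunctor (snd A' B'))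
    (StrictPseudofunctor.toFunctor (snd A B ≫ G)) (fun _ => rfl)
    (fun _ b => heq_of_eq (G.map_id b).symm) (fun _ _ _ _ => HEq.rfl) p)

/-- The tensor product of 2-functors. -/
noncomputable def map {A A' B B' : GrayIcon.{u}} (F : A ⟶ A') (G : B ⟶ B') :
    gray A B ⟶ gray A' B' :=
  (mapData F G).functor

theorem map_fst {A A' B B' : GrayIcon.{u}} (F : A ⟶ A') (G : B ⟶ B') :
    map F G ≫ fst A' B' = fst A B ≫ F := pair_fst _

theorem map_snd {A A' B B' : GrayIcon.{u}} (F : A ⟶ A') (G : B ⟶ B') :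
    map F G ≫ snd A' B' = snd A B ≫ G := pair_snd _

end GrayIcon

/-! ### The monoidal structure of the Gray tensor product -/

namespace GrayIcon

section Associator

variable (A B C : GrayIcon.{u})

/-- The associativity isomorphism, as a lift of its two components. -/
noncomputable def assocData : Gray.PairData (X := Gray (Gray A.carrier B.carrier) C.carrier)
    (A := A.carrier) (B := Gray B.carrier C.carrier)
    (fst (gray A B) C ≫ fst A B) (map (snd A B) (𝟙 C)) where
  map p := (Gray.assocPath A.carrier B.carrier C.carrier).map p
  map_id _ := rfl
  map_comp p q := (Gray.assocPath A.carrier B.carrier C.carrier).map_comp p q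
  map_fst p := eq_of_heq (Gray.functor_map_heq
    ((Gray.assocPath A.carrier B.carrier C.carrier).toFunctor ⋙
      StrictPseudofunctor.toFunctor (fst A (gray B C)))
    (StrictPseudofunctor.toFunctor (fst (gray A B) C ≫ fst A B)) (fun _ => rfl)
    (fun p c => Gray.functor_map_heq ((Gray.assocPathLeft c).toFunctor ⋙
      StrictPseudofunctor.toFunctor (fst A (gray B C)))
      (StrictPseudofunctor.toFunctor (fst A B)) (fun _ => rfl) (fun _ _ => HEq.rfl)
      (fun _ _ _ _ => HEq.rfl) p)
    (fun _ _ _ _ => HEq.rfl) p)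
  map_snd p := eq_of_heq (Gray.functor_map_heq
    ((Gray.assocPath A.carrier B.carrier C.carrier).toFunctor ⋙
      StrictPseudofunctor.toFunctor (snd A (gray B C)))
    (StrictPseudofunctor.toFunctor (map (snd A B) (𝟙 C))) (fun _ => rfl)
    (fun p c => Gray.functor_map_heq ((Gray.assocPathLeft c).toFunctor ⋙
      StrictPseudofunctor.toFunctor (snd A (gray B C)))
      (StrictPseudofunctor.toFunctor (snd A B) ⋙ Gray.leftFunctor c) (fun _ => rfl)
      (fun _ b => heq_of_eq (Eq.trans (b := 𝟙 (⟨b, c⟩ : Gray B.carrier C.carrier)) rfl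
        ((Gray.left_id b c).symm.trans rfl)))
      (fun _ _ _ _ => HEq.rfl) p)
    (fun _ _ _ _ => HEq.rfl) p)

/-- The inverse of the associativity isomorphism, as a lift of its two components. -/
noncomputable def assocInvData : Gray.PairData (X := Gray A.carrier (Gray B.carrier C.carrier))
    (A := Gray A.carrier B.carrier) (B := C.carrier)
    (map (𝟙 A) (fst B C)) (snd A (gray B C) ≫ snd B C) where
  map p := (Gray.assocInvPath A.carrier B.carrier C.carrier).map p
  map_id _ := rfl
  map_comp p q := (Gray.assocInvPath A.carrier B.carrier C.carrier).map_comp p q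
  map_fst p := eq_of_heq (Gray.functor_map_heq
    ((Gray.assocInvPath A.carrier B.carrier C.carrier).toFunctor ⋙
      StrictPseudofunctor.toFunctor (fst (gray A B) C))
    (StrictPseudofunctor.toFunctor (map (𝟙 A) (fst B C))) (fun _ => rfl)
    (fun _ _ => HEq.rfl)
    (fun a _ _ p => Gray.functor_map_heq ((Gray.assocInvPathRight a).toFunctor ⋙
      StrictPseudofunctor.toFunctor (fst (gray A B) C))
      (StrictPseudofunctor.toFunctor (fst B C) ⋙ Gray.rightFunctor a) (fun _ => rfl)
      (fun _ _ => HEq.rfl)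
      (fun b _ _ _ => heq_of_eq (Eq.trans (b := 𝟙 (⟨a, b⟩ : Gray A.carrier B.carrier)) rfl
        ((Gray.right_id a b).symm.trans rfl))) p) p)
  map_snd p := eq_of_heq (Gray.functor_map_heq
    ((Gray.assocInvPath A.carrier B.carrier C.carrier).toFunctor ⋙
      StrictPseudofunctor.toFunctor (snd (gray A B) C))
    (StrictPseudofunctor.toFunctor (snd A (gray B C) ≫ snd B C)) (fun _ => rfl)
    (fun _ _ => HEq.rfl)
    (fun a _ _ p => Gray.functor_map_heq ((Gray.assocInvPathRight a).toFunctor ⋙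
      StrictPseudofunctor.toFunctor (snd (gray A B) C))
      (StrictPseudofunctor.toFunctor (snd B C)) (fun _ => rfl) (fun _ _ => HEq.rfl)
      (fun _ _ _ _ => HEq.rfl) p) p)

/-- The associativity 2-functor. -/
noncomputable def assocHom : gray (gray A B) C ⟶ gray A (gray B C) := (assocData A B C).functor

/-- The inverse of the associativity 2-functor. -/
noncomputable def assocInv : gray A (gray B C) ⟶ gray (gray A B) C := (assocInvData A B C).functor

theorem assocHom_fst : assocHom A B C ≫ fst A (gray B C) = fst (gray A B) C ≫ fst A B := pair_fst _

theorem assocHom_snd : assocHom A B C ≫ snd A (gray B C) = map (snd A B) (𝟙 C) := pair_snd _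

theorem assocInv_fst : assocInv A B C ≫ fst (gray A B) C = map (𝟙 A) (fst B C) := pair_fst _

theorem assocInv_snd : assocInv A B C ≫ snd (gray A B) C = snd A (gray B C) ≫ snd B C := pair_snd _

end Associator

theorem sameMap_left {A B C D : GrayIcon.{u}} {F G : gray (gray A B) C ⟶ D}
    (ho : ∀ x, F.obj x = G.obj x)
    (hll : ∀ {a a' : A.carrier} (f : a ⟶ a') (b : B.carrier) (c : C.carrier),
      HEq (F.map (Gray.left (Gray.left f b) c)) (G.map (Gray.left (Gray.left f b) c)))
    (hlr : ∀ (a : A.carrier) {b b' : B.carrier} (g : b ⟶ b') (c : C.carrier),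
      HEq (F.map (Gray.left (Gray.right a g) c)) (G.map (Gray.left (Gray.right a g) c)))
    (hr : ∀ (x : Gray A.carrier B.carrier) {c c' : C.carrier} (h : c ⟶ c'),
      HEq (F.map (Gray.right x h)) (G.map (Gray.right x h))) : SameMap F G :=
  ⟨ho, hom_map_heq ho (fun p c => Gray.functor_map_heq
    (Gray.leftFunctor c ⋙ StrictPseudofunctor.toFunctor F)
    (Gray.leftFunctor c ⋙ StrictPseudofunctor.toFunctor G) (fun x => ho ⟨x, c⟩)
    (fun f b => hll f b c) (fun a _ _ g => hlr a g c) p) hr⟩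

theorem sameMap_right {A B C D : GrayIcon.{u}} {F G : gray A (gray B C) ⟶ D}
    (ho : ∀ x, F.obj x = G.obj x)
    (hl : ∀ {a a' : A.carrier} (f : a ⟶ a') (x : Gray B.carrier C.carrier),
      HEq (F.map (Gray.left f x)) (G.map (Gray.left f x)))
    (hrl : ∀ (a : A.carrier) {b b' : B.carrier} (g : b ⟶ b') (c : C.carrier),
      HEq (F.map (Gray.right a (Gray.left g c))) (G.map (Gray.right a (Gray.left g c))))
    (hrr : ∀ (a : A.carrier) (b : B.carrier) {c c' : C.carrier} (h : c ⟶ c'),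
      HEq (F.map (Gray.right a (Gray.right b h))) (G.map (Gray.right a (Gray.right b h)))) :
    SameMap F G :=
  ⟨ho, hom_map_heq ho hl (fun a _ _ p => Gray.functor_map_heq
    (Gray.rightFunctor a ⋙ StrictPseudofunctor.toFunctor F)
    (Gray.rightFunctor a ⋙ StrictPseudofunctor.toFunctor G) (fun x => ho ⟨a, x⟩)
    (fun g c => hrl a g c) (fun b _ _ h => hrr a b h) p)⟩

/-- The associativity isomorphism of the Gray tensor product. -/
noncomputable def associator (A B C : GrayIcon.{u}) : gray (gray A B) C ≅ gray A (gray B C) where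
  hom := assocHom A B C
  inv := assocInv A B C
  hom_inv_id := by
    have h : SameMap (assocHom A B C ≫ assocInv A B C) (𝟙 _) :=
      sameMap_left (fun _ => rfl) (fun _ _ _ => HEq.rfl) (fun _ _ _ _ _ => HEq.rfl)
        (fun _ _ _ _ => HEq.rfl)
    refine gray_hom_ext h (gray_hom_ext (h.comp _) ?_ ?_) ?_
    · rw [Strict.assoc, Strict.assoc, Strict.assoc, ← Strict.assoc (assocInv _ _ _), assocInv_fst,
        map_fst, Strict.comp_id, assocHom_fst, Strict.id_comp]
    · rw [Strict.assoc, Strict.assoc, Strict.assoc, ← Strict.assoc (assocInv _ _ _), assocInv_fst,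
        map_snd, ← Strict.assoc, assocHom_snd, map_fst, Strict.id_comp]
    · rw [Strict.assoc, assocInv_snd, ← Strict.assoc, assocHom_snd, map_snd, Strict.comp_id,
        Strict.id_comp]
  inv_hom_id := by
    have h : SameMap (assocInv A B C ≫ assocHom A B C) (𝟙 _) :=
      sameMap_right (fun _ => rfl) (fun _ _ => HEq.rfl) (fun _ _ _ _ _ => HEq.rfl)
        (fun _ _ _ _ _ => HEq.rfl)
    refine gray_hom_ext h ?_ (gray_hom_ext (h.comp _) ?_ ?_)
    · rw [Strict.assoc, assocHom_fst, ← Strict.assoc, assocInv_fst, map_fst, Strict.comp_id,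
        Strict.id_comp]
    · rw [Strict.assoc, Strict.assoc, Strict.assoc, ← Strict.assoc (assocHom _ _ _), assocHom_snd,
        map_fst, ← Strict.assoc, assocInv_fst, map_snd, Strict.id_comp]
    · rw [Strict.assoc, Strict.assoc, Strict.assoc, ← Strict.assoc (assocHom _ _ _), assocHom_snd,
        map_snd, Strict.comp_id, assocInv_snd, Strict.id_comp]

/-- The 2-functor to the terminal 2-category. -/
def toUnit (A : GrayIcon.{u}) : A ⟶ unit := StrictPseudofunctor.mk''
  { obj := fun _ => ⟨⟨PUnit.unit⟩⟩
    map := fun _ => 𝟙 _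
    map₂ := fun _ => 𝟙 _
    map_id := fun _ => rfl
    map_comp := fun _ _ => rfl
    map₂_whisker_left := fun _ _ _ _ => Subsingleton.elim _ _
    map₂_whisker_right := fun _ _ => Subsingleton.elim _ _ }

theorem unit_hom_ext {A : GrayIcon.{u}} (F G : A ⟶ unit) : F = G :=
  hom_ext (Icon.unit_hom_ext _ _)

/-- The inverse of the left unit isomorphism, as a lift of its components. -/
def leftUnitorData (A : GrayIcon.{u}) : Gray.PairData (X := A.carrier) (A := unit.carrier)
    (B := A.carrier) (toUnit A) (𝟙 A : A ⟶ A) where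
  map f := Gray.right _ f
  map_id a := Gray.right_id _ a
  map_comp f g := Gray.right_comp _ f g
  map_fst _ := Icon.unit_map_eq _ _
  map_snd _ := rfl

/-- The inverse of the right unit isomorphism, as a lift of its components. -/
def rightUnitorData (A : GrayIcon.{u}) : Gray.PairData (X := A.carrier) (A := A.carrier)
    (B := unit.carrier) (𝟙 A : A ⟶ A) (toUnit A) where
  map f := Gray.left f _
  map_id a := Gray.left_id a _
  map_comp f g := Gray.left_comp f g _
  map_fst _ := rfl
  map_snd _ := Icon.unit_map_eq _ _

/-- The left unit isomorphism of the Gray tensor product. -/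
noncomputable def leftUnitor (A : GrayIcon.{u}) : gray unit A ≅ A where
  hom := snd unit A
  inv := ((leftUnitorData A).functor : A ⟶ gray unit A)
  hom_inv_id := by
    refine gray_hom_ext (sameMap (fun _ => rfl) (fun {a a'} f b => ?_) (fun _ _ _ _ => HEq.rfl))
      (unit_hom_ext _ _) ?_
    · obtain rfl := Icon.unit_obj_eq a a'
      obtain rfl := Icon.unit_map_eq f (𝟙 _)
      exact heq_of_eq ((Gray.right_id _ _).trans (Gray.left_id _ _).symm)
    · rw [Strict.assoc, pair_snd, Strict.comp_id, Strict.id_comp]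
  inv_hom_id := pair_snd _

/-- The right unit isomorphism of the Gray tensor product. -/
noncomputable def rightUnitor (A : GrayIcon.{u}) : gray A unit ≅ A where
  hom := fst A unit
  inv := ((rightUnitorData A).functor : A ⟶ gray A unit)
  hom_inv_id := by
    refine gray_hom_ext (sameMap (fun _ => rfl) (fun _ _ => HEq.rfl) (fun a b b' g => ?_))
      ?_ (unit_hom_ext _ _)
    · obtain rfl := Icon.unit_obj_eq b b'
      obtain rfl := Icon.unit_map_eq g (𝟙 _)
      exact heq_of_eq ((Gray.left_id _ _).trans (Gray.right_id _ _).symm)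
    · rw [Strict.assoc, pair_fst, Strict.comp_id, Strict.id_comp]
  inv_hom_id := pair_fst _

/-- The Gray tensor product with its projections. -/
noncomputable def projections : Projections GrayIcon.{u} gray unit where
  fst := fst
  snd := snd
  rel := SameMap
  rel_comp h H := h.comp H
  hom_ext h h₁ h₂ := gray_hom_ext h h₁ h₂
  pair₂ {_ _ _ F G} α β := (jointlyFullyFaithful_gray _ _).icon_exists
    (F := lax (homToIcon F)) (G := lax (homToIcon G)) α β
  hom_ext₂ {_ _ _ F G _ _} h₁ h₂ := (jointlyFullyFaithful_gray _ _).icon_unique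
    (F := lax (homToIcon F)) (G := lax (homToIcon G)) h₁ h₂
  map := map
  map_fst := map_fst
  map_snd := map_snd
  associator := associator
  associator_fst := assocHom_fst
  associator_snd_fst A B C := by
    have h := assocHom_snd A B C
    rw [← Strict.assoc, associator, h, map_fst]
  associator_snd_snd A B C := by
    have h := assocHom_snd A B C
    rw [← Strict.assoc, associator, h, map_snd, Strict.comp_id]
  leftUnitor := leftUnitor
  leftUnitor_hom _ := rfl
  rightUnitor := rightUnitor
  rightUnitor_hom _ := rfl
  rel_map_id _ _ := sameMap (fun _ => rfl) (fun _ _ => HEq.rfl) (fun _ _ _ _ => HEq.rfl)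
  rel_map_comp _ _ _ _ := sameMap (fun _ => rfl) (fun _ _ => HEq.rfl) (fun _ _ _ _ => HEq.rfl)
  rel_associator_natural _ _ _ := sameMap_left (fun _ => rfl) (fun _ _ _ => HEq.rfl)
    (fun _ _ _ _ _ => HEq.rfl) (fun _ _ _ _ => HEq.rfl)
  rel_pentagon A B C D := sameMap_left (fun _ => rfl)
    (fun p c d => Gray.functor_map_heq
      (Gray.leftFunctor c ⋙ Gray.leftFunctor d ⋙ StrictPseudofunctor.toFunctor
        (map (associator A B C).hom (𝟙 D) ≫ (associator A (gray B C) D).hom ≫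
        map (𝟙 A) (associator B C D).hom))
      (Gray.leftFunctor c ⋙ Gray.leftFunctor d ⋙ StrictPseudofunctor.toFunctor
        ((associator (gray A B) C D).hom ≫ (associator A B (gray C D)).hom)) (fun _ => rfl)
      (fun _ _ => HEq.rfl) (fun _ _ _ _ => HEq.rfl) p)
    (fun _ _ _ _ _ => HEq.rfl) (fun _ _ _ _ => HEq.rfl)
  rel_triangle _ b := sameMap_left (fun _ => rfl) (fun _ _ _ => HEq.rfl)
    (fun a u u' g c => by
      obtain rfl := Icon.unit_obj_eq u u'
      obtain rfl := Icon.unit_map_eq g (𝟙 _)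
      exact heq_of_eq ((Gray.right_id _ _).trans (Gray.left_id _ _).symm))
    (fun _ _ _ _ => HEq.rfl)

end GrayIcon

/-! ### The universal cubical functors as a lax monoidal structure -/

namespace GrayIcon

theorem homToIcon_comp {A B C : GrayIcon.{u}} (F : A ⟶ B) (G : B ⟶ C) :
    homToIcon (F ≫ G) = homToIcon F ≫ homToIcon G := rfl

theorem cubical_fst (A B : GrayIcon.{u}) :
    cubical A B ≫ homToIcon (projections.fst A B) = Icon.projections.fst A.toIcon B.toIcon :=
  Gray.univCubical_proj₁

theorem cubical_snd (A B : GrayIcon.{u}) :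
    cubical A B ≫ homToIcon (projections.snd A B) = Icon.projections.snd A.toIcon B.toIcon :=
  Gray.univCubical_proj₂

theorem cubical_fst_assoc (A B : GrayIcon.{u}) {C : Icon.{u}} (F : A.toIcon ⟶ C) :
    cubical A B ≫ homToIcon (projections.fst A B) ≫ F =
      Icon.projections.fst A.toIcon B.toIcon ≫ F := by
  rw [← cubical_fst, Strict.assoc]

theorem cubical_snd_assoc (A B : GrayIcon.{u}) {C : Icon.{u}} (F : B.toIcon ⟶ C) :
    cubical A B ≫ homToIcon (projections.snd A B) ≫ F =
      Icon.projections.snd A.toIcon B.toIcon ≫ F := by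
  rw [← cubical_snd, Strict.assoc]

theorem toIcon_hom_ext {X : Icon.{u}} {A B : GrayIcon.{u}} {F G : X ⟶ (gray A B).toIcon}
    (h : ∀ {x y : X.carrier} (f : x ⟶ y), HEq (F.map f) (G.map f))
    (h₁ : F ≫ homToIcon (projections.fst A B) = G ≫ homToIcon (projections.fst A B))
    (h₂ : F ≫ homToIcon (projections.snd A B) = G ≫ homToIcon (projections.snd A B)) : F = G :=
  JointlyFullyFaithful.pseudofunctor_ext
    (P := Gray.proj₁ A.carrier B.carrier) (Q := Gray.proj₂ A.carrier B.carrier)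
    (jointlyFullyFaithful_gray A B) h h₁ h₂

theorem toIcon_hom_ext₂ {X : Icon.{u}} {A B : GrayIcon.{u}} {F G : X ⟶ (gray A B).toIcon}
    {γ δ : F ⟶ G}
    (h₁ : γ ▷ homToIcon (projections.fst A B) = δ ▷ homToIcon (projections.fst A B))
    (h₂ : γ ▷ homToIcon (projections.snd A B) = δ ▷ homToIcon (projections.snd A B)) : γ = δ :=
  (jointlyFullyFaithful_gray A B).icon_unique (F := lax F) (G := lax G) h₁ h₂

/-- The 2-cells and whiskerings of `GrayIcon` are those of `Icon`. -/
theorem square_toIcon {A B C D : GrayIcon.{u}} {F F' : A ⟶ B} {γ : F ⟶ F'} {q : B ⟶ D} {p : A ⟶ C}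
    {G G' : C ⟶ D} {α : G ⟶ G'} (s : Square γ q p α) :
    Square (incl.map₂ γ) (homToIcon q) (homToIcon p) (incl.map₂ α) where
  source := congrArg homToIcon s.source
  target := congrArg homToIcon s.target
  heq := s.heq

theorem cubical_natural {A A' B B' : GrayIcon.{u}} (F : A ⟶ A') (G : B ⟶ B') :
    Icon.projections.map (homToIcon F) (homToIcon G) ≫ cubical A' B' =
      cubical A B ≫ homToIcon (projections.map F G) := by
  refine toIcon_hom_ext (fun _ => HEq.rfl) ?_ ?_
  · rw [Strict.assoc, Strict.assoc, cubical_fst, Projections.map_fst, ← homToIcon_comp,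
      Projections.map_fst, homToIcon_comp, cubical_fst_assoc]
  · rw [Strict.assoc, Strict.assoc, cubical_snd, Projections.map_snd, ← homToIcon_comp,
      Projections.map_snd, homToIcon_comp, cubical_snd_assoc]

theorem cubical_natural₂ {A A' B B' : GrayIcon.{u}} {F F' : A ⟶ A'} {G G' : B ⟶ B'} (α : F ⟶ F')
    (β : G ⟶ G') :
    Icon.projections.map₂ (incl.map₂ α) (incl.map₂ β) ▷ cubical A' B' =
      eqToHom (cubical_natural F G) ≫ cubical A B ◁ incl.map₂ (projections.map₂ α β) ≫
        eqToHom (cubical_natural F' G').symm := by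
  refine toIcon_hom_ext₂ (Square.unique
    ((Icon.projections.map₂_fst (incl.map₂ α) (incl.map₂ β)).of_comp_right (cubical_fst A' B'))
    (((square_toIcon (projections.map₂_fst α β)).of_comp_left (cubical_fst A B)).conj _ _))
    (Square.unique
    ((Icon.projections.map₂_snd (incl.map₂ α) (incl.map₂ β)).of_comp_right (cubical_snd A' B'))
    (((square_toIcon (projections.map₂_snd α β)).of_comp_left (cubical_snd A B)).conj _ _))

/-- On the 1-cell `((f, g), h)` both sides are the composite of `f ⊗ 1`, `1 ⊗ (g ⊗ 1)` and
`1 ⊗ (1 ⊗ h)`, bracketed in the two possible ways. -/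
theorem cubical_associator_map (A B C : GrayIcon.{u})
    {x y : (Icon.prod (Icon.prod A.toIcon B.toIcon) C.toIcon).carrier} (f : x ⟶ y) :
    (Icon.projections.map (cubical A B) (𝟙 C.toIcon) ≫ cubical (gray A B) C ≫
        homToIcon (projections.associator A B C).hom).map f =
      ((Icon.projections.associator A.toIcon B.toIcon C.toIcon).hom ≫
        Icon.projections.map (𝟙 A.toIcon) (cubical B C) ≫ cubical A (gray B C)).map f := by
  refine Eq.trans (b := (Gray.left f.1.1 (⟨x.1.2, x.2⟩ : Gray B.carrier C.carrier) ≫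
    Gray.right y.1.1 (Gray.left f.1.2 x.2)) ≫ Gray.right y.1.1 (Gray.right y.1.2 f.2)) rfl ?_
  exact (Strict.assoc _ _ _).trans (congrArg (_ ≫ ·) (Gray.right_comp y.1.1
    (Gray.left f.1.2 x.2) (Gray.right y.1.2 f.2)).symm)

theorem cubical_associator (A B C : GrayIcon.{u}) :
    Icon.projections.map (cubical A B) (𝟙 C.toIcon) ≫ cubical (gray A B) C ≫
        homToIcon (projections.associator A B C).hom =
      (Icon.projections.associator A.toIcon B.toIcon C.toIcon).hom ≫
        Icon.projections.map (𝟙 A.toIcon) (cubical B C) ≫ cubical A (gray B C) := by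
  refine toIcon_hom_ext (fun f => heq_of_eq (cubical_associator_map A B C f)) ?_
    (toIcon_hom_ext (fun f => heq_of_eq (congrArg (homToIcon (projections.snd A (gray B C))).map
      (cubical_associator_map A B C f))) ?_ ?_)
  · have h : homToIcon (projections.associator A B C).hom ≫ homToIcon (projections.fst _ _) =
        homToIcon (projections.fst _ _) ≫ homToIcon (projections.fst _ _) :=
      congrArg homToIcon (projections.associator_fst A B C)
    simp only [Strict.assoc, h, cubical_fst, cubical_fst_assoc, Projections.map_fst,
      Projections.map_fst_assoc, Strict.comp_id, Projections.associator_fst]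
  · have h : homToIcon (projections.associator A B C).hom ≫ homToIcon (projections.snd _ _) ≫
        homToIcon (projections.fst _ _) =
          homToIcon (projections.fst _ _) ≫ homToIcon (projections.snd _ _) :=
      congrArg homToIcon (projections.associator_snd_fst A B C)
    simp only [Strict.assoc, h, cubical_fst, cubical_snd, cubical_fst_assoc,
      Projections.map_fst_assoc, Projections.map_snd_assoc, Projections.associator_snd_fst]
  · have h : homToIcon (projections.associator A B C).hom ≫ homToIcon (projections.snd _ _) ≫
        homToIcon (projections.snd _ _) = homToIcon (projections.snd _ _) :=
      congrArg homToIcon (projections.associator_snd_snd A B C)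
    simp only [Strict.assoc, h, cubical_snd, Projections.map_snd,
      Strict.comp_id, Projections.associator_snd_snd]

/-- The **Cat**-lax monoidal structure on the inclusion given by the universal cubical functors. -/
noncomputable def laxMonoidal : CatLaxMonoidal projections.{u}.toStronglyMonoidal
    Icon.projections.{u}.toStronglyMonoidal incl where
  χ := cubical
  χ_natural := cubical_natural
  χ_natural₂ := cubical_natural₂
  ι := 𝟙 Icon.unit
  associativity := cubical_associator
  left_unit A := by
    have h : Icon.projections.map (𝟙 Icon.unit) (𝟙 A.toIcon) ≫ cubical unit A ≫
        homToIcon (projections.leftUnitor A).hom = Icon.projections.snd Icon.unit A.toIcon := by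
      rw [Projections.map_id, Strict.id_comp, Projections.leftUnitor_hom]
      exact cubical_snd unit A
    exact h
  right_unit A := by
    have h : Icon.projections.map (𝟙 A.toIcon) (𝟙 Icon.unit) ≫ cubical A unit ≫
        homToIcon (projections.rightUnitor A).hom = Icon.projections.fst A.toIcon Icon.unit := by
      rw [Projections.map_id, Strict.id_comp, Projections.rightUnitor_hom]
      exact cubical_fst A unit
    exact h

end GrayIcon
end GrayMon

theorem proposition5p4 :
    ∃ (MI : GrayMon.StronglyMonoidal GrayMon.Icon.{u} GrayMon.Icon.prod GrayMon.Icon.unit)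
      (MG : GrayMon.StronglyMonoidal GrayMon.GrayIcon.{u} GrayMon.GrayIcon.gray
        GrayMon.GrayIcon.unit)
      (L : GrayMon.CatLaxMonoidal MG MI GrayMon.GrayIcon.incl),
      GrayMon.Icon.IsCartesian MI ∧ L.ι = 𝟙 GrayMon.Icon.unit ∧
      ∀ A B : GrayMon.GrayIcon.{u}, L.χ A B = GrayMon.GrayIcon.cubical A B ∧
        GrayMon.GrayIcon.IsUniversalCubical (GrayMon.GrayIcon.cubical A B) :=
  ⟨_, _, GrayMon.GrayIcon.laxMonoidal, GrayMon.Icon.isCartesian_projections, rfl,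
    fun A B => ⟨rfl, GrayMon.GrayIcon.isUniversalCubical_cubical A B⟩⟩
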